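/- For a permutation $\pi\in S_n$, a peak is a position $i$ with $1<i<n$ and $\pi(i-1)<\pi(i)>\pi(i+1)$; let $p(\pi)$ be the number of peaks of $\pi$. For each $n\ge 1$ let $C_n$ be a conjugacy class of $S_n$, and let $\alpha_1(C_n)$ be the fraction of fixed points of each element of $C_n$, i.e. the number of its fixed points divided by $n$. Suppose that $\alpha_1(C_n)\to\alpha$ as $n\to\infty$ for some $\alpha\in[0,1]$, and that $\pi_n$ is chosen uniformly at random from $C_n$. Then, as $n\to\infty$, \[ \frac{p(\pi_n)-\frac{1-\alpha_1(C_n)^3}{3}\,n}{\sqrt n} \quad\text{converges in distribution to}\quad \mathcal N\!\left(0,\ \tfrac{2}{45}+\tfrac19\alpha^3-\tfrac35\alpha^5+\tfrac49\alpha^6\right), \] where $\mathcal N(0,0)$ denotes the point mass at $0$ (the case $\alpha=1$). -/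

import Mathlib

open MeasureTheory ProbabilityTheory Filter

/-- The finite set `S_n` carries the discrete σ-algebra. -/
instance instMeasurableSpacePermFin (n : ℕ) : MeasurableSpace (Equiv.Perm (Fin n)) := ⊤

/-- The number of peaks of `π`: positions `i` that have both a left neighbour `a` and a right
neighbour `b`, with `π a < π i > π b`. -/
def peaks {n : ℕ} (π : Equiv.Perm (Fin n)) : ℕ :=
  (Finset.univ.filter fun i : Fin n =>
    ∃ a b : Fin n, (a : ℕ) + 1 = i ∧ (i : ℕ) + 1 = b ∧ π a < π i ∧ π b < π i).card

/-- The number of fixed points of a permutation. -/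
def numFixedPoints {n : ℕ} (π : Equiv.Perm (Fin n)) : ℕ :=
  (Finset.univ.filter fun i : Fin n => π i = i).card

theorem numFixedPoints_eq_of_isConj {n : ℕ} {σ τ : Equiv.Perm (Fin n)} (h : IsConj σ τ) :
    numFixedPoints σ = numFixedPoints τ := by
  obtain ⟨c, rfl⟩ := isConj_iff.1 h
  refine Finset.card_bij (fun i _ => c i) ?_ ?_ ?_
  · intro i hi
    have h' : σ i = i := (Finset.mem_filter.1 hi).2
    exact Finset.mem_filter.2 ⟨Finset.mem_univ _, by simp [h']⟩
  · intro i _ j _ hij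
    exact c.injective hij
  · intro j hj
    have h' : (c * σ * c⁻¹) j = j := (Finset.mem_filter.1 hj).2
    refine ⟨c⁻¹ j, Finset.mem_filter.2 ⟨Finset.mem_univ _, ?_⟩, by simp⟩
    exact c.injective (by simpa using h')

/-- The common number of fixed points of the elements of a conjugacy class. -/
def classFixedPoints {n : ℕ} (C : ConjClasses (Equiv.Perm (Fin n))) : ℕ :=
  Quotient.lift numFixedPoints (fun _ _ h => numFixedPoints_eq_of_isConj h) C

/-- The fraction `α₁(C)` of fixed points of each element of a conjugacy class `C` of `S_n`. -/
noncomputable def fixedPointDensity {n : ℕ} (C : ConjClasses (Equiv.Perm (Fin n))) : ℝ :=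
  (classFixedPoints C : ℝ) / n

/-- The limiting variance as a function of the limiting density of fixed points. -/
noncomputable def peakVariance (α : ℝ) : ℝ :=
  2 / 45 + α ^ 3 / 9 - 3 / 5 * α ^ 5 + 4 / 9 * α ^ 6

theorem peakVariance_nonneg {α : ℝ} (hα : α ∈ Set.Icc (0 : ℝ) 1) : 0 ≤ peakVariance α := by
  obtain ⟨h0, h1⟩ := hα
  have h : peakVariance α =
      (1 - α) ^ 2 * (2 + 4 * α + 6 * α ^ 2 + 13 * α ^ 3 + 20 * α ^ 4) / 45 := by
    unfold peakVariance
    ring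
  rw [h]
  positivity

/-- The limiting variance as a nonnegative real, for a density in `[0, 1]`. -/
noncomputable def peakVarianceNN (α : ℝ) (hα : α ∈ Set.Icc (0 : ℝ) 1) : NNReal :=
  ⟨peakVariance α, peakVariance_nonneg hα⟩

/-! The mechanism is a double count of pairs (labelling with `q = 2 * a` letters, compatible
ranking). For a fixed ranking, conjugation turns `τ` into a permutation `π` of `Fin n`, and the
number of compatible labellings depends on `π` only through its number `p` of peaks: its generating
function is `2X(1+X)^m(4X)^p/(1-X)^(n+1)` with `m = n-1-2p` (`totalSeries_closed_form`). Normalised,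
this is `labelRatio a n m`.

For a fixed labelling, two compatible rankings differ by a label-preserving element of the
centralizer of `τ` (`IsCompatible.rankings_commute`). For most labellings only the fixed points of
`τ` leave any freedom, so the average number of rankings is close to the same count for the identity
on the `k` fixed points. Hence the class average of `labelRatio a n (n-1-2p)` is close to
`labelRatio a k (k-1)`, with relative error vanishing with `n / a` (`labelRatio_average_bounds`).

A change of measure in the binomial sum gives `labelRatio a k m ≈ exp (ratioExponent a k m)` as long
as `n^5 / a^4` stays bounded and `n / a → 0`. With `a ~ b n^(5/4)`, the difference of the two
exponents is `s W + c Q`, where `W` is the normalised peak count, `s → -1/(4b²)`, `c → 1/b⁴`, and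
`Q` is a bounded quadratic function of `p / n`. So `E exp(s W + c Q) → 1`. Since `Q` differs from a
constant by `O(|W|/√n)`, the tilt can be removed, and the Gaussian Laplace transform remains.

Only negative arguments are reached in this way. This suffices: convergence on a half-line to a
transform that tends to 1 at the origin gives tightness, and a law is determined by its Laplace
transform there, by analytic continuation. -/

/-! ### Weak convergence from Laplace transforms on the negative half-line -/

theorem exp_mul_le_one_add_exp_mul {s θ x : ℝ} (hs : s ≤ θ) (hθ : θ ≤ 0) :
    Real.exp (θ * x) ≤ 1 + Real.exp (s * x) := by
  rcases le_total 0 x with hx | hx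
  · have h1 : Real.exp (θ * x) ≤ 1 := by
      rw [Real.exp_le_one_iff]; exact mul_nonpos_of_nonpos_of_nonneg hθ hx
    linarith [Real.exp_pos (s * x)]
  · have h1 : Real.exp (θ * x) ≤ Real.exp (s * x) := by
      rw [Real.exp_le_exp]; exact mul_le_mul_of_nonpos_right hs hx
    linarith

theorem abs_mul_exp_mul_le {s θ x : ℝ} (hs : s < θ) (hθ : θ < 0) :
    |x| * Real.exp (θ * x) ≤ 1 / (-θ) + 1 / (θ - s) * Real.exp (s * x) := by
  have hs' : 0 < θ - s := by linarith
  have hθ' : 0 < -θ := by linarith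
  rcases le_total 0 x with hx | hx
  · rw [abs_of_nonneg hx]
    have h1 : (-θ) * x ≤ Real.exp ((-θ) * x) := by linarith [Real.add_one_le_exp ((-θ) * x)]
    have h2 : x * Real.exp (θ * x) ≤ 1 / (-θ) := by
      rw [le_div_iff₀ hθ']
      calc x * Real.exp (θ * x) * (-θ) = ((-θ) * x) * Real.exp (θ * x) := by ring
        _ ≤ Real.exp ((-θ) * x) * Real.exp (θ * x) := by gcongr
        _ = 1 := by rw [← Real.exp_add]; simp
    have : 0 ≤ 1 / (θ - s) * Real.exp (s * x) := by positivity
    linarith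
  · rw [abs_of_nonpos hx]
    have h1 : (θ - s) * (-x) ≤ Real.exp ((θ - s) * (-x)) := by
      linarith [Real.add_one_le_exp ((θ - s) * (-x))]
    have h2 : -x * Real.exp (θ * x) ≤ 1 / (θ - s) * Real.exp (s * x) := by
      rw [div_mul_eq_mul_div, one_mul, le_div_iff₀ hs']
      calc -x * Real.exp (θ * x) * (θ - s) = ((θ - s) * (-x)) * Real.exp (θ * x) := by ring
        _ ≤ Real.exp ((θ - s) * (-x)) * Real.exp (θ * x) := by gcongr
        _ = Real.exp (s * x) := by rw [← Real.exp_add]; ring_nf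
    have : 0 ≤ 1 / (-θ) := by positivity
    linarith

theorem abs_exp_sub_exp_le (u v : ℝ) :
    |Real.exp u - Real.exp v| ≤ |u - v| * (Real.exp u + Real.exp v) := by
  wlog h : v ≤ u generalizing u v
  · rw [abs_sub_comm, abs_sub_comm u v, add_comm (Real.exp u)]
    exact this v u (le_of_not_ge h)
  rw [abs_of_nonneg (by linarith [Real.exp_le_exp.2 h]), abs_of_nonneg (by linarith)]
  have h1 : 1 - Real.exp (v - u) ≤ u - v := by linarith [Real.add_one_le_exp (v - u)]
  have h2 : Real.exp v = Real.exp u * Real.exp (v - u) := by rw [← Real.exp_add]; ring_nf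
  have h3 : Real.exp u * (1 - Real.exp (v - u)) ≤ Real.exp u * (u - v) :=
    mul_le_mul_of_nonneg_left h1 (Real.exp_pos u).le
  have h4 : 0 ≤ (u - v) * Real.exp v := mul_nonneg (by linarith) (Real.exp_pos v).le
  nlinarith

theorem tendsto_complexMGF_boundary {μ : Measure ℝ} [IsProbabilityMeasure μ]
    (hμ : ∀ θ < 0, Integrable (fun x => Real.exp (θ * x)) μ) (t : ℝ) :
    Tendsto (fun θ : ℝ => complexMGF id μ (θ + t * Complex.I)) (nhdsWithin 0 (Set.Iio 0))
      (nhds (charFun μ t)) := by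
  rw [← complexMGF_id_mul_I]
  simp only [complexMGF, id]
  refine tendsto_integral_filter_of_dominated_convergence (fun x => 1 + Real.exp ((-1) * x))
    ?_ ?_ ?_ ?_
  · exact Eventually.of_forall fun θ => by fun_prop
  · have : ∀ᶠ θ : ℝ in nhdsWithin 0 (Set.Iio 0), -1 < θ ∧ θ < 0 := by
      have := Ioo_mem_nhdsLT (show (-1 : ℝ) < 0 by norm_num)
      exact this
    filter_upwards [this] with θ hθ
    refine Eventually.of_forall fun x => ?_
    rw [Complex.norm_exp]
    simpa using exp_mul_le_one_add_exp_mul (x := x) hθ.1.le hθ.2.le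
  · exact (integrable_const 1).add (hμ (-1) (by norm_num))
  · refine Eventually.of_forall fun x => ?_
    have : Continuous fun θ : ℝ => Complex.exp ((θ + t * Complex.I) * x) := by fun_prop
    have h := (this.tendsto 0).mono_left (nhdsWithin_le_nhds (s := Set.Iio 0))
    simpa using h

/-- Both transforms are analytic on the open left half-plane and agree on its real points, hence
everywhere there. The imaginary axis may lie on the boundary of the domain of analyticity, so the
characteristic functions are recovered as boundary values. -/
theorem measure_eq_of_mgf_eq_of_neg {μ ν : Measure ℝ} [IsProbabilityMeasure μ]
    [IsProbabilityMeasure ν] (hμ : ∀ θ < 0, Integrable (fun x => Real.exp (θ * x)) μ)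
    (hν : ∀ θ < 0, Integrable (fun x => Real.exp (θ * x)) ν)
    (h : ∀ θ < 0, mgf id μ θ = mgf id ν θ) : μ = ν := by
  have key : ∀ {μ : Measure ℝ}, (∀ θ < 0, Integrable (fun x => Real.exp (θ * x)) μ) →
      AnalyticOnNhd ℂ (complexMGF id μ) {z | z.re < 0} := by
    intro μ hμ
    refine analyticOnNhd_complexMGF.mono fun z hz => ?_
    have : Set.Iio (0 : ℝ) ⊆ integrableExpSet id μ := fun θ hθ => hμ θ hθ
    exact interior_mono this (by simpa using hz)
  have hpre : IsPreconnected {z : ℂ | z.re < 0} :=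
    ((convex_Iio (0 : ℝ)).linear_preimage Complex.reLm).isPreconnected
  have heq : Set.EqOn (complexMGF id μ) (complexMGF id ν) {z : ℂ | z.re < 0} := by
    refine (key hμ).eqOn_of_preconnected_of_frequently_eq (key hν) hpre
      (z₀ := ((-1 : ℝ) : ℂ)) (by simp) ?_
    have h_real : ∃ᶠ x : ℝ in nhdsWithin (-1) {-1}ᶜ, complexMGF id μ x = complexMGF id ν x := by
      have h1 : ∀ᶠ x : ℝ in nhdsWithin (-1) {-1}ᶜ, x < 0 :=
        nhdsWithin_le_nhds (Iio_mem_nhds (by norm_num))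
      refine Eventually.frequently ?_
      filter_upwards [h1] with x hx
      rw [complexMGF_ofReal, complexMGF_ofReal, h x hx]
    rw [frequently_iff_seq_forall] at h_real ⊢
    obtain ⟨xs, hx_tendsto, hx_eq⟩ := h_real
    refine ⟨fun n ↦ xs n, ?_, fun n ↦ ?_⟩
    · rw [tendsto_nhdsWithin_iff] at hx_tendsto ⊢
      constructor
      · exact (Complex.continuous_ofReal.tendsto _).comp hx_tendsto.1
      · refine hx_tendsto.2.mono fun n hn => ?_
        simp only [Set.mem_compl_iff, Set.mem_singleton_iff] at hn ⊢
        exact_mod_cast hn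
    · exact hx_eq n
  refine Measure.ext_of_charFun (funext fun t => ?_)
  refine tendsto_nhds_unique (tendsto_complexMGF_boundary hμ t)
    ((tendsto_complexMGF_boundary hν t).congr' ?_)
  filter_upwards [self_mem_nhdsWithin] with θ hθ
  exact (heq (by simpa using hθ)).symm

section Laplace

variable {μ : ℕ → Measure ℝ} [∀ n, IsProbabilityMeasure (μ n)]

theorem exists_eventually_integral_exp_le
    (hint : ∀ n θ, Integrable (fun x => Real.exp (θ * x)) (μ n)) {m : ℝ → ℝ}
    (h : ∀ θ < 0, ∃ s : ℕ → ℝ, Tendsto s atTop (nhds θ) ∧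
      Tendsto (fun n => ∫ x, Real.exp (s n * x) ∂(μ n)) atTop (nhds (m θ)))
    {θ : ℝ} (hθ : θ < 0) :
    ∃ K, ∀ᶠ n in atTop, ∫ x, Real.exp (θ * x) ∂(μ n) ≤ K := by
  obtain ⟨s, hs, hlim⟩ := h (θ - 1) (by linarith)
  refine ⟨1 + (m (θ - 1) + 1), ?_⟩
  filter_upwards [hs.eventually (gt_mem_nhds (show θ - 1 < θ by linarith)),
    hlim.eventually (gt_mem_nhds (show m (θ - 1) < m (θ - 1) + 1 by linarith))] with n h1 h2
  calc ∫ x, Real.exp (θ * x) ∂(μ n) ≤ ∫ x, (1 + Real.exp (s n * x)) ∂(μ n) :=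
        integral_mono (hint n θ) ((integrable_const 1).add (hint n _))
          fun x => exp_mul_le_one_add_exp_mul h1.le hθ.le
    _ = 1 + ∫ x, Real.exp (s n * x) ∂(μ n) := by
        rw [integral_add (integrable_const 1) (hint n _)]; simp
    _ ≤ _ := by linarith

/-- The argument that comes out of an integer scale `a` is only close to `θ`. Moving it to `θ` costs
`|s n - θ|` times a moment of `|x| * exp (σ * x)`, for `σ` near `θ`, which an exponential moment at
a more negative argument controls. -/
theorem tendsto_integral_exp_of_seq
    (hint : ∀ n θ, Integrable (fun x => Real.exp (θ * x)) (μ n)) {m : ℝ → ℝ}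
    (h : ∀ θ < 0, ∃ s : ℕ → ℝ, Tendsto s atTop (nhds θ) ∧
      Tendsto (fun n => ∫ x, Real.exp (s n * x) ∂(μ n)) atTop (nhds (m θ)))
    {θ : ℝ} (hθ : θ < 0) :
    Tendsto (fun n => ∫ x, Real.exp (θ * x) ∂(μ n)) atTop (nhds (m θ)) := by
  obtain ⟨s, hs, hlim⟩ := h θ hθ
  -- For `σ` in `[2θ, θ/2]` the argument `2θ - 1` lies at distance at least 1 below `σ`, which makes
  -- the bound `hb` uniform.
  obtain ⟨K, hK⟩ := exists_eventually_integral_exp_le hint h (θ := 2 * θ - 1) (by linarith)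
  refine tendsto_of_tendsto_of_dist hlim ?_
  have hD : Tendsto (fun n => |s n - θ| * (2 * (2 / (-θ) + K))) atTop (nhds 0) := by
    have := ((hs.sub_const θ).abs).mul_const (2 * (2 / (-θ) + K))
    simpa using this
  refine squeeze_zero' (Eventually.of_forall fun _ => dist_nonneg) ?_ hD
  filter_upwards [hK, hs.eventually (Ioo_mem_nhds (show 2 * θ < θ by linarith)
    (show θ < θ / 2 by linarith))] with n hKn hsn
  have hb : ∀ σ, 2 * θ ≤ σ → σ ≤ θ / 2 → ∀ x : ℝ, |x| * Real.exp (σ * x) ≤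
      2 / (-θ) + Real.exp ((2 * θ - 1) * x) := by
    intro σ h1 h2 x
    refine (abs_mul_exp_mul_le (s := 2 * θ - 1) (by linarith) (by linarith)).trans ?_
    have e1 : 1 / (-σ) ≤ 2 / (-θ) := by
      rw [div_le_div_iff₀ (by linarith) (by linarith)]; linarith
    have e2 : 1 / (σ - (2 * θ - 1)) ≤ 1 := by
      rw [div_le_one (by linarith)]; linarith
    have e3 := mul_le_mul_of_nonneg_right e2 (Real.exp_pos ((2 * θ - 1) * x)).le
    linarith
  rw [Real.dist_eq, ← integral_sub (hint n _) (hint n _)]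
  calc |∫ x, (Real.exp (s n * x) - Real.exp (θ * x)) ∂(μ n)|
      ≤ ∫ x, |Real.exp (s n * x) - Real.exp (θ * x)| ∂(μ n) := abs_integral_le_integral_abs
    _ ≤ ∫ x, |s n - θ| * (2 * (2 / (-θ) + Real.exp ((2 * θ - 1) * x))) ∂(μ n) := by
        refine integral_mono ((hint n _).sub (hint n _)).abs
          ((((integrable_const _).add (hint n _)).const_mul 2).const_mul _) fun x => ?_
        have h1 := abs_exp_sub_exp_le (s n * x) (θ * x)
        have h2 := hb (s n) hsn.1.le hsn.2.le x
        have h3 := hb θ (by linarith) (by linarith) x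
        rw [← sub_mul, abs_mul] at h1
        calc |Real.exp (s n * x) - Real.exp (θ * x)|
            ≤ |s n - θ| * (|x| * Real.exp (s n * x) + |x| * Real.exp (θ * x)) := by
              linarith
          _ ≤ |s n - θ| * (2 * (2 / (-θ) + Real.exp ((2 * θ - 1) * x))) := by
              gcongr; linarith
    _ = |s n - θ| * (2 * (2 / (-θ) + ∫ x, Real.exp ((2 * θ - 1) * x) ∂(μ n))) := by
        rw [integral_const_mul, integral_const_mul, integral_add (integrable_const _) (hint n _)]
        simp
    _ ≤ _ := by gcongr

/-- Markov's inequality for `(exp (θ * x) - 1) ^ 2`: it controls both tails at once, being at least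
1/4 when `|θ * x| > 1`, and its mean tends to `m (2θ) - 2 m θ + 1`, which is small for `θ` near 0.
-/
theorem isTightMeasureSet_range_of_tendsto_integral_exp
    (hint : ∀ n θ, Integrable (fun x => Real.exp (θ * x)) (μ n)) {m : ℝ → ℝ}
    (hm : Tendsto m (nhdsWithin 0 (Set.Iio 0)) (nhds 1))
    (h : ∀ θ < 0, Tendsto (fun n => ∫ x, Real.exp (θ * x) ∂(μ n)) atTop (nhds (m θ))) :
    IsTightMeasureSet (Set.range μ) := by
  refine isTightMeasureSet_range_of_tendsto_limsup_measure_norm_gt ?_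
  rw [ENNReal.tendsto_nhds_zero]
  intro ε hε
  obtain ⟨δ, hδ0, hδε⟩ : ∃ δ : ℝ, 0 < δ ∧ ENNReal.ofReal δ ≤ ε := by
    rcases eq_or_ne ε ⊤ with rfl | hε'
    · exact ⟨1, one_pos, le_top⟩
    · exact ⟨ε.toReal, ENNReal.toReal_pos hε.ne' hε', by rw [ENNReal.ofReal_toReal hε']⟩
  have hm2 : Tendsto (fun θ => 4 * (m (2 * θ) - 2 * m θ + 1)) (nhdsWithin 0 (Set.Iio 0))
      (nhds 0) := by
    have h2 : Tendsto (fun θ : ℝ => 2 * θ) (nhdsWithin 0 (Set.Iio 0))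
        (nhdsWithin 0 (Set.Iio 0)) := by
      refine tendsto_nhdsWithin_iff.2 ⟨?_, ?_⟩
      · have : Continuous fun θ : ℝ => 2 * θ := by fun_prop
        simpa using (this.tendsto 0).mono_left nhdsWithin_le_nhds
      · filter_upwards [self_mem_nhdsWithin] with θ hθ
        simp only [Set.mem_Iio] at hθ ⊢; linarith
    have := (((hm.comp h2).sub (hm.const_mul 2)).add_const 1).const_mul 4
    norm_num at this
    exact this
  obtain ⟨θ, hθlt, hθ0⟩ : ∃ θ, 4 * (m (2 * θ) - 2 * m θ + 1) < δ ∧ θ < 0 :=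
    ((hm2.eventually (gt_mem_nhds hδ0)).and self_mem_nhdsWithin).exists
  have hlim : Tendsto (fun n => 4 * ∫ x, (Real.exp (θ * x) - 1) ^ 2 ∂(μ n)) atTop
      (nhds (4 * (m (2 * θ) - 2 * m θ + 1))) := by
    have : ∀ n, ∫ x, (Real.exp (θ * x) - 1) ^ 2 ∂(μ n) =
        ∫ x, Real.exp (2 * θ * x) ∂(μ n) - 2 * ∫ x, Real.exp (θ * x) ∂(μ n) + 1 := by
      intro n
      have e : ∀ x : ℝ, (Real.exp (θ * x) - 1) ^ 2 =
          Real.exp (2 * θ * x) - 2 * Real.exp (θ * x) + 1 := by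
        intro x
        have : Real.exp (2 * θ * x) = Real.exp (θ * x) ^ 2 := by
          rw [← Real.exp_nat_mul]; push_cast; ring_nf
        rw [this]; ring
      simp_rw [e]
      have i1 : Integrable (fun x => Real.exp (2 * θ * x) - 2 * Real.exp (θ * x)) (μ n) :=
        (hint n _).sub ((hint n _).const_mul 2)
      rw [integral_add i1 (integrable_const 1),
        integral_sub (hint n _) ((hint n _).const_mul 2), integral_const_mul]
      simp
    simp_rw [this]
    exact (((h (2 * θ) (by linarith)).sub ((h θ hθ0).const_mul 2)).add_const 1).const_mul 4
  filter_upwards [eventually_ge_atTop (1 / (-θ))] with r hr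
  refine (limsup_le_of_le (a := ENNReal.ofReal δ) (by isBoundedDefault) ?_).trans hδε
  filter_upwards [hlim.eventually (gt_mem_nhds hθlt)] with n hn
  have hint2 : Integrable (fun x => (Real.exp (θ * x) - 1) ^ 2) (μ n) := by
    have e : (fun x : ℝ => (Real.exp (θ * x) - 1) ^ 2) =
        fun x => Real.exp (2 * θ * x) - 2 * Real.exp (θ * x) + 1 := by
      funext x
      have : Real.exp (2 * θ * x) = Real.exp (θ * x) ^ 2 := by
        rw [← Real.exp_nat_mul]; push_cast; ring_nf
      rw [this]; ring
    rw [e]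
    exact ((hint n _).sub ((hint n _).const_mul 2)).add (integrable_const 1)
  have hmark := mul_meas_ge_le_integral_of_nonneg (μ := μ n)
    (Eventually.of_forall fun x => sq_nonneg (Real.exp (θ * x) - 1)) hint2 (1 / 4)
  have hsub : {x : ℝ | r < ‖x‖} ⊆ {x | 1 / 4 ≤ (Real.exp (θ * x) - 1) ^ 2} := by
    intro x hx
    simp only [Set.mem_ofPred_eq, Real.norm_eq_abs] at hx ⊢
    have hx' : 1 < -θ * |x| := by
      have h1 : 1 / (-θ) < |x| := lt_of_le_of_lt hr hx
      rw [div_lt_iff₀ (by linarith)] at h1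
      linarith
    have he : (2 : ℝ) ≤ Real.exp 1 := by linarith [Real.add_one_le_exp 1]
    rcases le_total 0 x with h0 | h0
    · rw [abs_of_nonneg h0] at hx'
      have h1 : Real.exp (θ * x) ≤ Real.exp (-1) := Real.exp_le_exp.2 (by linarith)
      have h2 : Real.exp (-1) ≤ 1 / 2 := by
        rw [Real.exp_neg, inv_eq_one_div]
        exact one_div_le_one_div_of_le (by norm_num) he
      nlinarith
    · rw [abs_of_nonpos h0] at hx'
      have h1 : Real.exp 1 ≤ Real.exp (θ * x) := Real.exp_le_exp.2 (by linarith)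
      nlinarith
  have hreal : (μ n).real {x : ℝ | r < ‖x‖} ≤ δ := by
    have h1 : (μ n).real {x : ℝ | r < ‖x‖} ≤
        (μ n).real {x | 1 / 4 ≤ (Real.exp (θ * x) - 1) ^ 2} := measureReal_mono hsub
    linarith
  rw [← ENNReal.ofReal_toReal (measure_ne_top (μ n) _)]
  exact ENNReal.ofReal_le_ofReal hreal

/-- A bound at `2θ` is a second moment bound for `exp (θ * x)`, hence uniform integrability:
truncating at `B` costs at most `K / B`, and the truncated function is bounded and continuous. -/
theorem tendsto_integral_exp_of_tendsto_ultrafilter {U : Ultrafilter ℕ}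
    {ν : ℕ → ProbabilityMeasure ℝ} {ν' : ProbabilityMeasure ℝ}
    (hν : Tendsto ν U (nhds ν'))
    (hint : ∀ n θ, Integrable (fun x => Real.exp (θ * x)) (ν n : Measure ℝ)) {θ K : ℝ}
    (hK : ∀ᶠ n in U, ∫ x, Real.exp (2 * θ * x) ∂(ν n : Measure ℝ) ≤ K) :
    Integrable (fun x => Real.exp (θ * x)) (ν' : Measure ℝ) ∧
    Tendsto (fun n => ∫ x, Real.exp (θ * x) ∂(ν n : Measure ℝ)) U
      (nhds (∫ x, Real.exp (θ * x) ∂(ν' : Measure ℝ))) := by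
  have hK0 : 0 ≤ K := by
    obtain ⟨n, hn⟩ := hK.exists
    exact (integral_nonneg fun x => (Real.exp_pos _).le).trans hn
  have hmeas : Measurable fun x : ℝ => Real.exp (θ * x) := by fun_prop
  have hcut : ∀ B : ℕ, Tendsto (fun n => ∫ x, min (Real.exp (θ * x)) B ∂(ν n : Measure ℝ)) U
      (nhds (∫ x, min (Real.exp (θ * x)) B ∂(ν' : Measure ℝ))) := by
    intro B
    have hc : Continuous fun x : ℝ => min (Real.exp (θ * x)) (B : ℝ) := by fun_prop
    let g : BoundedContinuousFunction ℝ ℝ :=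
      BoundedContinuousFunction.ofNormedAddCommGroup _ hc B fun x => by
        rw [Real.norm_eq_abs, abs_of_nonneg (le_min (Real.exp_pos _).le (Nat.cast_nonneg _))]
        exact min_le_right _ _
    exact (ProbabilityMeasure.tendsto_iff_forall_integral_tendsto.1 hν) g
  have hcut_int : ∀ (B : ℕ) (ρ : ProbabilityMeasure ℝ),
      Integrable (fun x => min (Real.exp (θ * x)) (B : ℝ)) (ρ : Measure ℝ) := by
    intro B ρ
    refine Integrable.mono' (integrable_const (B : ℝ)) (by fun_prop)
      (Eventually.of_forall fun x => ?_)
    rw [Real.norm_eq_abs, abs_of_nonneg (le_min (Real.exp_pos _).le (Nat.cast_nonneg _))]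
    exact min_le_right _ _
  have hpt : ∀ x : ℝ, Tendsto (fun B : ℕ => min (Real.exp (θ * x)) (B : ℝ)) atTop
      (nhds (Real.exp (θ * x))) := by
    intro x
    refine tendsto_const_nhds.congr' ?_
    filter_upwards [tendsto_natCast_atTop_atTop.eventually_ge_atTop (Real.exp (θ * x))] with B hB
    rw [min_eq_left hB]
  have hbound : ∀ B : ℕ, ∫ x, min (Real.exp (θ * x)) B ∂(ν' : Measure ℝ) ≤ 1 + K := by
    intro B
    refine le_of_tendsto (hcut B) ?_
    filter_upwards [hK] with n hn
    calc ∫ x, min (Real.exp (θ * x)) B ∂(ν n : Measure ℝ)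
        ≤ ∫ x, (1 + Real.exp (2 * θ * x)) ∂(ν n : Measure ℝ) := by
          refine integral_mono (hcut_int B _) ((integrable_const 1).add (hint n _)) fun x => ?_
          refine (min_le_left _ _).trans ?_
          have : Real.exp (2 * θ * x) = Real.exp (θ * x) ^ 2 := by
            rw [← Real.exp_nat_mul]; push_cast; ring_nf
          simp only [this]
          nlinarith [sq_nonneg (Real.exp (θ * x) - 1), Real.exp_pos (θ * x)]
      _ = 1 + ∫ x, Real.exp (2 * θ * x) ∂(ν n : Measure ℝ) := by
          rw [integral_add (integrable_const 1) (hint n _)]; simp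
      _ ≤ 1 + K := by linarith
  have hI : Integrable (fun x => Real.exp (θ * x)) (ν' : Measure ℝ) := by
    refine ⟨hmeas.aestronglyMeasurable, ?_⟩
    rw [hasFiniteIntegral_iff_ofReal (Eventually.of_forall fun x => (Real.exp_pos _).le)]
    have h1 : ∀ x : ℝ, ENNReal.ofReal (Real.exp (θ * x)) =
        liminf (fun B : ℕ => ENNReal.ofReal (min (Real.exp (θ * x)) (B : ℝ))) atTop := fun x =>
      ((ENNReal.tendsto_ofReal (hpt x)).liminf_eq).symm
    simp_rw [h1]
    refine (lintegral_liminf_le fun B => by fun_prop).trans_lt ?_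
    refine lt_of_le_of_lt (b := ENNReal.ofReal (1 + K)) ?_ ENNReal.ofReal_lt_top
    refine liminf_le_of_le (by isBoundedDefault) fun b hb => ?_
    obtain ⟨B, hB⟩ := hb.exists
    refine hB.trans ?_
    rw [← ofReal_integral_eq_lintegral_ofReal (hcut_int B ν')
      (Eventually.of_forall fun x => le_min (Real.exp_pos _).le (Nat.cast_nonneg _))]
    exact ENNReal.ofReal_le_ofReal (hbound B)
  refine ⟨hI, ?_⟩
  have hcut' : Tendsto (fun B : ℕ => ∫ x, min (Real.exp (θ * x)) B ∂(ν' : Measure ℝ)) atTop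
      (nhds (∫ x, Real.exp (θ * x) ∂(ν' : Measure ℝ))) := by
    refine tendsto_integral_of_dominated_convergence (fun x => Real.exp (θ * x))
      (fun B => (hcut_int B ν').aestronglyMeasurable) hI (fun B => Eventually.of_forall fun x => ?_)
      (Eventually.of_forall hpt)
    rw [Real.norm_eq_abs, abs_of_nonneg (le_min (Real.exp_pos _).le (Nat.cast_nonneg _))]
    exact min_le_left _ _
  rw [Metric.tendsto_nhds]
  intro ε hε
  have hKB : Tendsto (fun B : ℕ => K / B) atTop (nhds 0) := tendsto_const_div_atTop_nhds_zero_nat K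
  obtain ⟨B, hB1, hB2, hB3⟩ := ((hKB.eventually (gt_mem_nhds (show 0 < ε / 3 by positivity))).and
    (((Metric.tendsto_nhds.1 hcut') (ε / 3) (by positivity)).and
      (eventually_gt_atTop 0))).exists
  have hB3' : (0 : ℝ) < B := by exact_mod_cast hB3
  filter_upwards [hK, (Metric.tendsto_nhds.1 (hcut B)) (ε / 3) (by positivity)] with n hn hcn
  have hdiff : |∫ x, Real.exp (θ * x) ∂(ν n : Measure ℝ) -
      ∫ x, min (Real.exp (θ * x)) B ∂(ν n : Measure ℝ)| ≤ K / B := by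
    rw [← integral_sub (hint n _) (hcut_int B _), abs_of_nonneg
      (integral_nonneg fun x => sub_nonneg.2 (min_le_left _ _))]
    calc ∫ x, (Real.exp (θ * x) - min (Real.exp (θ * x)) B) ∂(ν n : Measure ℝ)
        ≤ ∫ x, Real.exp (2 * θ * x) / B ∂(ν n : Measure ℝ) := by
          refine integral_mono ((hint n _).sub (hcut_int B _)) ((hint n _).div_const _) fun x => ?_
          have : Real.exp (2 * θ * x) = Real.exp (θ * x) ^ 2 := by
            rw [← Real.exp_nat_mul]; push_cast; ring_nf
          simp only [this]
          rw [le_div_iff₀ hB3']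
          have hp := Real.exp_pos (θ * x)
          rcases le_total (Real.exp (θ * x)) B with h | h
          · rw [min_eq_left h]; nlinarith
          · rw [min_eq_right h]; nlinarith
      _ = (∫ x, Real.exp (2 * θ * x) ∂(ν n : Measure ℝ)) / B := integral_div _ _
      _ ≤ K / B := by gcongr
  rw [Real.dist_eq] at hB2 hcn ⊢
  rw [abs_lt] at *
  rw [abs_le] at hdiff
  constructor <;> linarith [hB2.1, hB2.2, hcn.1, hcn.2, hdiff.1, hdiff.2]

/-- Convergence of Laplace transforms on the negative half-line, along slightly perturbed
arguments, to those of a Gaussian implies weak convergence. -/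
theorem tendsto_gaussianReal_of_tendsto_integral_exp {ν : ℕ → ProbabilityMeasure ℝ} {v : NNReal}
    (hint : ∀ n θ, Integrable (fun x => Real.exp (θ * x)) (ν n : Measure ℝ))
    (h : ∀ θ < 0, ∃ s : ℕ → ℝ, Tendsto s atTop (nhds θ) ∧
      Tendsto (fun n => ∫ x, Real.exp (s n * x) ∂(ν n : Measure ℝ)) atTop
        (nhds (Real.exp (v * θ ^ 2 / 2)))) :
    Tendsto ν atTop (nhds (⟨gaussianReal 0 v, inferInstance⟩ : ProbabilityMeasure ℝ)) := by
  have h' : ∀ θ < 0, Tendsto (fun n => ∫ x, Real.exp (θ * x) ∂(ν n : Measure ℝ)) atTop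
      (nhds (Real.exp (v * θ ^ 2 / 2))) := fun θ hθ =>
    tendsto_integral_exp_of_seq (m := fun θ => Real.exp (v * θ ^ 2 / 2)) hint h hθ
  have htight : IsTightMeasureSet (Set.range fun n => (ν n : Measure ℝ)) := by
    refine isTightMeasureSet_range_of_tendsto_integral_exp hint ?_ h'
    have hc : Continuous fun θ : ℝ => Real.exp (v * θ ^ 2 / 2) := by fun_prop
    simpa using (hc.tendsto 0).mono_left (nhdsWithin_le_nhds (s := Set.Iio 0))
  -- By tightness every ultrafilter finer than `atTop` has a limit law; its Laplace transform on the
  -- negative half-line identifies it.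
  refine (Filter.tendsto_iff_ultrafilter _ _ _).2 fun U hU ↦ ?_
  have h_compact : IsCompact (closure (Set.range ν)) := by
    refine isCompact_closure_of_isTightMeasureSet (htight.subset ?_)
    rintro _ ⟨_, ⟨n, rfl⟩, rfl⟩
    exact ⟨n, rfl⟩
  obtain ⟨ν', -, hν' : Tendsto ν U (nhds ν')⟩ := h_compact.ultrafilter_le_nhds (U.map ν)
    (.trans (by simp) (monotone_principal subset_closure))
  have hlap : ∀ θ < 0, Integrable (fun x => Real.exp (θ * x)) (ν' : Measure ℝ) ∧
      ∫ x, Real.exp (θ * x) ∂(ν' : Measure ℝ) = Real.exp (v * θ ^ 2 / 2) := by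
    intro θ hθ
    have hK : ∀ᶠ n in U, ∫ x, Real.exp (2 * θ * x) ∂(ν n : Measure ℝ) ≤
        Real.exp (v * (2 * θ) ^ 2 / 2) + 1 :=
      hU (((h' (2 * θ) (by linarith)).eventually (gt_mem_nhds (lt_add_one _))).mono
        fun n hn => hn.le)
    obtain ⟨h1, h2⟩ := tendsto_integral_exp_of_tendsto_ultrafilter hν' hint hK
    exact ⟨h1, tendsto_nhds_unique h2 ((h' θ hθ).mono_left hU)⟩
  have heq : (ν' : Measure ℝ) = gaussianReal 0 v := by
    refine measure_eq_of_mgf_eq_of_neg (fun θ hθ => (hlap θ hθ).1)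
      (fun θ _ => integrable_exp_mul_gaussianReal θ) fun θ hθ => ?_
    rw [mgf_id_gaussianReal]
    simpa [mgf] using (hlap θ hθ).2
  have : ν' = ⟨gaussianReal 0 v, inferInstance⟩ := Subtype.ext heq
  rwa [← this]

end Laplace


/-! ### Compatible labellings of a permutation are counted by its peaks -/

/-- The ranking `r` of the points and the labelling `ℓ` are compatible with `τ`: points are ranked
by their labels, ties at odd labels are broken by the ranks of the images under `τ`, and ties at
even labels by the reverse order of these ranks. -/
def IsCompatible {X : Type*} {N q : ℕ} (τ : Equiv.Perm X) (ℓ : X → Fin q) (r : X ≃ Fin N) : Prop :=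
  ∀ x y, r x < r y → ℓ x < ℓ y ∨
    (ℓ x = ℓ y ∧ if Even (ℓ x : ℕ) then r (τ y) < r (τ x) else r (τ x) < r (τ y))

/-- The number of labellings with `q` letters compatible with `π` in the natural order. -/
noncomputable def compatibleCount {n : ℕ} (q : ℕ) (π : Equiv.Perm (Fin n)) : ℕ :=
  Nat.card {f : Fin n → Fin q // IsCompatible π f (Equiv.refl _)}

section PrefixCount

open PowerSeries

/-- The number of words of `i + 1` letters in `ℕ` ending in a given letter, weakly increasing, with
equality in slot `s` only at even letters if `D s` and only at odd letters otherwise. -/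
def prefixCount (D : ℕ → Prop) [DecidablePred D] : ℕ → ℕ → ℕ
  | 0, _ => 1
  | i + 1, g => ∑ h ∈ Finset.range g, prefixCount D i h +
      if (Even g ↔ D i) then prefixCount D i g else 0

/-- The words counted by `prefixCount`. -/
def IsPatternWord (D : ℕ → Prop) {i q : ℕ} (f : Fin (i + 1) → Fin q) : Prop :=
  ∀ s : Fin i, f s.castSucc < f s.succ ∨
    (f s.castSucc = f s.succ ∧ (Even (f s.castSucc : ℕ) ↔ D s))

theorem isPatternWord_snoc (D : ℕ → Prop) {i q : ℕ} (f : Fin (i + 1) → Fin q) (x : Fin q) :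
    IsPatternWord D (Fin.snoc f x : Fin (i + 2) → Fin q) ↔ IsPatternWord D f ∧
      (f (Fin.last i) < x ∨ (f (Fin.last i) = x ∧ (Even (x : ℕ) ↔ D i))) := by
  unfold IsPatternWord
  rw [Fin.forall_fin_succ']
  refine and_congr (forall_congr' fun s => ?_) ?_
  · rw [← Fin.castSucc_succ]
    simp only [Fin.snoc_castSucc, Fin.val_castSucc]
  · simp only [Fin.snoc_castSucc, Fin.succ_last, Fin.snoc_last, Fin.val_last]
    constructor <;> rintro (h | ⟨h, h'⟩)
    · exact Or.inl h
    · exact Or.inr ⟨h, h ▸ h'⟩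
    · exact Or.inl h
    · exact Or.inr ⟨h, h ▸ h'⟩

variable (D : ℕ → Prop) [DecidablePred D]

open Classical in
theorem sum_isPatternWord_last (q i : ℕ) (g : Fin q) :
    (∑ f : Fin (i + 1) → Fin q, if IsPatternWord D f ∧ f (Fin.last i) = g then 1 else 0) =
      prefixCount D i g := by
  induction i generalizing g with
  | zero =>
    simp only [prefixCount]
    rw [Finset.sum_eq_single (fun _ => g)]
    · rw [if_pos]; exact ⟨fun s => s.elim0, rfl⟩
    · intro f _ hf
      rw [if_neg]
      rintro ⟨-, h⟩
      exact hf (funext fun s => by rw [← h]; congr; exact Fin.ext (by simp))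
    · simp
  | succ i ih =>
    rw [← (Fin.snocEquiv (fun _ => Fin q)).sum_comp, Fintype.sum_prod_type]
    simp only [Fin.snocEquiv, Equiv.coe_fn_mk]
    simp_rw [isPatternWord_snoc]
    simp only [Fin.snoc_last]
    rw [Finset.sum_eq_single g (fun x _ hx => Finset.sum_eq_zero fun f _ => if_neg fun h => hx h.2)
      (by simp)]
    simp only [and_true, prefixCount]
    have h1 : ∀ f : Fin (i + 1) → Fin q,
        (if IsPatternWord D f ∧ (f (Fin.last i) < g ∨ (f (Fin.last i) = g ∧ (Even (g : ℕ) ↔ D i)))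
          then 1 else 0) =
        ∑ h : Fin q, (if h < g ∨ (h = g ∧ (Even (g : ℕ) ↔ D i)) then
          (if IsPatternWord D f ∧ f (Fin.last i) = h then 1 else 0) else 0) := by
      intro f
      rw [Finset.sum_eq_single (f (Fin.last i))]
      · by_cases hc : IsPatternWord D f <;> simp [hc]
      · intro h _ hh
        have : ¬ (IsPatternWord D f ∧ f (Fin.last i) = h) := fun h' => hh h'.2.symm
        simp [this]
      · simp
    simp_rw [h1]
    rw [Finset.sum_comm]
    have h2 : ∀ h : Fin q, (∑ f : Fin (i + 1) → Fin q,
        (if h < g ∨ (h = g ∧ (Even (g : ℕ) ↔ D i)) then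
          (if IsPatternWord D f ∧ f (Fin.last i) = h then 1 else 0) else 0)) =
        (if (h : ℕ) < g then prefixCount D i h else 0) +
          (if (h : ℕ) = g then (if (Even (g : ℕ) ↔ D i) then prefixCount D i g else 0) else 0) := by
      intro h
      by_cases hlt : h < g
      · have : (h : ℕ) ≠ g := ne_of_lt hlt
        simp only [hlt, true_or, if_true, ih, this, if_false, Fin.lt_def.1 hlt, add_zero]
      · by_cases heq : h = g
        · subst heq
          by_cases hD : (Even (h : ℕ) ↔ D i) <;> simp [hD, ih]
        · have h3 : ¬ (h : ℕ) < g := hlt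
          have h4 : ¬ (h : ℕ) = g := fun h' => heq (Fin.ext h')
          simp [hlt, heq, h3, h4]
    simp_rw [h2]
    rw [Finset.sum_add_distrib]
    congr 1
    · rw [Fin.sum_univ_eq_sum_range (fun h => if h < (g : ℕ) then prefixCount D i h else 0) q,
        ← Finset.sum_filter]
      congr 1
      ext h
      simp only [Finset.mem_filter, Finset.mem_range]
      have := g.2
      omega
    · rw [Finset.sum_eq_single g]
      · simp
      · intro h _ hh
        rw [if_neg (fun h' => hh (Fin.ext h'))]
      · simp

theorem card_isPatternWord (q i : ℕ) :
    Nat.card {f : Fin (i + 1) → Fin q // IsPatternWord D f} =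
      ∑ g ∈ Finset.range q, prefixCount D i g := by
  classical
  rw [← Fin.sum_univ_eq_sum_range]
  simp_rw [← sum_isPatternWord_last D q i]
  rw [Finset.sum_comm, Nat.card_eq_fintype_card, Fintype.card_subtype, Finset.card_filter]
  refine Finset.sum_congr rfl fun f _ => ?_
  by_cases hf : IsPatternWord D f <;> simp [hf]

/-- Generating function of the number of words with letters below `2 * a`. -/
noncomputable def totalSeries (i : ℕ) : PowerSeries ℤ :=
  PowerSeries.mk fun a => ((∑ g ∈ Finset.range (2 * a), prefixCount D i g : ℕ) : ℤ)

/-- Generating function of the number of words ending in the even letter `2 * v`. -/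
noncomputable def evenSeries (i : ℕ) : PowerSeries ℤ :=
  PowerSeries.mk fun v => (prefixCount D i (2 * v) : ℤ)

/-- Generating function of the number of words ending in the odd letter `2 * v + 1`. -/
noncomputable def oddSeries (i : ℕ) : PowerSeries ℤ :=
  PowerSeries.mk fun v => (prefixCount D i (2 * v + 1) : ℤ)

theorem one_sub_X_mul_totalSeries (i : ℕ) :
    (1 - X) * totalSeries D i = X * (oddSeries D i + evenSeries D i) := by
  ext a
  cases a with
  | zero => simp [totalSeries, sub_mul]
  | succ a =>
    rw [sub_mul, one_mul, map_sub, coeff_succ_X_mul, coeff_succ_X_mul, map_add]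
    simp only [totalSeries, oddSeries, evenSeries, coeff_mk]
    rw [show 2 * (a + 1) = 2 * a + 1 + 1 by ring, Finset.sum_range_succ, Finset.sum_range_succ]
    push_cast; ring

/-- In this and the next three lemmas, the letters allowed before `g` are those below `g`, plus `g`
itself when its parity fits the slot. At an ascent the thresholds for `2v` and `2v+1` are `2v` and
`2(v+1)`, a shift of the total; at a descent both are `2v+1`. -/
theorem evenSeries_succ_of_asc {i : ℕ} (h : ¬ D i) : evenSeries D (i + 1) = totalSeries D i := by
  ext v
  simp [evenSeries, totalSeries, prefixCount, h]

theorem oddSeries_succ_of_asc {i : ℕ} (h : ¬ D i) : X * oddSeries D (i + 1) = totalSeries D i := by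
  ext v
  cases v with
  | zero => simp [totalSeries]
  | succ v =>
    rw [coeff_succ_X_mul]
    simp only [oddSeries, totalSeries, prefixCount, coeff_mk, h, iff_false]
    rw [if_pos (by simp), show 2 * (v + 1) = 2 * v + 1 + 1 by ring, ← Finset.sum_range_succ]

theorem evenSeries_succ_of_desc {i : ℕ} (h : D i) :
    evenSeries D (i + 1) = totalSeries D i + evenSeries D i := by
  ext v
  simp [evenSeries, totalSeries, prefixCount, h]

theorem oddSeries_succ_of_desc {i : ℕ} (h : D i) :
    oddSeries D (i + 1) = totalSeries D i + evenSeries D i := by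
  ext v
  simp [evenSeries, oddSeries, totalSeries, prefixCount, h, Finset.sum_range_succ]

/-- The number of slots `s < i` with `D s` that are preceded by a slot without `D`. -/
def patternPeaks (i : ℕ) : ℕ := ((Finset.range i).filter fun s => 0 < s ∧ ¬ D (s - 1) ∧ D s).card

theorem patternPeaks_succ (i : ℕ) : patternPeaks D (i + 1) =
    patternPeaks D i + if (0 < i ∧ ¬ D (i - 1) ∧ D i) then 1 else 0 := by
  unfold patternPeaks
  rw [Finset.range_add_one, Finset.filter_insert]
  split_ifs with h
  · rw [Finset.card_insert_of_notMem (by simp)]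
  · rfl

theorem one_add_X_ne_zero : (1 + X : PowerSeries ℤ) ≠ 0 := by
  intro h
  have := congrArg (coeff 0) h
  simp at this

/-- A slot multiplies the total by `(1+X)/(1-X)`, except a descent just after an ascent, which
multiplies it by `4X/((1-X)(1+X))`: a peak trades a factor `1+X` for `4X`. The last two clauses
carry the state of the induction, namely the share of words ending in an even letter, which depends
only on the type of the last slot. The empty pattern behaves as if it ended in a descent. -/
theorem totalSeries_closed_form (i : ℕ) :
    ∃ m, m + 2 * patternPeaks D i = i ∧
      (1 - X) ^ (i + 2) * totalSeries D i = 2 * X * (1 + X) ^ m * (4 * X) ^ patternPeaks D i ∧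
      ((i = 0 ∨ D (i - 1)) → 2 * X * evenSeries D i = (1 - X) * totalSeries D i) ∧
      ((0 < i ∧ ¬ D (i - 1)) → (1 + X) * evenSeries D i = (1 - X) * totalSeries D i ∧ 1 ≤ m) := by
  induction i with
  | zero =>
    have h1 : oddSeries D 0 = evenSeries D 0 := by ext v; simp [oddSeries, evenSeries, prefixCount]
    have h2 : (1 - X) * evenSeries D 0 = 1 := by
      have : evenSeries D 0 = PowerSeries.mk 1 := by ext v; simp [evenSeries, prefixCount]
      rw [this, mul_comm]; exact PowerSeries.mk_one_mul_one_sub_eq_one ℤ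
    have h3 := one_sub_X_mul_totalSeries D 0
    rw [h1] at h3
    refine ⟨0, by simp [patternPeaks], ?_, fun _ => by rw [h3]; ring, fun h => absurd h.1 (by simp)⟩
    simp only [patternPeaks, Finset.range_zero, Finset.filter_empty, Finset.card_empty, pow_zero,
      mul_one, zero_add]
    rw [pow_two, mul_assoc, h3]
    linear_combination (2 * X) * h2
  | succ i ih =>
    obtain ⟨m, hm, hA, hd, ha⟩ := ih
    have h3 := one_sub_X_mul_totalSeries D (i + 1)
    by_cases hD : D i
    · rw [oddSeries_succ_of_desc D hD, evenSeries_succ_of_desc D hD] at h3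
      by_cases hprev : 0 < i ∧ ¬ D (i - 1)
      · obtain ⟨h4, h5⟩ := ha hprev
        obtain ⟨m, rfl⟩ : ∃ m', m = m' + 1 := ⟨m - 1, by omega⟩
        have hp : patternPeaks D (i + 1) = patternPeaks D i + 1 := by
          rw [patternPeaks_succ, if_pos ⟨hprev.1, hprev.2, hD⟩]
        refine ⟨m, by omega, ?_, fun _ => ?_, fun h => absurd hD (by simpa using h.2)⟩
        · rw [hp]
          -- The relation `h4` after an ascent determines `evenSeries` only up to the factor `1+X`.
          -- The preceding ascent has supplied such a factor, which is the clause `1 ≤ m`.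
          refine mul_left_cancel₀ one_add_X_ne_zero ?_
          linear_combination (1 - X) ^ (i + 2) * (1 + X) * h3 + (1 - X) ^ (i + 2) * 2 * X * h4 +
            4 * X * hA
        · rw [h3, evenSeries_succ_of_desc D hD]; ring
      · have hprev' : i = 0 ∨ D (i - 1) := by
          by_contra hcon
          push Not at hcon
          exact hprev ⟨Nat.pos_of_ne_zero hcon.1, hcon.2⟩
        have h4 := hd hprev'
        have hp : patternPeaks D (i + 1) = patternPeaks D i := by
          rw [patternPeaks_succ, if_neg (fun h => hprev ⟨h.1, h.2.1⟩), add_zero]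
        refine ⟨m + 1, by omega, ?_, fun _ => ?_, fun h => absurd hD (by simpa using h.2)⟩
        · rw [hp]
          linear_combination (1 - X) ^ (i + 2) * h3 + (1 - X) ^ (i + 2) * h4 + (1 + X) * hA
        · rw [h3, evenSeries_succ_of_desc D hD]; ring
    · have hp : patternPeaks D (i + 1) = patternPeaks D i := by
        rw [patternPeaks_succ, if_neg (fun h => hD h.2.2), add_zero]
      rw [mul_add, oddSeries_succ_of_asc D hD, evenSeries_succ_of_asc D hD] at h3
      refine ⟨m + 1, by omega, ?_, fun h => absurd (by simpa using h) hD, fun _ => ⟨?_, by omega⟩⟩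
      · rw [hp]
        linear_combination (1 - X) ^ (i + 2) * h3 + (1 + X) * hA
      · rw [h3, evenSeries_succ_of_asc D hD]; ring

/-- Coefficient extraction in the closed form. The bound `ha` keeps every shift `p + 1 + j` with `j
≤ m` at most `a`, so no binomial term is cut off and the natural subtraction is exact. -/
theorem sum_prefixCount_eq {i m a : ℕ} (hm : m + 2 * patternPeaks D i = i)
    (ha : m + patternPeaks D i + 1 ≤ a) :
    ∑ g ∈ Finset.range (2 * a), prefixCount D i g =
      2 * 4 ^ patternPeaks D i * ∑ j ∈ Finset.range (m + 1),
        m.choose j * (i + 1 + (a - (patternPeaks D i + 1 + j))).choose (i + 1) := by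
  obtain ⟨m', hm', hA, -, -⟩ := totalSeries_closed_form D i
  obtain rfl : m' = m := by omega
  set p := patternPeaks D i
  have hinv : ((1 - X : PowerSeries ℤ) ^ (i + 2)) *
      (invOneSubPow ℤ (i + 2) : PowerSeries ℤ) = 1 := by
    rw [← invOneSubPow_inv_eq_one_sub_pow]
    exact (invOneSubPow ℤ (i + 2)).inv_val
  have hA' : totalSeries D i = ∑ j ∈ Finset.range (m' + 1),
      C (2 * 4 ^ p * (m'.choose j : ℤ)) *
        (X ^ (p + 1 + j) * (invOneSubPow ℤ (i + 2) : PowerSeries ℤ)) := by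
    have h1 : totalSeries D i = (2 * X * (1 + X) ^ m' * (4 * X) ^ p) *
        (invOneSubPow ℤ (i + 2) : PowerSeries ℤ) := by
      rw [← hA]; linear_combination (-totalSeries D i) * hinv
    rw [h1, add_comm (1 : PowerSeries ℤ) X, add_pow, Finset.mul_sum, Finset.sum_mul, Finset.sum_mul]
    refine Finset.sum_congr rfl fun j _ => ?_
    simp only [map_mul, map_pow, map_natCast, one_pow, mul_one]
    rw [show (C (2 : ℤ) : PowerSeries ℤ) = 2 from map_ofNat _ 2,
      show (C (4 : ℤ) : PowerSeries ℤ) = 4 from map_ofNat _ 4]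
    ring
  have h := congrArg (coeff a) hA'
  rw [totalSeries, coeff_mk, map_sum] at h
  zify
  push_cast at h
  rw [h, Finset.mul_sum]
  refine Finset.sum_congr rfl fun j hj => ?_
  have hj' : j ≤ m' := by simpa [Nat.lt_succ_iff] using hj
  rw [coeff_C_mul, coeff_X_pow_mul', if_pos (by omega), invOneSubPow_val_succ_eq_mk_add_choose,
    coeff_mk]
  ring

end PrefixCount

/-- The descent pattern of a permutation. -/
def HasDescent {n : ℕ} (π : Equiv.Perm (Fin n)) (s : ℕ) : Prop :=
  ∃ h : s + 1 < n, π ⟨s + 1, h⟩ < π ⟨s, by omega⟩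

open Classical in
theorem peaks_eq_patternPeaks {i : ℕ} (π : Equiv.Perm (Fin (i + 1))) :
    peaks π = patternPeaks (HasDescent π) i := by
  unfold peaks patternPeaks
  refine Finset.card_bij (fun s _ => (s : ℕ)) ?_ ?_ ?_
  · intro s hs
    obtain ⟨a, b, ha, hb, h1, h2⟩ := (Finset.mem_filter.1 hs).2
    have hbl := b.2
    refine Finset.mem_filter.2 ⟨Finset.mem_range.2 (by omega), by omega, ?_, ?_⟩
    · rintro ⟨h, h'⟩
      have e1 : (⟨(s : ℕ) - 1, by omega⟩ : Fin (i + 1)) = a := Fin.ext (by simp; omega)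
      have e2 : (⟨(s : ℕ) - 1 + 1, h⟩ : Fin (i + 1)) = s := Fin.ext (by simp; omega)
      rw [e1, e2] at h'
      exact absurd h' (not_lt.2 h1.le)
    · refine ⟨by omega, ?_⟩
      have e1 : (⟨(s : ℕ) + 1, by omega⟩ : Fin (i + 1)) = b := Fin.ext hb
      rw [e1]; exact h2
  · intro s _ t _ hst
    exact Fin.ext hst
  · intro s hs
    obtain ⟨hs1, hs2, hs3, hs4⟩ := Finset.mem_filter.1 hs
    have hs1 := Finset.mem_range.1 hs1
    obtain ⟨h, h'⟩ := hs4
    refine ⟨⟨s, by omega⟩, Finset.mem_filter.2 ⟨Finset.mem_univ _, ⟨s - 1, by omega⟩, ⟨s + 1, h⟩,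
      by simp; omega, rfl, ?_, h'⟩, rfl⟩
    have hne : π ⟨s - 1, by omega⟩ ≠ π ⟨s, by omega⟩ := by
      intro he
      have := congrArg Fin.val (π.injective he)
      simp at this
      omega
    refine lt_of_le_of_ne (not_lt.1 fun hlt => hs3 ⟨by omega, ?_⟩) hne
    have e : (⟨s - 1 + 1, by omega⟩ : Fin (i + 1)) = ⟨s, by omega⟩ := Fin.ext (by simp; omega)
    rw [e]; exact hlt

/-- Lexicographic order on pairs (label, image), with the second coordinate reversed at even labels,
is transitive, so it need only be tested at consecutive positions. -/
theorem isCompatible_refl_iff {i q : ℕ} (π : Equiv.Perm (Fin (i + 1))) (f : Fin (i + 1) → Fin q) :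
    IsCompatible π f (Equiv.refl _) ↔ IsPatternWord (HasDescent π) f := by
  let R : Fin q × Fin (i + 1) → Fin q × Fin (i + 1) → Prop := fun u v =>
    u.1 < v.1 ∨ (u.1 = v.1 ∧ if Even (u.1 : ℕ) then v.2 < u.2 else u.2 < v.2)
  have : IsTrans (Fin q × Fin (i + 1)) R := by
    refine ⟨?_⟩
    rintro ⟨a, b⟩ ⟨a', b'⟩ ⟨a'', b''⟩ (h1 | ⟨h1, h1'⟩) (h2 | ⟨h2, h2'⟩)
    · exact Or.inl (lt_trans h1 h2)
    · simp only at h2; subst h2; exact Or.inl h1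
    · simp only at h1; subst h1; exact Or.inl h2
    · simp only at h1 h2; subst h1 h2
      refine Or.inr ⟨rfl, ?_⟩
      simp only at h1' h2' ⊢
      split_ifs at * with h
      · exact lt_trans h2' h1'
      · exact lt_trans h1' h2'
  have key := Fin.liftFun_iff_succ R (f := fun s => (f s, π s))
  have e1 : IsCompatible π f (Equiv.refl _) ↔
      Relator.LiftFun (· < ·) R (fun s => (f s, π s)) (fun s => (f s, π s)) :=
    ⟨fun h x y hxy => h x y hxy, fun h x y hxy => h hxy⟩
  rw [e1, key]
  refine forall_congr' fun s => ?_
  simp only [R]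
  refine or_congr Iff.rfl (and_congr_right fun _ => ?_)
  have hD : HasDescent π s ↔ π s.succ < π s.castSucc :=
    ⟨fun ⟨_, h⟩ => h, fun h => ⟨by omega, h⟩⟩
  rw [hD]
  have hne : π s.castSucc ≠ π s.succ := fun he => by
    have := congrArg Fin.val (π.injective he)
    simp at this
  split_ifs with h
  · simp [h]
  · simp only [h, false_iff, not_lt]
    exact ⟨le_of_lt, fun h' => lt_of_le_of_ne h' hne⟩

/-- The normalized number of labellings with `2 * a` letters compatible with a permutation of `k`
points, as a binomial average over `m` trials. -/
noncomputable def labelRatio (a : ℝ) (k m : ℕ) : ℝ :=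
  (1 / 2) ^ m * ∑ j ∈ Finset.range (m + 1), (m.choose j : ℝ) *
    ∏ i ∈ Finset.range k, (1 + ((i - (k - 1) / 2) - (j - m / 2)) / a)

theorem two_mul_peaks_lt {i : ℕ} (π : Equiv.Perm (Fin (i + 1))) : 2 * peaks π ≤ i := by
  classical
  rw [peaks_eq_patternPeaks]
  obtain ⟨m, hm, -⟩ := totalSeries_closed_form (HasDescent π) i
  omega

/-- Times the factorial, each binomial coefficient is a rising product with factors `a - p - j + s`.
As `n - 1 = m + 2p`, centring `s` at `(n-1)/2` and `j` at `m/2` absorbs `p`, and the constant `2 *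
4^p / 2^n` is the binomial weight `2^(-m)`. -/
theorem compatibleCount_eq_labelRatio {n a : ℕ} (ha : n ≤ a) (ha0 : 0 < a)
    (π : Equiv.Perm (Fin n)) :
    (n.factorial : ℝ) * compatibleCount (2 * a) π / (2 * a : ℝ) ^ n =
      labelRatio a n (n - 1 - 2 * peaks π) := by
  classical
  cases n with
  | zero =>
    have : compatibleCount (2 * a) π = 1 := by
      unfold compatibleCount
      rw [Nat.card_eq_one_iff_unique]
      exact ⟨⟨fun f g => Subtype.ext (funext fun x => x.elim0)⟩,
        ⟨⟨fun x => x.elim0, fun x => x.elim0⟩⟩⟩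
    simp [this, labelRatio]
  | succ i =>
    have hcard : compatibleCount (2 * a) π =
        ∑ g ∈ Finset.range (2 * a), prefixCount (HasDescent π) i g := by
      unfold compatibleCount
      rw [← card_isPatternWord]
      exact Nat.card_congr (Equiv.subtypeEquivRight fun f => isCompatible_refl_iff π f)
    have h2 := two_mul_peaks_lt π
    set m := i + 1 - 1 - 2 * peaks π with hm
    have hm' : m + 2 * peaks π = i := by omega
    rw [peaks_eq_patternPeaks] at hm'
    rw [hcard, sum_prefixCount_eq (HasDescent π) hm' (by omega), ← peaks_eq_patternPeaks,
      labelRatio]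
    rw [← peaks_eq_patternPeaks] at hm'
    have haR : (0 : ℝ) < a := by exact_mod_cast ha0
    push_cast
    rw [Finset.mul_sum, Finset.mul_sum, Finset.mul_sum, Finset.sum_div]
    refine Finset.sum_congr rfl fun j hj => ?_
    have hj' : j ≤ m := by simpa [Nat.lt_succ_iff] using hj
    set t := a - (peaks π + 1 + j) with ht
    have htR : (t : ℝ) = a - (peaks π + 1 + j) := by
      rw [ht, Nat.cast_sub (by omega)]; push_cast; ring
    have hfac : ((i + 1).factorial : ℝ) * ((i + 1 + t).choose (i + 1) : ℝ) =
        ∏ s ∈ Finset.range (i + 1), ((t : ℝ) + 1 + s) := by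
      have h3 := Nat.ascFactorial_eq_factorial_mul_choose t (i + 1)
      rw [Nat.ascFactorial_eq_prod_range, add_comm t (i + 1)] at h3
      exact_mod_cast h3.symm
    have hprod : ∏ s ∈ Finset.range (i + 1), ((t : ℝ) + 1 + s) = (a : ℝ) ^ (i + 1) *
        ∏ s ∈ Finset.range (i + 1),
          (1 + ((s - (((i : ℝ) + 1) - 1) / 2) - (j - m / 2)) / a) := by
      rw [← Finset.card_range (i + 1), ← Finset.prod_const, Finset.card_range,
        ← Finset.prod_mul_distrib]
      refine Finset.prod_congr rfl fun s _ => ?_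
      have : (i : ℝ) = m + 2 * peaks π := by exact_mod_cast hm'.symm
      rw [htR, this]
      field_simp
      ring
    have hpow : (2 : ℝ) * 4 ^ peaks π = (1 / 2) ^ m * 2 ^ (i + 1) := by
      have h4 : (2 : ℝ) ^ (i + 1) = 2 ^ m * (2 * 4 ^ peaks π) := by
        rw [show (4 : ℝ) = 2 ^ 2 by norm_num, ← pow_mul, ← pow_succ', ← pow_add]
        congr 1; omega
      rw [h4, ← mul_assoc, ← mul_pow]
      norm_num
    calc ((i + 1).factorial : ℝ) * (2 * 4 ^ peaks π *
          ((m.choose j : ℝ) * ((i + 1 + t).choose (i + 1) : ℝ))) / (2 * a) ^ (i + 1)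
        = (2 * 4 ^ peaks π) * (m.choose j : ℝ) *
          (((i + 1).factorial : ℝ) * ((i + 1 + t).choose (i + 1) : ℝ)) /
            (2 * a) ^ (i + 1) := by ring
      _ = _ := by
          rw [hfac, hprod, hpow, mul_pow]
          field_simp


/-! ### Compatible rankings are unique up to label-preserving symmetries -/

section Rank

theorem exists_rank_equiv {Y α : Type*} [Fintype Y] [LinearOrder α] {k : ℕ}
    (hk : Fintype.card Y = k) (h : Y → α) (hh : Function.Injective h) :
    ∃ e : Y ≃ Fin k, ∀ x y, e x < e y ↔ h x < h y := by
  let := LinearOrder.lift' h hh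
  refine ⟨(Fintype.orderIsoFinOfCardEq Y hk).symm.toEquiv, fun x y => ?_⟩
  exact (Fintype.orderIsoFinOfCardEq Y hk).symm.lt_iff_lt

theorem rank_equiv_unique {Y : Type*} {k : ℕ} {e e' : Y ≃ Fin k}
    (h : ∀ x y, e x < e y → e' x < e' y) : e = e' := by
  have hmono : StrictMono fun i => e' (e.symm i) := fun i j hij => h _ _ (by simpa using hij)
  have := (StrictMono.range_inj hmono (strictMono_id (α := Fin k))).1
    (by rw [Set.range_id]; exact (e.symm.trans e').surjective.range_eq)
  ext x
  have := congrFun this (e x)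
  simp only [Equiv.symm_apply_apply, id] at this
  rw [this]

end Rank

section Key

variable {X : Type*} {q : ℕ}

/-- The sign of a letter: even letters are negative. -/
noncomputable def letterSign (g : ℕ) : ℝ := if Even g then -1 else 1

theorem abs_letterSign (g : ℕ) : |letterSign g| = 1 := by
  unfold letterSign; split_ifs <;> simp

/-- A real key sorting the points by the signed lexicographic order of their itineraries. -/
structure IsKey (τ : Equiv.Perm X) (ℓ : X → Fin q) (β : ℝ) (v : X → ℝ) : Prop where
  pos : 0 < β
  lt_one : β < 1
  eq : ∀ x, v x = (ℓ x : ℕ) + letterSign (ℓ x) * (β * v (τ x))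
  small : ∀ x, |β * v x| ≤ 1 / 4

/-- The key is a signed expansion, with ratio `β`, of the itinerary of labels along the `τ`-orbit,
obtained as the fixed point of a contraction. The choice `β = 1/(5q)` gives `|v| ≤ 5q/4`, so the
tail after the first label is at most 1/4 and cannot reverse the order of two different labels. -/
theorem exists_isKey [Fintype X] (hq : 0 < q) (τ : Equiv.Perm X) (ℓ : X → Fin q) :
    ∃ β v, IsKey τ ℓ β v := by
  have hq' : (1 : ℝ) ≤ q := by exact_mod_cast hq
  set β : ℝ := 1 / (5 * q) with hβ
  have hβ0 : 0 < β := by positivity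
  have hβ5 : β ≤ 1 / 5 := by
    rw [hβ]; exact one_div_le_one_div_of_le (by norm_num) (by linarith)
  let T : (X → ℝ) → (X → ℝ) := fun v x => (ℓ x : ℕ) + letterSign (ℓ x) * (β * v (τ x))
  have hT : ContractingWith (1 / 5 : NNReal) T := by
    refine ⟨by rw [← NNReal.coe_lt_coe]; norm_num, LipschitzWith.of_dist_le_mul fun v w => ?_⟩
    rw [dist_pi_le_iff (by positivity)]
    intro x
    simp only [T, Real.dist_eq]
    have h1 : ((ℓ x : ℕ) : ℝ) + letterSign (ℓ x) * (β * v (τ x)) -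
        (((ℓ x : ℕ) : ℝ) + letterSign (ℓ x) * (β * w (τ x))) =
        letterSign (ℓ x) * (β * (v (τ x) - w (τ x))) := by ring
    rw [h1, abs_mul, abs_letterSign, one_mul, abs_mul, abs_of_pos hβ0]
    have h2 : |v (τ x) - w (τ x)| ≤ dist v w := by
      rw [← Real.dist_eq]; exact dist_le_pi_dist v w (τ x)
    have h3 : ((1 / 5 : NNReal) : ℝ) = 1 / 5 := by norm_num
    rw [h3]
    exact mul_le_mul hβ5 h2 (abs_nonneg _) (by norm_num)
  set v := hT.fixedPoint T with hv
  have hfix : ∀ x, v x = (ℓ x : ℕ) + letterSign (ℓ x) * (β * v (τ x)) := fun x =>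
    (congrFun (hT.fixedPoint_isFixedPt) x).symm
  refine ⟨β, v, hβ0, by linarith, hfix, ?_⟩
  intro x
  obtain ⟨z, -, hz⟩ := Finset.exists_max_image Finset.univ (fun y => |v y|) ⟨x, Finset.mem_univ x⟩
  have h1 : |v z| ≤ q + 1 / 5 * |v z| := by
    calc |v z| = |((ℓ z : ℕ) : ℝ) + letterSign (ℓ z) * (β * v (τ z))| := by rw [← hfix z]
      _ ≤ |((ℓ z : ℕ) : ℝ)| + |letterSign (ℓ z) * (β * v (τ z))| := abs_add_le _ _
      _ = (ℓ z : ℕ) + β * |v (τ z)| := by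
          rw [abs_mul, abs_letterSign, one_mul, abs_mul, abs_of_pos hβ0, Nat.abs_cast]
      _ ≤ q + 1 / 5 * |v z| := by
          have e1 : ((ℓ z : ℕ) : ℝ) ≤ q := by exact_mod_cast (ℓ z).2.le
          have e2 := mul_le_mul hβ5 (hz (τ z) (Finset.mem_univ _)) (abs_nonneg _) (by norm_num)
          linarith
  have h2 : |v x| ≤ 5 / 4 * q := by
    have := hz x (Finset.mem_univ _); linarith
  rw [abs_mul, abs_of_pos hβ0]
  calc β * |v x| ≤ β * (5 / 4 * q) := by gcongr
    _ = 1 / 4 := by rw [hβ]; field_simp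

namespace IsKey

variable {τ : Equiv.Perm X} {ℓ : X → Fin q} {β : ℝ} {v : X → ℝ}

theorem label_le (hv : IsKey τ ℓ β v) {x y : X} (h : v x ≤ v y) : ℓ x ≤ ℓ y := by
  by_contra hlt
  push Not at hlt
  have h1 : ((ℓ y : ℕ) : ℝ) + 1 ≤ (ℓ x : ℕ) := by exact_mod_cast hlt
  have hx := abs_le.1 (hv.small (τ x))
  have hy := abs_le.1 (hv.small (τ y))
  have ex := hv.eq x
  have ey := hv.eq y
  unfold letterSign at ex ey
  split_ifs at ex ey <;> linarith [hx.1, hx.2, hy.1, hy.2]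

theorem label_eq (hv : IsKey τ ℓ β v) {x y : X} (h : v x = v y) : ℓ x = ℓ y :=
  le_antisymm (hv.label_le h.le) (hv.label_le h.ge)

theorem sub_eq (hv : IsKey τ ℓ β v) {x y : X} (h : ℓ x = ℓ y) :
    v x - v y = letterSign (ℓ x) * (β * (v (τ x) - v (τ y))) := by
  rw [hv.eq x, hv.eq y, h]; ring

theorem apply_eq (hv : IsKey τ ℓ β v) {x y : X} (h : v x = v y) : v (τ x) = v (τ y) := by
  have h1 := hv.sub_eq (hv.label_eq h)
  rw [h, sub_self] at h1
  have hs : letterSign (ℓ x) ≠ 0 := by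
    intro h0; have := abs_letterSign (ℓ x); rw [h0] at this; simp at this
  have := (mul_eq_zero.1 ((mul_eq_zero.1 h1.symm).resolve_left hs)).resolve_left hv.pos.ne'
  linarith

theorem pow_apply_eq (hv : IsKey τ ℓ β v) {x y : X} (h : v x = v y) (d : ℕ) :
    v ((τ ^ d) x) = v ((τ ^ d) y) := by
  induction d with
  | zero => simpa
  | succ d ih => rw [pow_succ', Equiv.Perm.mul_apply, Equiv.Perm.mul_apply]; exact hv.apply_eq ih

theorem inv_apply_eq [Finite X] (hv : IsKey τ ℓ β v) {x y : X} (h : v x = v y) :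
    v (τ⁻¹ x) = v (τ⁻¹ y) := by
  obtain ⟨d, hd⟩ : ∃ d : ℕ, τ ^ d = τ⁻¹ := by
    have := mem_powers_iff_mem_zpowers (x := τ) (y := τ⁻¹)
    exact this.2 (inv_mem (Subgroup.mem_zpowers τ))
  rw [← hd]; exact hv.pow_apply_eq h d

/-- Take an inverted pair with the largest gap in `v`. Its labels agree, so compatibility makes the
images under `τ` an inverted pair too (in swapped order at even labels), with a gap larger by the
factor `1/β > 1`. -/
theorem le_of_lt [Fintype X] (hv : IsKey τ ℓ β v) {N : ℕ} {r : X ≃ Fin N}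
    (hr : IsCompatible τ ℓ r) {x y : X} (hxy : r x < r y) : v x ≤ v y := by
  classical
  by_contra hlt
  push Not at hlt
  obtain ⟨⟨a, b⟩, hab, hmax⟩ := Finset.exists_max_image
    ((Finset.univ : Finset (X × X)).filter fun z => r z.1 < r z.2 ∧ v z.2 < v z.1)
    (fun z => v z.1 - v z.2) ⟨(x, y), by simp [hxy, hlt]⟩
  obtain ⟨h1, h2⟩ := (Finset.mem_filter.1 hab).2
  simp only at h1 h2 hmax
  rcases hr a b h1 with h3 | ⟨h3, h4⟩
  · exact absurd (hv.label_le h2.le) (not_le.2 h3)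
  · have h5 := hv.sub_eq h3
    unfold letterSign at h5
    have hβ := hv.pos
    have hβ1 := hv.lt_one
    split_ifs at h4 h5 with he
    · have h6 : 0 < v (τ b) - v (τ a) := by
        by_contra hc; push Not at hc
        nlinarith
      have := hmax (τ b, τ a) (by simp only [Finset.mem_filter, Finset.mem_univ, true_and]
                                  exact ⟨h4, by linarith⟩)
      simp only at this
      nlinarith
    · have h6 : 0 < v (τ a) - v (τ b) := by
        by_contra hc; push Not at hc
        nlinarith
      have := hmax (τ a, τ b) (by simp only [Finset.mem_filter, Finset.mem_univ, true_and]
                                  exact ⟨h4, by linarith⟩)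
      simp only at this
      nlinarith

/-- Both rankings list the values of `v` in increasing order, and the sorted list is unique. -/
theorem comp_ranking [Fintype X] (hv : IsKey τ ℓ β v) {N : ℕ} {r r' : X ≃ Fin N}
    (hr : IsCompatible τ ℓ r) (hr' : IsCompatible τ ℓ r') (x : X) :
    v ((r.trans r'.symm) x) = v x := by
  have hm : ∀ {r : X ≃ Fin N}, IsCompatible τ ℓ r → Monotone (v ∘ r.symm) := by
    intro r hr i j hij
    rcases hij.eq_or_lt with h | h
    · rw [h]
    · exact hv.le_of_lt hr (by simpa using h)
  have := Tuple.unique_monotone (f := v ∘ r.symm) (σ := Equiv.refl _) (τ := r'.symm.trans r)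
    (by simpa using hm hr) (by
      have e : (v ∘ r.symm) ∘ (r'.symm.trans r) = v ∘ r'.symm := by funext i; simp
      rw [e]; exact hm hr')
  have h := congrFun this (r x)
  simp at h
  simpa using h.symm

end IsKey

/-- With `g` carrying `r` to `r'`, it is enough that the conjugate `τ g τ⁻¹` also carries `r` to
`r'`. Points with different keys are ordered by the key, which `g` preserves. For equal keys the
order of two points is dictated by that of their preimages and the parity of the common label, data
that `g` transports from `r` to `r'`. -/
theorem IsCompatible.rankings_commute [Fintype X] (hq : 0 < q) {τ : Equiv.Perm X} {ℓ : X → Fin q}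
    {N : ℕ} {r r' : X ≃ Fin N} (hr : IsCompatible τ ℓ r) (hr' : IsCompatible τ ℓ r') :
    (∀ x, ℓ ((r.trans r'.symm) x) = ℓ x) ∧
      ∀ x, (r.trans r'.symm) (τ x) = τ ((r.trans r'.symm) x) := by
  obtain ⟨β, v, hv⟩ := exists_isKey hq τ ℓ
  have hvg := hv.comp_ranking hr hr'
  set g := r.trans r'.symm with hg
  have hgr : ∀ x, r' (g x) = r x := fun x => by simp [hg]
  refine ⟨fun x => hv.label_eq (hvg x), fun x => ?_⟩
  -- An order-preserving comparison of two rankings forces equality, so only strict inequalities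
  -- need checking.
  have key : r = (τ⁻¹.trans (g.trans τ)).trans r' := by
    refine rank_equiv_unique fun x y hxy => ?_
    simp only [Equiv.trans_apply]
    have hx' : v (τ (g (τ⁻¹ x))) = v x := by
      rw [hv.apply_eq (hvg (τ⁻¹ x))]; simp
    have hy' : v (τ (g (τ⁻¹ y))) = v y := by
      rw [hv.apply_eq (hvg (τ⁻¹ y))]; simp
    rcases (hv.le_of_lt hr hxy).lt_or_eq with h | h
    · by_contra hcon
      push Not at hcon
      rcases hcon.lt_or_eq with h' | h'
      · have := hv.le_of_lt hr' h'
        linarith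
      · have := r'.injective h'
        rw [this] at hy'
        linarith
    · have h1 := hv.inv_apply_eq h
      have h2 := hv.label_eq h1
      have h3 : ℓ (g (τ⁻¹ x)) = ℓ (τ⁻¹ x) := hv.label_eq (hvg _)
      have h4 : ℓ (g (τ⁻¹ y)) = ℓ (τ⁻¹ y) := hv.label_eq (hvg _)
      have hne : r (τ⁻¹ x) ≠ r (τ⁻¹ y) := by
        intro he
        have := τ⁻¹.injective (r.injective he)
        rw [this] at hxy; exact lt_irrefl _ hxy
      rcases lt_or_gt_of_ne hne with hlt | hlt
      · have h5 := (hr _ _ hlt).resolve_left (by rw [h2]; exact lt_irrefl _)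
        have h6 := (hr' (g (τ⁻¹ x)) (g (τ⁻¹ y)) (by rw [hgr, hgr]; exact hlt)).resolve_left
          (by rw [h3, h4, h2]; exact lt_irrefl _)
        have h5' := h5.2
        have h6' := h6.2
        rw [h3] at h6'
        split_ifs at h5' h6'
        · exact absurd (by simpa using h5') (not_lt.2 hxy.le)
        · exact h6'
      · have h5 := (hr _ _ hlt).resolve_left (by rw [h2]; exact lt_irrefl _)
        have h6 := (hr' (g (τ⁻¹ y)) (g (τ⁻¹ x)) (by rw [hgr, hgr]; exact hlt)).resolve_left
          (by rw [h3, h4, h2]; exact lt_irrefl _)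
        have h5' := h5.2
        have h6' := h6.2
        rw [h4] at h6'
        split_ifs at h5' h6'
        · exact h6'
        · exact absurd (by simpa using h5') (not_lt.2 hxy.le)
  have h := congrFun (congrArg DFunLike.coe key) (τ x)
  have h' : r (τ x) = r' (τ (g x)) := by simpa using h
  apply r'.injective
  rw [← h', hgr]

end Key


/-! ### Averages over random labellings and label-preserving centralizers -/

section Labellings

variable {X : Type*} [Fintype X] [DecidableEq X] {q : ℕ}

/-- `φ` does not depend on the label of `x`. -/
def IgnoresLabel (φ : (X → Fin q) → ℝ) (x : X) : Prop :=
  ∀ ℓ g, φ (Function.update ℓ x g) = φ ℓ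

theorem mul_sum_ite_label_eq {φ : (X → Fin q) → ℝ} {x y : X} (hφ : IgnoresLabel φ x)
    (hy : y ≠ x) :
    (q : ℝ) * ∑ ℓ, (if ℓ x = ℓ y then φ ℓ else 0) = ∑ ℓ, φ ℓ := by
  set e := (Equiv.funSplitAt x (Fin q)).symm with he
  have hx : ∀ g f, e (g, f) x = g := fun g f => by simp [he, Equiv.funSplitAt, Equiv.piSplitAt]
  have hne : ∀ g f z (hz : z ≠ x), e (g, f) z = f ⟨z, hz⟩ := fun g f z hz => by
    simp [he, Equiv.funSplitAt, Equiv.piSplitAt, hz]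
  have hind : ∀ g g' f, φ (e (g, f)) = φ (e (g', f)) := by
    intro g g' f
    rw [← hφ (e (g', f)) g]
    congr 1
    funext z
    by_cases hz : z = x
    · subst hz; rw [hx, Function.update_self]
    · rw [Function.update_of_ne hz, hne _ _ _ hz, hne _ _ _ hz]
  rw [← e.sum_comp, ← e.sum_comp (fun ℓ => φ ℓ), Fintype.sum_prod_type_right,
    Fintype.sum_prod_type_right, Finset.mul_sum]
  refine Finset.sum_congr rfl fun f _ => ?_
  simp_rw [hx, hne _ _ y hy]
  rw [Finset.sum_ite_eq' Finset.univ, if_pos (Finset.mem_univ _),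
    Finset.sum_congr rfl fun g _ => hind g (f ⟨y, hy⟩) f]
  simp

theorem IgnoresLabel.ite {φ : (X → Fin q) → ℝ} {x y z : X} (hφ : IgnoresLabel φ x)
    (hy : y ≠ x) (hz : z ≠ x) : IgnoresLabel (fun ℓ => if ℓ y = ℓ z then φ ℓ else 0) x := by
  intro ℓ g
  simp only [Function.update_of_ne hy, Function.update_of_ne hz, hφ ℓ g]

theorem sq_mul_sum_ite_label_eq {φ : (X → Fin q) → ℝ} {x y z w : X} (hφ : IgnoresLabel φ x)
    (hφz : IgnoresLabel φ z) (hy : y ≠ x) (hz : z ≠ x) (hw : w ≠ x) (hwz : w ≠ z) :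
    (q : ℝ) ^ 2 * ∑ ℓ, (if ℓ x = ℓ y ∧ ℓ z = ℓ w then φ ℓ else 0) = ∑ ℓ, φ ℓ := by
  simp_rw [ite_and]
  rw [pow_two, mul_assoc, mul_sum_ite_label_eq (hφ.ite hz hw) hy, mul_sum_ite_label_eq hφz hwz]

/-- Permutations commuting with `τ`, preserving the labels and moving only points of `A`. -/
def labelStabilizer (τ : Equiv.Perm X) (ℓ : X → Fin q) (A : Finset X) : Finset (Equiv.Perm X) :=
  Finset.univ.filter fun g => (∀ x, g (τ x) = τ (g x)) ∧ (∀ x, ℓ (g x) = ℓ x) ∧ ∀ x ∉ A, g x = x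

theorem ignoresLabel_card_labelStabilizer (τ : Equiv.Perm X) {A : Finset X} {x : X} (hx : x ∉ A) :
    IgnoresLabel (fun ℓ : X → Fin q => ((labelStabilizer τ ℓ A).card : ℝ)) x := by
  intro ℓ b
  simp only
  congr 2
  unfold labelStabilizer
  refine Finset.filter_congr fun g _ => and_congr_right fun _ => and_congr_left fun hg => ?_
  have hgx : g x = x := hg x hx
  refine forall_congr' fun y => ?_
  by_cases hy : y = x
  · subst hy; rw [hgx]; simp
  · have : g y ≠ x := fun h => hy (g.injective (h.trans hgx.symm))
    rw [Function.update_of_ne hy, Function.update_of_ne this]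

theorem pow_apply_of_commute {τ g : Equiv.Perm X} (h : ∀ x, g (τ x) = τ (g x)) (x : X) (d : ℤ) :
    g ((τ ^ d) x) = (τ ^ d) (g x) := by
  have hc : Commute g τ := Equiv.ext h
  exact congrFun (congrArg DFunLike.coe (hc.zpow_right d).eq) x

/-- An element commuting with `τ` is determined on the cycle `c` by its value at `x`, so each fibre
of `g ↦ g x` embeds into the stabilizer for `A`. A value in `c` other than `x` must share the label
of `x`; a value in `A` must share two consecutive labels. -/
theorem card_labelStabilizer_le (τ : Equiv.Perm X) (ℓ : X → Fin q) {A c : Finset X} {x : X}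
    (hc : ∀ y, y ∈ c ↔ τ.SameCycle x y) :
    ((labelStabilizer τ ℓ (A ∪ c)).card : ℝ) ≤ (labelStabilizer τ ℓ A).card *
      (1 + ∑ y ∈ c.erase x, (if ℓ x = ℓ y then (1 : ℝ) else 0) +
        ∑ y ∈ A, if ℓ x = ℓ y ∧ ℓ (τ x) = ℓ (τ y) then (1 : ℝ) else 0) := by
  have hxc : x ∈ c := (hc x).2 (Equiv.Perm.SameCycle.refl _ _)
  have h1 : (labelStabilizer τ ℓ (A ∪ c)).card ≤ (labelStabilizer τ ℓ A).card *
      ((labelStabilizer τ ℓ (A ∪ c)).image fun g => g x).card := by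
    refine Finset.card_le_mul_card_image _ _ fun b hb => ?_
    obtain ⟨g₀, hg₀, rfl⟩ := Finset.mem_image.1 hb
    refine Finset.card_le_card_of_injOn (fun g => g₀⁻¹ * g) ?_
      (fun g _ g' _ h => mul_left_cancel h)
    intro g hg
    obtain ⟨hg, hgx⟩ := Finset.mem_filter.1 (Finset.mem_coe.1 hg)
    obtain ⟨a1, a2, a3⟩ := (Finset.mem_filter.1 hg).2
    obtain ⟨b1, b2, b3⟩ := (Finset.mem_filter.1 hg₀).2
    have b1' : ∀ z, g₀⁻¹ (τ z) = τ (g₀⁻¹ z) := by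
      intro z
      apply g₀.injective
      rw [b1]; simp
    have hcomm : ∀ z, (g₀⁻¹ * g) (τ z) = τ ((g₀⁻¹ * g) z) := by
      intro z
      rw [Equiv.Perm.mul_apply, Equiv.Perm.mul_apply, a1, b1']
    refine Finset.mem_coe.2 (Finset.mem_filter.2 ⟨Finset.mem_univ _, hcomm, ?_, ?_⟩)
    · intro z
      have := b2 (g₀⁻¹ (g z))
      rw [Equiv.Perm.mul_apply, ← this, ← a2 z]; simp
    · intro z hz
      by_cases hzc : z ∈ c
      · obtain ⟨d, rfl⟩ := (hc z).1 hzc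
        rw [pow_apply_of_commute hcomm, Equiv.Perm.mul_apply, hgx]; simp
      · have hz' : z ∉ A ∪ c := by simp [hz, hzc]
        rw [Equiv.Perm.mul_apply, a3 z hz']
        apply g₀.injective
        rw [b3 z hz']; simp
  have h2 : ((labelStabilizer τ ℓ (A ∪ c)).image fun g => g x) ⊆
      {x} ∪ ((c.erase x).filter fun y => ℓ x = ℓ y) ∪
        (A.filter fun y => ℓ x = ℓ y ∧ ℓ (τ x) = ℓ (τ y)) := by
    intro y hy
    obtain ⟨g, hg, rfl⟩ := Finset.mem_image.1 hy
    obtain ⟨a1, a2, a3⟩ := (Finset.mem_filter.1 hg).2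
    have hmem : g x ∈ A ∪ c := by
      by_contra hcon
      have h := g.injective (a3 _ hcon)
      rw [h] at hcon
      exact hcon (by simp [hxc])
    have e1 : ℓ x = ℓ (g x) := (a2 x).symm
    have e2 : ℓ (τ x) = ℓ (τ (g x)) := by rw [← a1, a2]
    simp only [Finset.mem_union, Finset.mem_singleton, Finset.mem_filter, Finset.mem_erase]
    rcases Finset.mem_union.1 hmem with h | h
    · exact Or.inr ⟨h, e1, e2⟩
    · by_cases hgx : g x = x
      · exact Or.inl (Or.inl hgx)
      · exact Or.inl (Or.inr ⟨⟨hgx, h⟩, e1⟩)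
  have h3 : (((labelStabilizer τ ℓ (A ∪ c)).image fun g => g x).card : ℝ) ≤
      1 + ∑ y ∈ c.erase x, (if ℓ x = ℓ y then (1 : ℝ) else 0) +
        ∑ y ∈ A, if ℓ x = ℓ y ∧ ℓ (τ x) = ℓ (τ y) then (1 : ℝ) else 0 := by
    rw [Finset.sum_boole, Finset.sum_boole]
    have := (Finset.card_le_card h2).trans ((Finset.card_union_le _ _).trans
      (Nat.add_le_add_right (Finset.card_union_le _ _) _))
    rw [Finset.card_singleton] at this
    exact_mod_cast this
  calc ((labelStabilizer τ ℓ (A ∪ c)).card : ℝ)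
      ≤ (labelStabilizer τ ℓ A).card *
        ((labelStabilizer τ ℓ (A ∪ c)).image fun g => g x).card := by exact_mod_cast h1
    _ ≤ _ := by gcongr

/-- The labels of `x` and `τ x` are distinct coordinates on which the stabilizer for `A` and the
weight do not depend. The fewer than `|c|` coincidences inside the cycle therefore cost `1/q` each
and the `|A|` coincidences outside cost `1/q²` each; Bernoulli's inequality turns the result into a
power that multiplies over cycles. -/
theorem sum_card_labelStabilizer_union_le (hq : 0 < q) (τ : Equiv.Perm X) {A c : Finset X} {x : X}
    (hc : ∀ y, y ∈ c ↔ τ.SameCycle x y) (hA : ∀ y, τ y ∈ A ↔ y ∈ A) (hxA : x ∉ A)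
    (hx : τ x ≠ x) {φ : (X → Fin q) → ℝ} (hφ0 : ∀ ℓ, 0 ≤ φ ℓ)
    (hφ : ∀ y, τ y ≠ y → IgnoresLabel φ y) :
    ∑ ℓ, φ ℓ * (labelStabilizer τ ℓ (A ∪ c)).card ≤
      (1 + (1 / q + Fintype.card X / q ^ 2)) ^ c.card *
        ∑ ℓ, φ ℓ * (labelStabilizer τ ℓ A).card := by
  have hq' : (0 : ℝ) < q := by exact_mod_cast hq
  have hxc : x ∈ c := (hc x).2 (Equiv.Perm.SameCycle.refl _ _)
  set ψ : (X → Fin q) → ℝ := fun ℓ => φ ℓ * (labelStabilizer τ ℓ A).card with hψ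
  have hψ0 : ∀ ℓ, 0 ≤ ψ ℓ := fun ℓ => mul_nonneg (hφ0 ℓ) (Nat.cast_nonneg _)
  have hψi : ∀ y, τ y ≠ y → y ∉ A → IgnoresLabel ψ y := fun y h1 h2 ℓ g => by
    have e1 := hφ y h1 ℓ g
    have e2 := ignoresLabel_card_labelStabilizer τ h2 ℓ g
    simp only at e2
    simp only [hψ, e1, e2]
  set S := ∑ ℓ, ψ ℓ with hS
  have hS0 : 0 ≤ S := Finset.sum_nonneg fun ℓ _ => hψ0 ℓ
  have hτx : τ (τ x) ≠ τ x := fun h => hx (τ.injective h)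
  have hτxA : τ x ∉ A := fun h => hxA ((hA x).1 h)
  have e1 : ∀ y ∈ c.erase x, ∑ ℓ, (if ℓ x = ℓ y then ψ ℓ else 0) = S / q := by
    intro y hy
    rw [eq_div_iff hq'.ne', mul_comm]
    exact mul_sum_ite_label_eq (hψi x hx hxA) (Finset.ne_of_mem_erase hy)
  have e2 : ∀ y ∈ A, ∑ ℓ, (if ℓ x = ℓ y ∧ ℓ (τ x) = ℓ (τ y) then ψ ℓ else 0) = S / q ^ 2 := by
    intro y hy
    rw [eq_div_iff (pow_ne_zero 2 hq'.ne'), mul_comm]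
    exact sq_mul_sum_ite_label_eq (hψi x hx hxA) (hψi (τ x) hτx hτxA)
      (fun h => hxA (h ▸ hy)) hx (fun h => hxA (h ▸ (hA y).2 hy))
      (fun h => hxA (τ.injective h ▸ hy))
  have hcard : (c.erase x).card + 1 = c.card := Finset.card_erase_add_one hxc
  calc ∑ ℓ, φ ℓ * (labelStabilizer τ ℓ (A ∪ c)).card
      ≤ ∑ ℓ, (ψ ℓ + ∑ y ∈ c.erase x, (if ℓ x = ℓ y then ψ ℓ else 0) +
        ∑ y ∈ A, if ℓ x = ℓ y ∧ ℓ (τ x) = ℓ (τ y) then ψ ℓ else 0) := by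
        refine Finset.sum_le_sum fun ℓ _ => ?_
        refine (mul_le_mul_of_nonneg_left (card_labelStabilizer_le τ ℓ hc) (hφ0 ℓ)).trans_eq ?_
        rw [← mul_assoc, mul_add, mul_add, mul_one, Finset.mul_sum, Finset.mul_sum]
        simp only [hψ, mul_ite, mul_one, mul_zero]
    _ = S + (c.erase x).card * (S / q) + A.card * (S / q ^ 2) := by
        rw [Finset.sum_add_distrib, Finset.sum_add_distrib, Finset.sum_comm,
          Finset.sum_congr rfl e1, Finset.sum_comm, Finset.sum_congr rfl e2]
        simp [hS]
    _ ≤ (1 + c.card * (1 / q + Fintype.card X / q ^ 2)) * S := by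
        have f1 : ((c.erase x).card : ℝ) ≤ c.card := by exact_mod_cast Finset.card_erase_le
        have f2 : (A.card : ℝ) ≤ c.card * Fintype.card X := by
          have g1 : A.card ≤ Fintype.card X := Finset.card_le_univ A
          have g2 : 1 ≤ c.card := Finset.card_pos.2 ⟨x, hxc⟩
          have : A.card ≤ c.card * Fintype.card X := by nlinarith
          exact_mod_cast this
        have f3 := mul_le_mul_of_nonneg_right f1 (div_nonneg hS0 hq'.le)
        have f4 := mul_le_mul_of_nonneg_right f2 (div_nonneg hS0 (sq_nonneg (q : ℝ)))
        have f5 : (1 + c.card * (1 / q + Fintype.card X / q ^ 2)) * S = S + c.card * (S / q) +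
            c.card * Fintype.card X * (S / q ^ 2) := by ring
        linarith
    _ ≤ _ := by
        refine mul_le_mul_of_nonneg_right ?_ hS0
        exact one_add_mul_le_pow (le_trans (by norm_num) (by positivity :
          (0 : ℝ) ≤ 1 / q + Fintype.card X / q ^ 2)) _

/-- Cycles are removed from `A` one at a time. The weight `φ` may depend on the labels of fixed
points; it will be the number of compatible rankings of these. -/
theorem sum_card_labelStabilizer_le (hq : 0 < q) (τ : Equiv.Perm X)
    {φ : (X → Fin q) → ℝ} (hφ0 : ∀ ℓ, 0 ≤ φ ℓ) (hφ : ∀ y, τ y ≠ y → IgnoresLabel φ y)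
    (A : Finset X) (hA : ∀ y, τ y ∈ A ↔ y ∈ A) (hAτ : ∀ y ∈ A, τ y ≠ y) :
    ∑ ℓ, φ ℓ * (labelStabilizer τ ℓ A).card ≤
      (1 + (1 / q + Fintype.card X / q ^ 2)) ^ A.card * ∑ ℓ, φ ℓ := by
  classical
  induction A using Finset.strongInduction with
  | H A ih =>
    rcases A.eq_empty_or_nonempty with rfl | ⟨x, hx⟩
    · have : ∀ ℓ : X → Fin q, (labelStabilizer τ ℓ ∅).card = 1 := by
        intro ℓ
        rw [Finset.card_eq_one]
        refine ⟨1, Finset.ext fun g => ?_⟩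
        simp only [labelStabilizer, Finset.mem_filter, Finset.mem_univ, true_and,
          Finset.mem_singleton]
        refine ⟨fun h => Equiv.ext fun x => h.2.2 x (by simp), ?_⟩
        rintro rfl
        simp
      simp [this]
    · set c := Finset.univ.filter fun y => τ.SameCycle x y with hcdef
      have hc : ∀ y, y ∈ c ↔ τ.SameCycle x y := fun y => by simp [hcdef]
      have hApow : ∀ (d : ℤ) y, (τ ^ d) y ∈ A ↔ y ∈ A := by
        intro d
        induction d with
        | zero => simp
        | succ d ihd => intro y; rw [add_comm, zpow_add, zpow_one, Equiv.Perm.mul_apply, hA, ihd]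
        | pred d ihd =>
          intro y
          rw [← ihd y, ← hA, sub_eq_add_neg, add_comm, zpow_add, Equiv.Perm.mul_apply]
          simp
      have hcA : c ⊆ A := by
        intro y hy
        obtain ⟨d, rfl⟩ := (hc y).1 hy
        exact (hApow d x).2 hx
      have hxc : x ∈ c := (hc x).2 (Equiv.Perm.SameCycle.refl _ _)
      have hA' : ∀ y, τ y ∈ A \ c ↔ y ∈ A \ c := by
        intro y
        rw [Finset.mem_sdiff, Finset.mem_sdiff, hA, hc, hc, Equiv.Perm.sameCycle_apply_right]
      have hss : A \ c ⊂ A := Finset.sdiff_ssubset hcA ⟨x, hxc⟩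
      have h1 := ih _ hss hA' fun y hy => hAτ y (Finset.mem_sdiff.1 hy).1
      have h2 := sum_card_labelStabilizer_union_le hq τ hc hA' (by simp [hxc]) (hAτ x hx) hφ0 hφ
      rw [Finset.sdiff_union_of_subset hcA] at h2
      refine h2.trans ((mul_le_mul_of_nonneg_left h1 (by positivity)).trans_eq ?_)
      rw [← mul_assoc, ← pow_add]
      congr 2
      have := Finset.card_sdiff_add_card_eq_card hcA
      omega

end Labellings


/-! ### The average number of compatible rankings is governed by the fixed points -/

section Rankings

variable {X : Type*} [Fintype X] [DecidableEq X] {q : ℕ}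

open Classical in
/-- The rankings compatible with `τ` and the labelling `ℓ`. -/
noncomputable def rankings (N : ℕ) (τ : Equiv.Perm X) (ℓ : X → Fin q) : Finset (X ≃ Fin N) :=
  Finset.univ.filter fun r => IsCompatible τ ℓ r

/-- The restriction of a labelling to the fixed points of `τ`. -/
def fixedLabels (τ : Equiv.Perm X) (ℓ : X → Fin q) : {x // τ x = x} → Fin q := fun x => ℓ x

theorem mem_rankings {N : ℕ} {τ : Equiv.Perm X} {ℓ : X → Fin q} {r : X ≃ Fin N} :
    r ∈ rankings N τ ℓ ↔ IsCompatible τ ℓ r := by simp [rankings]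

/-- Rankings are fibred over their restriction to the fixed points. Two in one fibre differ by a
label-preserving element of the centralizer, and equality of the restrictions makes that element
trivial on the fixed points. -/
theorem card_rankings_le (hq : 0 < q) (τ : Equiv.Perm X) (ℓ : X → Fin q) {N k : ℕ}
    (hk : Fintype.card {x // τ x = x} = k) :
    (rankings N τ ℓ).card ≤ (labelStabilizer τ ℓ (Finset.univ.filter fun x => τ x ≠ x)).card *
      (rankings k (1 : Equiv.Perm {x // τ x = x}) (fixedLabels τ ℓ)).card := by
  have hex : ∀ r : X ≃ Fin N, ∃ e : {x // τ x = x} ≃ Fin k, ∀ x y, e x < e y ↔ r x < r y :=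
    fun r => exists_rank_equiv hk (fun x : {x // τ x = x} => r x)
      (r.injective.comp Subtype.val_injective)
  choose res hres using hex
  refine Finset.card_le_mul_card_image_of_maps_to (f := res) (fun r hr => ?_) _ fun b _ => ?_
  · rw [mem_rankings] at hr ⊢
    intro x y hxy
    rcases hr x y ((hres r x y).1 hxy) with h | ⟨h, h'⟩
    · exact Or.inl h
    · refine Or.inr ⟨h, ?_⟩
      rw [x.2, y.2] at h'
      simp only [Equiv.Perm.one_apply, hres, fixedLabels]
      exact h'
  · rcases ((rankings N τ ℓ).filter fun r => res r = b).eq_empty_or_nonempty with h | ⟨r₀, hr₀⟩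
    · simp [h]
    obtain ⟨hr₀, hb₀⟩ := Finset.mem_filter.1 hr₀
    rw [mem_rankings] at hr₀
    refine Finset.card_le_card_of_injOn (fun r => r₀.trans r.symm) (fun r hr => ?_) ?_
    · obtain ⟨hr, hb⟩ := Finset.mem_filter.1 (Finset.mem_coe.1 hr)
      rw [mem_rankings] at hr
      obtain ⟨h1, h2⟩ := hr₀.rankings_commute hq hr
      refine Finset.mem_coe.2 (Finset.mem_filter.2 ⟨Finset.mem_univ _, h2, h1, fun x hx => ?_⟩)
      set g : Equiv.Perm X := r₀.trans r.symm with hg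
      have hgr : ∀ x, r (g x) = r₀ x := fun x => by simp [hg]
      have hxF : τ x = x := by simpa using hx
      have hpres : ∀ x, τ (g x) = g x ↔ τ x = x := fun x => by
        rw [← h2]; exact g.injective.eq_iff
      have key : res r₀ = (g.subtypePerm hpres).trans (res r) := by
        refine rank_equiv_unique fun y z hyz => ?_
        simp only [Equiv.trans_apply, hres, Equiv.Perm.subtypePerm_apply, hgr]
        exact (hres r₀ y z).1 hyz
      have h3 := congrFun (congrArg DFunLike.coe key) ⟨x, hxF⟩
      rw [hb₀, ← hb] at h3
      have h4 := (res r).injective h3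
      exact (congrArg Subtype.val h4).symm
    · intro r _ r' _ h
      have : r.symm = r'.symm := by
        ext i
        have := congrFun (congrArg DFunLike.coe h) (r₀.symm i)
        simpa using this
      rw [← r.symm_symm, this, r'.symm_symm]

/-- Sort by the key. In the absence of collisions only fixed points can share a key, and such ties
are broken by `s`. -/
theorem exists_compatible_extending (hq : 0 < q) (τ : Equiv.Perm X) (ℓ : X → Fin q) {k N : ℕ}
    (hN : Fintype.card X = N)
    (hgood : ∀ x y, τ x ≠ x → y ≠ x → ¬ (ℓ x = ℓ y ∧ ℓ (τ x) = ℓ (τ y)))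
    {s : {x // τ x = x} ≃ Fin k}
    (hs : IsCompatible (1 : Equiv.Perm {x // τ x = x}) (fixedLabels τ ℓ) s) :
    ∃ r : X ≃ Fin N, IsCompatible τ ℓ r ∧ ∀ x y, s x < s y → r x < r y := by
  obtain ⟨β, v, hv⟩ := exists_isKey hq τ ℓ
  have hvF : IsKey (1 : Equiv.Perm {x // τ x = x}) (fixedLabels τ ℓ) β (fun x => v x) :=
    { pos := hv.pos
      lt_one := hv.lt_one
      eq := fun x => by
        have := hv.eq x
        rw [x.2] at this
        exact this
      small := fun x => hv.small x }
  -- The default 0 is harmless: by `hgood` a moved point shares its key with no other point.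
  let tie : X → ℕ := fun x => if h : τ x = x then (s ⟨x, h⟩ : ℕ) else 0
  have hfix : ∀ {x y}, x ≠ y → v x = v y → τ x = x := by
    intro x y hxy h
    by_contra hx
    exact hgood x y hx (Ne.symm hxy) ⟨hv.label_eq h, hv.label_eq (hv.apply_eq h)⟩
  obtain ⟨r, hr⟩ := exists_rank_equiv hN (fun x => toLex (v x, tie x)) (by
    intro x y hxy
    by_contra hne
    have h1 : (v x, tie x) = (v y, tie y) := toLex_inj.1 hxy
    have h2 := congrArg Prod.fst h1
    have h3 := congrArg Prod.snd h1
    have hx := hfix hne h2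
    have hy := hfix (Ne.symm hne) h2.symm
    simp only [tie, hx, hy, dif_pos] at h3
    have := s.injective (Fin.ext h3)
    exact hne (congrArg Subtype.val this))
  have hr' : ∀ x y, r x < r y ↔ v x < v y ∨ v x = v y ∧ tie x < tie y := fun x y => by
    rw [hr, Prod.Lex.toLex_lt_toLex]
  have hsr : ∀ x y, s x < s y → r x < r y := by
    intro x y hxy
    rw [hr']
    rcases (hvF.le_of_lt hs hxy).lt_or_eq with h | h
    · exact Or.inl h
    · refine Or.inr ⟨h, ?_⟩
      simp only [tie, x.2, y.2, dif_pos]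
      exact hxy
  refine ⟨r, fun x y hxy => ?_, hsr⟩
  rcases (hr' x y).1 hxy with h | ⟨h, htie⟩
  · rcases (hv.label_le h.le).lt_or_eq with hl | hl
    · exact Or.inl hl
    · refine Or.inr ⟨hl, ?_⟩
      have h1 := hv.sub_eq hl
      have hβ := hv.pos
      unfold letterSign at h1
      split_ifs at h1 ⊢
      · refine (hr' _ _).2 (Or.inl ?_)
        by_contra hc; push Not at hc
        nlinarith
      · refine (hr' _ _).2 (Or.inl ?_)
        by_contra hc; push Not at hc
        nlinarith
  · have hne : x ≠ y := by rintro rfl; exact lt_irrefl _ htie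
    have hx := hfix hne h
    have hy := hfix (Ne.symm hne) h.symm
    simp only [tie, hx, hy, dif_pos] at htie
    have h1 := hs ⟨x, hx⟩ ⟨y, hy⟩ htie
    rcases h1 with h1 | ⟨h1, h2⟩
    · exact Or.inl h1
    · refine Or.inr ⟨h1, ?_⟩
      rw [hx, hy]
      change if Even (ℓ x : ℕ) then s ⟨y, hy⟩ < s ⟨x, hx⟩ else s ⟨x, hx⟩ < s ⟨y, hy⟩ at h2
      -- Two fixed points with the same even label would have to be ranked in both orders, so only
      -- odd labels occur here.
      by_cases he : Even (ℓ x : ℕ)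
      · rw [if_pos he] at h2
        exact absurd h2 (not_lt.2 (le_of_lt htie))
      · rw [if_neg he]; exact hxy

theorem card_rankings_fixedLabels_le (hq : 0 < q) (τ : Equiv.Perm X) (ℓ : X → Fin q) {k N : ℕ}
    (hN : Fintype.card X = N)
    (hgood : ∀ x y, τ x ≠ x → y ≠ x → ¬ (ℓ x = ℓ y ∧ ℓ (τ x) = ℓ (τ y))) :
    (rankings k (1 : Equiv.Perm {x // τ x = x}) (fixedLabels τ ℓ)).card ≤
      (rankings N τ ℓ).card := by
  have hex : ∀ s : {x // τ x = x} ≃ Fin k, ∃ r : X ≃ Fin N,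
      s ∈ rankings k (1 : Equiv.Perm {x // τ x = x}) (fixedLabels τ ℓ) →
        IsCompatible τ ℓ r ∧ ∀ x y, s x < s y → r x < r y := by
    intro s
    by_cases hs : s ∈ rankings k (1 : Equiv.Perm {x // τ x = x}) (fixedLabels τ ℓ)
    · obtain ⟨r, hr⟩ := exists_compatible_extending hq τ ℓ hN hgood (mem_rankings.1 hs)
      exact ⟨r, fun _ => hr⟩
    · exact ⟨Fintype.equivFinOfCardEq hN, fun h => absurd h hs⟩
  choose ext hext using hex
  refine Finset.card_le_card_of_injOn ext (fun s hs => mem_rankings.2 (hext s hs).1) ?_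
  intro s hs s' hs' h
  refine rank_equiv_unique fun x y hxy => ?_
  have h1 := (hext s hs).2 x y hxy
  rw [h] at h1
  by_contra hcon
  push Not at hcon
  rcases hcon.lt_or_eq with h2 | h2
  · exact absurd ((hext s' hs').2 y x h2) (not_lt.2 h1.le)
  · rw [s'.injective h2] at h1
    exact lt_irrefl _ h1

theorem ignoresLabel_fixedLabels (τ : Equiv.Perm X) (φ : ({x // τ x = x} → Fin q) → ℝ) {y : X}
    (hy : τ y ≠ y) : IgnoresLabel (fun ℓ : X → Fin q => φ (fixedLabels τ ℓ)) y := by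
  intro ℓ g
  simp only
  congr 1
  funext x
  unfold fixedLabels
  rw [Function.update_of_ne]
  intro h
  exact hy (h ▸ x.2)

theorem sum_fixedLabels (hq : 0 < q) (τ : Equiv.Perm X) (φ : ({x // τ x = x} → Fin q) → ℝ) :
    (∑ ℓ : X → Fin q, φ (fixedLabels τ ℓ)) / (q : ℝ) ^ Fintype.card X =
      (∑ ℓ, φ ℓ) / (q : ℝ) ^ Fintype.card {x // τ x = x} := by
  have hq' : (q : ℝ) ≠ 0 := by exact_mod_cast hq.ne'
  have h1 : ∑ ℓ : X → Fin q, φ (fixedLabels τ ℓ) =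
      (q : ℝ) ^ Fintype.card {x // ¬ τ x = x} * ∑ ℓ, φ ℓ := by
    rw [← (Equiv.piEquivPiSubtypeProd (fun x => τ x = x) (fun _ => Fin q)).symm.sum_comp,
      Fintype.sum_prod_type, Finset.mul_sum]
    refine Finset.sum_congr rfl fun f _ => ?_
    have : ∀ f', fixedLabels τ ((Equiv.piEquivPiSubtypeProd (fun x => τ x = x)
        (fun _ => Fin q)).symm (f, f')) = f := by
      intro f'
      funext x
      simp [fixedLabels, Equiv.piEquivPiSubtypeProd, x.2]
    simp_rw [this]
    simp
  have h2 : Fintype.card X = Fintype.card {x // ¬ τ x = x} + Fintype.card {x // τ x = x} := by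
    have := Fintype.card_subtype_compl fun x => τ x = x
    have h3 := Fintype.card_subtype_le fun x => τ x = x
    omega
  rw [h1, h2, pow_add]
  field_simp

theorem sum_card_rankings_le (hq : 0 < q) (τ : Equiv.Perm X) {N k : ℕ}
    (hN : Fintype.card X = N) (hk : Fintype.card {x // τ x = x} = k) :
    (∑ ℓ : X → Fin q, ((rankings N τ ℓ).card : ℝ)) / (q : ℝ) ^ N ≤
      (1 + (1 / q + N / q ^ 2)) ^ N *
        ((∑ ℓ : {x // τ x = x} → Fin q, ((rankings k 1 ℓ).card : ℝ)) / (q : ℝ) ^ k) := by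
  have hq' : (0 : ℝ) < q := by exact_mod_cast hq
  set A := Finset.univ.filter fun x => τ x ≠ x
  set φ : ({x // τ x = x} → Fin q) → ℝ := fun ℓ => (rankings k 1 ℓ).card with hφ
  have h1 := sum_card_labelStabilizer_le hq τ (φ := fun ℓ => φ (fixedLabels τ ℓ))
    (fun ℓ => Nat.cast_nonneg _) (fun y hy => ignoresLabel_fixedLabels τ φ hy) A
    (fun y => by simp [A]) (fun y hy => by simpa [A] using hy)
  have h2 := sum_fixedLabels hq τ φ
  rw [hN, hk] at h2
  rw [← h2, ← mul_div_assoc]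
  refine div_le_div_of_nonneg_right ?_ (by positivity)
  calc ∑ ℓ : X → Fin q, ((rankings N τ ℓ).card : ℝ)
      ≤ ∑ ℓ : X → Fin q, φ (fixedLabels τ ℓ) * (labelStabilizer τ ℓ A).card := by
        refine Finset.sum_le_sum fun ℓ _ => ?_
        rw [mul_comm, hφ, ← Nat.cast_mul]
        exact Nat.cast_le.2 (card_rankings_le hq τ ℓ hk)
    _ ≤ _ := h1
    _ ≤ _ := by
        rw [hN]
        refine mul_le_mul_of_nonneg_right ?_ (Finset.sum_nonneg fun ℓ _ => Nat.cast_nonneg _)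
        refine pow_le_pow_right₀ (le_add_of_nonneg_right (by positivity)) ?_
        rw [← hN]; exact Finset.card_le_univ A

/-- The two coincidences are independent unless they involve overlapping labels. For the neighbours
`τ x` and `τ⁻¹ x` only the first coincidence is used, which is affordable since there are at most
two of them. -/
theorem sum_ite_collision_le (hq : 0 < q) (τ : Equiv.Perm X) {φ : (X → Fin q) → ℝ}
    (hφ0 : ∀ ℓ, 0 ≤ φ ℓ) (hφ : ∀ y, τ y ≠ y → IgnoresLabel φ y) {x y : X} (hx : τ x ≠ x)
    (hy : y ≠ x) :
    ∑ ℓ, (if ℓ x = ℓ y ∧ ℓ (τ x) = ℓ (τ y) then φ ℓ else 0) ≤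
      (if y = τ x then (∑ ℓ, φ ℓ) / q else 0) + (if y = τ⁻¹ x then (∑ ℓ, φ ℓ) / q else 0) +
        (∑ ℓ, φ ℓ) / q ^ 2 := by
  have hq' : (0 : ℝ) < q := by exact_mod_cast hq
  have hS0 : 0 ≤ ∑ ℓ, φ ℓ := Finset.sum_nonneg fun ℓ _ => hφ0 ℓ
  have hone : ∑ ℓ, (if ℓ x = ℓ y ∧ ℓ (τ x) = ℓ (τ y) then φ ℓ else 0) ≤ (∑ ℓ, φ ℓ) / q := by
    rw [le_div_iff₀ hq', mul_comm, ← mul_sum_ite_label_eq (hφ x hx) hy]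
    refine mul_le_mul_of_nonneg_left (Finset.sum_le_sum fun ℓ _ => ?_) hq'.le
    by_cases h : ℓ x = ℓ y
    · by_cases h' : ℓ (τ x) = ℓ (τ y) <;> simp [h, h', hφ0]
    · simp [h]
  have hS1 : 0 ≤ (∑ ℓ, φ ℓ) / q := by positivity
  have hS2 : 0 ≤ (∑ ℓ, φ ℓ) / (q : ℝ) ^ 2 := by positivity
  by_cases h1 : y = τ x
  · rw [if_pos h1]
    split_ifs <;> linarith
  · by_cases h2 : y = τ⁻¹ x
    · rw [if_neg h1, if_pos h2]; linarith
    · rw [if_neg h1, if_neg h2, zero_add, zero_add, le_div_iff₀ (by positivity), mul_comm]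
      refine (sq_mul_sum_ite_label_eq (hφ x hx) (hφ (τ x) fun h => hx (τ.injective h)) hy hx
        (fun h => h2 ?_) (fun h => hy (τ.injective h))).le
      rw [← h]; simp

theorem sum_collisions_le (hq : 0 < q) (τ : Equiv.Perm X) {φ : (X → Fin q) → ℝ}
    (hφ0 : ∀ ℓ, 0 ≤ φ ℓ) (hφ : ∀ y, τ y ≠ y → IgnoresLabel φ y) {A : Finset X}
    (hA : ∀ x ∈ A, τ x ≠ x) {S : ℝ} (hS : ∑ ℓ, φ ℓ = S) :
    ∑ ℓ, ∑ x ∈ A, ∑ y ∈ Finset.univ.erase x,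
        (if ℓ x = ℓ y ∧ ℓ (τ x) = ℓ (τ y) then φ ℓ else 0) ≤
      Fintype.card X * (2 * (S / q) + Fintype.card X * (S / q ^ 2)) := by
  have hq' : (0 : ℝ) < q := by exact_mod_cast hq
  have hS0 : 0 ≤ S := hS ▸ Finset.sum_nonneg fun ℓ _ => hφ0 ℓ
  have hS1 : 0 ≤ S / q := by positivity
  have hS2 : 0 ≤ S / (q : ℝ) ^ 2 := by positivity
  have hinner : ∀ x ∈ A, ∑ ℓ, ∑ y ∈ Finset.univ.erase x,
      (if ℓ x = ℓ y ∧ ℓ (τ x) = ℓ (τ y) then φ ℓ else 0) ≤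
        2 * (S / q) + Fintype.card X * (S / q ^ 2) := by
    intro x hx
    rw [Finset.sum_comm]
    calc _ ≤ ∑ y ∈ Finset.univ.erase x, ((if y = τ x then S / q else 0) +
            (if y = τ⁻¹ x then S / q else 0) + S / q ^ 2) :=
          Finset.sum_le_sum fun y hy => hS ▸
            sum_ite_collision_le hq τ hφ0 hφ (hA x hx) (Finset.ne_of_mem_erase hy)
      _ ≤ ∑ y, ((if y = τ x then S / q else 0) +
            (if y = τ⁻¹ x then S / q else 0) + S / q ^ 2) := by
          refine Finset.sum_le_sum_of_subset_of_nonneg (Finset.erase_subset _ _) fun y _ _ => ?_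
          split_ifs <;> linarith
      _ = 2 * (S / q) + Fintype.card X * (S / q ^ 2) := by
          rw [Finset.sum_add_distrib, Finset.sum_add_distrib, Finset.sum_ite_eq',
            Finset.sum_ite_eq', if_pos (Finset.mem_univ _), if_pos (Finset.mem_univ _),
            Finset.sum_const, Finset.card_univ, nsmul_eq_mul]
          ring
  rw [Finset.sum_comm]
  refine (Finset.sum_le_sum hinner).trans ?_
  rw [Finset.sum_const, nsmul_eq_mul]
  refine mul_le_mul_of_nonneg_right ?_ (by positivity)
  exact_mod_cast Finset.card_le_univ A

/-- A first-order Bonferroni bound: without collisions every ranking of the fixed points extends,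
and a single collision already makes the left side nonpositive. -/
theorem sub_collisions_le_card_rankings (hq : 0 < q) (τ : Equiv.Perm X) {N k : ℕ}
    (hN : Fintype.card X = N) (ℓ : X → Fin q) {w : ℝ}
    (hw : ((rankings k (1 : Equiv.Perm {x // τ x = x}) (fixedLabels τ ℓ)).card : ℝ) = w) :
    w - ∑ x ∈ Finset.univ.filter (fun x => τ x ≠ x), ∑ y ∈ Finset.univ.erase x,
        (if ℓ x = ℓ y ∧ ℓ (τ x) = ℓ (τ y) then w else 0) ≤
      ((rankings N τ ℓ).card : ℝ) := by
  have hw0 : 0 ≤ w := hw ▸ Nat.cast_nonneg _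
  have hterm : ∀ x y, 0 ≤ if ℓ x = ℓ y ∧ ℓ (τ x) = ℓ (τ y) then w else 0 := fun x y => by
    split_ifs; exacts [hw0, le_rfl]
  by_cases hgood : ∀ x y, τ x ≠ x → y ≠ x → ¬ (ℓ x = ℓ y ∧ ℓ (τ x) = ℓ (τ y))
  · have h1 : w ≤ ((rankings N τ ℓ).card : ℝ) := by
      rw [← hw]
      exact Nat.cast_le.2 (card_rankings_fixedLabels_le hq τ ℓ hN hgood)
    exact (sub_le_self _ (Finset.sum_nonneg fun x _ =>
      Finset.sum_nonneg fun y _ => hterm x y)).trans h1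
  · push Not at hgood
    obtain ⟨x, y, hx, hy, h1⟩ := hgood
    refine le_trans (sub_nonpos.2 ?_) (Nat.cast_nonneg _)
    calc w = if ℓ x = ℓ y ∧ ℓ (τ x) = ℓ (τ y) then w else 0 := (if_pos h1).symm
      _ ≤ ∑ y ∈ Finset.univ.erase x, (if ℓ x = ℓ y ∧ ℓ (τ x) = ℓ (τ y) then w else 0) :=
        Finset.single_le_sum (f := fun y => if ℓ x = ℓ y ∧ ℓ (τ x) = ℓ (τ y) then w else 0)
          (fun y _ => hterm x y) (Finset.mem_erase.2 ⟨hy, Finset.mem_univ _⟩)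
      _ ≤ _ := Finset.single_le_sum (s := Finset.univ.filter fun x => τ x ≠ x)
          (f := fun x => ∑ y ∈ Finset.univ.erase x,
          (if ℓ x = ℓ y ∧ ℓ (τ x) = ℓ (τ y) then w else 0))
          (fun x _ => Finset.sum_nonneg fun y _ => hterm x y)
          (Finset.mem_filter.2 ⟨Finset.mem_univ _, hx⟩)

theorem le_sum_card_rankings (hq : 0 < q) (τ : Equiv.Perm X) {N k : ℕ}
    (hN : Fintype.card X = N) (hk : Fintype.card {x // τ x = x} = k) :
    (1 - N * (2 / q + N / q ^ 2)) *
        ((∑ ℓ : {x // τ x = x} → Fin q, ((rankings k 1 ℓ).card : ℝ)) / (q : ℝ) ^ k) ≤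
      (∑ ℓ : X → Fin q, ((rankings N τ ℓ).card : ℝ)) / (q : ℝ) ^ N := by
  have h2 := sum_fixedLabels hq τ fun ℓ => ((rankings k 1 ℓ).card : ℝ)
  rw [hN, hk] at h2
  rw [← h2, ← mul_div_assoc]
  refine div_le_div_of_nonneg_right ?_ (by positivity)
  obtain ⟨S, hS⟩ : ∃ S, ∑ ℓ : X → Fin q,
      ((rankings k (1 : Equiv.Perm {x // τ x = x}) (fixedLabels τ ℓ)).card : ℝ) = S := ⟨_, rfl⟩
  have h3 := sum_collisions_le hq τ
    (φ := fun ℓ => ((rankings k (1 : Equiv.Perm {x // τ x = x}) (fixedLabels τ ℓ)).card : ℝ))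
    (fun ℓ => Nat.cast_nonneg _)
    (fun y hy => ignoresLabel_fixedLabels τ (fun ℓ => ((rankings k 1 ℓ).card : ℝ)) hy)
    (A := Finset.univ.filter fun x => τ x ≠ x) (fun x hx => (Finset.mem_filter.1 hx).2) hS
  have h4 := Finset.sum_le_sum fun ℓ (_ : ℓ ∈ Finset.univ) =>
    sub_collisions_le_card_rankings (k := k) hq τ hN (ℓ : X → Fin q) rfl
  rw [Finset.sum_sub_distrib, hS] at h4
  rw [hN] at h3
  rw [hS]
  have e : (1 - N * (2 / q + N / q ^ 2)) * S = S - N * (2 * (S / q) + N * (S / q ^ 2)) := by ring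
  rw [e]
  exact (sub_le_sub_left h3 S).trans h4

/-- The double count: transporting along `r` turns a compatible pair for `τ` into a labelling
compatible with the conjugate of `τ` in the natural order. -/
theorem sum_card_rankings_eq (τ : Equiv.Perm X) (N : ℕ) :
    ∑ ℓ : X → Fin q, (rankings N τ ℓ).card =
      ∑ r : X ≃ Fin N, compatibleCount q (r.symm.trans (τ.trans r)) := by
  classical
  simp_rw [rankings, Finset.card_filter]
  rw [Finset.sum_comm]
  refine Finset.sum_congr rfl fun r _ => ?_
  unfold compatibleCount
  rw [Nat.card_eq_fintype_card, Fintype.card_subtype, Finset.card_filter,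
    ← (Equiv.arrowCongr r (Equiv.refl (Fin q))).sum_comp]
  refine Finset.sum_congr rfl fun ℓ _ => ?_
  congr 1
  rw [eq_iff_iff]
  constructor
  · intro h i j hij
    have := h (r.symm i) (r.symm j) (by simpa using hij)
    simpa using this
  · intro h x y hxy
    have := h (r x) (r y) hxy
    simpa using this

theorem sum_card_rankings_one {k : ℕ} (hk : Fintype.card X = k) :
    ∑ ℓ : X → Fin q, (rankings k 1 ℓ).card =
      k.factorial * compatibleCount q (1 : Equiv.Perm (Fin k)) := by
  rw [sum_card_rankings_eq]
  have : ∀ r : X ≃ Fin k, r.symm.trans ((1 : Equiv.Perm X).trans r) = 1 := fun r => by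
    ext i; simp
  simp_rw [this]
  rw [Finset.sum_const, Finset.card_univ, Fintype.card_equiv (Fintype.equivFinOfCardEq hk), hk,
    smul_eq_mul]

end Rankings

theorem card_fixed_eq_numFixedPoints {n : ℕ} (τ : Equiv.Perm (Fin n)) :
    Fintype.card {x // τ x = x} = numFixedPoints τ := by
  rw [Fintype.card_subtype]; rfl

theorem peaks_one (k : ℕ) : peaks (1 : Equiv.Perm (Fin k)) = 0 := by
  unfold peaks
  rw [Finset.card_eq_zero, Finset.filter_eq_empty_iff]
  rintro i - ⟨a, b, h1, h2, -, h3⟩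
  have : (b : ℕ) < i := h3
  omega

/-- The average of `labelRatio` over the conjugates of `τ` is close to its value at the identity
permutation of the fixed points of `τ`. -/
theorem labelRatio_average_bounds {n a : ℕ} (ha : n ≤ a) (ha0 : 0 < a) (τ : Equiv.Perm (Fin n)) :
    (1 - n * (1 / a + n / (2 * a) ^ 2)) * labelRatio a (numFixedPoints τ) (numFixedPoints τ - 1) ≤
      (∑ r : Equiv.Perm (Fin n), labelRatio a n (n - 1 - 2 * peaks (r * τ * r⁻¹))) / n.factorial ∧
    (∑ r : Equiv.Perm (Fin n), labelRatio a n (n - 1 - 2 * peaks (r * τ * r⁻¹))) / n.factorial ≤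
      (1 + (1 / (2 * a) + n / (2 * a) ^ 2)) ^ n *
        labelRatio a (numFixedPoints τ) (numFixedPoints τ - 1) := by
  have hq : 0 < 2 * a := by omega
  have haR : (0 : ℝ) < a := by exact_mod_cast ha0
  have hk := card_fixed_eq_numFixedPoints τ
  have hkn : numFixedPoints τ ≤ n := (Finset.card_le_univ _).trans (by simp)
  have h1 := sum_card_rankings_le hq τ (Fintype.card_fin n) hk
  have h2 := le_sum_card_rankings hq τ (Fintype.card_fin n) hk
  have e1 : (∑ ℓ : {x // τ x = x} → Fin (2 * a), ((rankings (numFixedPoints τ) 1 ℓ).card : ℝ)) /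
      ((2 * a : ℕ) : ℝ) ^ numFixedPoints τ =
        labelRatio a (numFixedPoints τ) (numFixedPoints τ - 1) := by
    have h3 := compatibleCount_eq_labelRatio (hkn.trans ha) ha0
      (1 : Equiv.Perm (Fin (numFixedPoints τ)))
    rw [peaks_one, mul_zero, Nat.sub_zero] at h3
    rw [← h3, ← Nat.cast_sum, sum_card_rankings_one hk]
    push_cast
    rfl
  have e2 : (∑ ℓ : Fin n → Fin (2 * a), ((rankings n τ ℓ).card : ℝ)) / ((2 * a : ℕ) : ℝ) ^ n =
      (∑ r : Equiv.Perm (Fin n), labelRatio a n (n - 1 - 2 * peaks (r * τ * r⁻¹))) /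
        n.factorial := by
    rw [← Nat.cast_sum, sum_card_rankings_eq, Nat.cast_sum, Finset.sum_div, Finset.sum_div]
    refine Finset.sum_congr rfl fun r _ => ?_
    rw [← compatibleCount_eq_labelRatio ha ha0]
    have : r * τ * r⁻¹ = r.symm.trans (Equiv.trans τ r) := rfl
    rw [this]
    have hf : (n.factorial : ℝ) ≠ 0 := by exact_mod_cast n.factorial_ne_zero
    push_cast
    field_simp
  rw [e1, e2] at h1 h2
  push_cast at h1 h2
  have e3 : (2 : ℝ) / (2 * a) = 1 / a := by field_simp
  rw [e3] at h2
  exact ⟨h2, h1⟩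


/-! ### Asymptotics of the label ratio -/

section Asymptotics

/-- Order four is needed: summed over up to `n` factors with `y = n / a`, the fourth-order terms
have size `n^5 / a^4`, which stays of order one at the chosen scale, whereas the fifth-order error
vanishes. -/
theorem abs_log_one_add_sub_le {z y : ℝ} (hz : |z| ≤ y) (hy : y ≤ 1 / 2) :
    |Real.log (1 + z) - (z - z ^ 2 / 2 + z ^ 3 / 3 - z ^ 4 / 4)| ≤ 2 * y ^ 5 := by
  have h1 := Real.abs_log_sub_add_sum_range_le (x := -z) (by rw [abs_neg]; linarith) 4
  rw [abs_neg, sub_neg_eq_add] at h1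
  have h2 : |z| ^ (4 + 1) / (1 - |z|) ≤ 2 * y ^ 5 := by
    rw [div_le_iff₀ (by linarith)]
    have h3 : |z| ^ (4 + 1) ≤ y ^ 5 := pow_le_pow_left₀ (abs_nonneg z) hz 5
    have h4 : 0 ≤ y ^ 5 := pow_nonneg ((abs_nonneg z).trans hz) 5
    nlinarith
  refine le_trans (le_of_eq ?_) (h1.trans h2)
  congr 1
  simp [Finset.sum_range_succ]
  ring

theorem sum_range_sub_pow_one (k : ℕ) (c : ℝ) :
    ∑ i ∈ Finset.range k, ((i : ℝ) - c) = k * (k - 1) / 2 - k * c := by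
  induction k with
  | zero => simp
  | succ k ih => rw [Finset.sum_range_succ, ih]; push_cast; ring

theorem sum_range_sub_pow_two (k : ℕ) (c : ℝ) :
    ∑ i ∈ Finset.range k, ((i : ℝ) - c) ^ 2 =
      (k - 1) * k * (2 * k - 1) / 6 - c * (k * (k - 1)) + k * c ^ 2 := by
  induction k with
  | zero => simp
  | succ k ih => rw [Finset.sum_range_succ, ih]; push_cast; ring

theorem sum_range_sub_pow_three (k : ℕ) (c : ℝ) :
    ∑ i ∈ Finset.range k, ((i : ℝ) - c) ^ 3 =
      (k * (k - 1) / 2) ^ 2 - 3 * c * ((k - 1) * k * (2 * k - 1) / 6) +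
        3 * c ^ 2 * (k * (k - 1) / 2) - k * c ^ 3 := by
  induction k with
  | zero => simp
  | succ k ih => rw [Finset.sum_range_succ, ih]; push_cast; ring

theorem sum_range_sub_pow_four (k : ℕ) (c : ℝ) :
    ∑ i ∈ Finset.range k, ((i : ℝ) - c) ^ 4 =
      k * (k - 1) * (2 * k - 1) * (3 * k ^ 2 - 3 * k - 1) / 30 -
        4 * c * (k * (k - 1) / 2) ^ 2 + 6 * c ^ 2 * ((k - 1) * k * (2 * k - 1) / 6) -
        4 * c ^ 3 * (k * (k - 1) / 2) + k * c ^ 4 := by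
  induction k with
  | zero => simp
  | succ k ih => rw [Finset.sum_range_succ, ih]; push_cast; ring

theorem abs_sum_log_sub_le {k : ℕ} {a J y : ℝ} (hy : y ≤ 1 / 2)
    (hz : ∀ i ∈ Finset.range k, |((i - ((k : ℝ) - 1) / 2) - J) / a| ≤ y) :
    |∑ i ∈ Finset.range k, Real.log (1 + ((i - ((k : ℝ) - 1) / 2) - J) / a) -
      (-(k * J) / a - ((k ^ 3 - k) / 12 + k * J ^ 2) / (2 * a ^ 2) -
        ((k ^ 3 - k) / 4 * J + k * J ^ 3) / (3 * a ^ 3) -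
        ((3 * k ^ 5 - 10 * k ^ 3 + 7 * k) / 240 + (k ^ 3 - k) / 2 * J ^ 2 + k * J ^ 4) /
          (4 * a ^ 4))| ≤ k * (2 * y ^ 5) := by
  set z : ℕ → ℝ := fun i => ((i - ((k : ℝ) - 1) / 2) - J) / a with hzdef
  have hpoly : ∑ i ∈ Finset.range k, (z i - z i ^ 2 / 2 + z i ^ 3 / 3 - z i ^ 4 / 4) =
      -(k * J) / a - ((k ^ 3 - k) / 12 + k * J ^ 2) / (2 * a ^ 2) -
        ((k ^ 3 - k) / 4 * J + k * J ^ 3) / (3 * a ^ 3) -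
        ((3 * k ^ 5 - 10 * k ^ 3 + 7 * k) / 240 + (k ^ 3 - k) / 2 * J ^ 2 + k * J ^ 4) /
          (4 * a ^ 4) := by
    set c : ℝ := ((k : ℝ) - 1) / 2 + J with hc
    have e : ∀ i : ℕ, z i = ((i : ℝ) - c) / a := fun i => by
      simp only [hzdef, hc]; ring
    clear_value z
    rw [Finset.sum_sub_distrib, Finset.sum_add_distrib, Finset.sum_sub_distrib,
      ← Finset.sum_div, ← Finset.sum_div, ← Finset.sum_div]
    simp_rw [e, div_pow]
    rw [← Finset.sum_div, ← Finset.sum_div, ← Finset.sum_div, ← Finset.sum_div,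
      sum_range_sub_pow_one, sum_range_sub_pow_two, sum_range_sub_pow_three,
      sum_range_sub_pow_four, hc]
    ring
  rw [← hpoly, ← Finset.sum_sub_distrib]
  refine (Finset.abs_sum_le_sum_abs _ _).trans ?_
  calc _ ≤ ∑ i ∈ Finset.range k, 2 * y ^ 5 :=
        Finset.sum_le_sum fun i hi => abs_log_one_add_sub_le (hz i hi) hy
    _ = _ := by simp

/-- The expression expanded is the log-density of the fair binomial law relative to the one with
success probability `1/2 - x/4`. -/
theorem abs_tilt_sub_le {m j : ℕ} (hj : j ≤ m) {x y : ℝ} (hx0 : 0 ≤ x) (hxy : x ≤ y)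
    (hy : y ≤ 1 / 2) :
    |(-(j * Real.log (1 - x / 2)) - (m - j) * Real.log (1 + x / 2)) -
      ((j - m / 2 : ℝ) * x + (j - m / 2 : ℝ) * x ^ 3 / 12 + m * x ^ 2 / 8 + m * x ^ 4 / 64)| ≤
      m * y ^ 5 := by
  have h1 := abs_log_one_add_sub_le (z := -(x / 2)) (y := y / 2)
    (by rw [abs_neg, abs_of_nonneg (by linarith)]; linarith) (by linarith)
  have h2 := abs_log_one_add_sub_le (z := x / 2) (y := y / 2)
    (by rw [abs_of_nonneg (by linarith)]; linarith) (by linarith)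
  rw [← sub_eq_add_neg] at h1
  have hy5 : 0 ≤ y ^ 5 := pow_nonneg (hx0.trans hxy) 5
  have h3 : 2 * (y / 2) ^ 5 ≤ y ^ 5 := by
    rw [div_pow]; norm_num; linarith
  have hj0 : (0 : ℝ) ≤ j := Nat.cast_nonneg j
  have hmj : (0 : ℝ) ≤ m - j := sub_nonneg.2 (by exact_mod_cast hj)
  rw [abs_le] at h1 h2 ⊢
  have a1 := mul_le_mul_of_nonneg_left (h1.1.trans' (neg_le_neg h3)) hj0
  have a2 := mul_le_mul_of_nonneg_left (h1.2.trans h3) hj0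
  have b1 := mul_le_mul_of_nonneg_left (h2.1.trans' (neg_le_neg h3)) hmj
  have b2 := mul_le_mul_of_nonneg_left (h2.2.trans h3) hmj
  constructor <;> nlinarith

/-- The limiting exponent of `labelRatio`. -/
noncomputable def ratioExponent (a k m : ℝ) : ℝ :=
  -k ^ 3 / (24 * a ^ 2) + k ^ 2 * m / (8 * a ^ 2) +
    (-k ^ 5 / 320 + k ^ 4 * m / 64 - k ^ 3 * m ^ 2 / 32) / a ^ 4

/-- Tilting with `x = k / a` cancels the leading linear term `-kJ/a` and moves the mean of `J` to
`-m x / 4`. Replacing `J²` by the square of that mean yields `ratioExponent`; the right side is what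
is left. -/
theorem exponent_poly_identity {a k m J : ℝ} (ha : a ≠ 0) :
    (-(k * J) / a - ((k ^ 3 - k) / 12 + k * J ^ 2) / (2 * a ^ 2) -
        ((k ^ 3 - k) / 4 * J + k * J ^ 3) / (3 * a ^ 3) -
        ((3 * k ^ 5 - 10 * k ^ 3 + 7 * k) / 240 + (k ^ 3 - k) / 2 * J ^ 2 + k * J ^ 4) /
          (4 * a ^ 4)) +
      (J * (k / a) + J * (k / a) ^ 3 / 12 + m * (k / a) ^ 2 / 8 + m * (k / a) ^ 4 / 64) -
      ratioExponent a k m =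
    -(k / a ^ 2) * ((J ^ 2 - (m * (k / a) / 4) ^ 2) / 2 +
        J ^ 2 * (J / a / 3 + ((k / a) ^ 2 - 1 / a ^ 2) / 8 + (J / a) ^ 2 / 4)) +
      (k / (24 * a ^ 2) + k * J / (12 * a ^ 3) + (10 * k ^ 3 - 7 * k) / (960 * a ^ 4)) := by
  unfold ratioExponent
  field_simp
  ring

/-- The deviation of the exponent from its limit, in terms of `x = k / a`, `s = 1 / a` and the
centred binomial variable `J`. -/
noncomputable def exponentDeviation (x s μ J : ℝ) : ℝ :=
  -(x * s) * ((J ^ 2 - μ ^ 2) / 2 + J ^ 2 * (J * s / 3 + (x ^ 2 - s ^ 2) / 8 + (J * s) ^ 2 / 4)) +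
    (x * s / 24 + x * (J * s) * s / 12 + (10 * x ^ 3 * s - 7 * x * s ^ 3) / 960)

theorem abs_deviation_factor_le {x y s w : ℝ} (hx0 : 0 ≤ x) (hxy : x ≤ y) (hs0 : 0 ≤ s)
    (hsy : s ≤ y) (hy1 : y ≤ 1) (hw : |w| ≤ y / 2) :
    |w / 3 + (x ^ 2 - s ^ 2) / 8 + w ^ 2 / 4| ≤ y / 2 := by
  have hy0 : 0 ≤ y := hx0.trans hxy
  have hw2 : w ^ 2 ≤ (y / 2) ^ 2 := sq_le_sq' (abs_le.1 hw).1 (abs_le.1 hw).2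
  have hyy : y ^ 2 ≤ y := by rw [pow_two]; exact mul_le_of_le_one_left hy0 hy1
  have hx2 : x ^ 2 ≤ y ^ 2 := pow_le_pow_left₀ hx0 hxy 2
  have hs2 : s ^ 2 ≤ y ^ 2 := pow_le_pow_left₀ hs0 hsy 2
  have h1 := abs_le.1 hw
  have h2 : (y / 2) ^ 2 = y ^ 2 / 4 := by ring
  rw [h2] at hw2
  rw [abs_le]
  constructor <;> linarith [sq_nonneg x, sq_nonneg s, sq_nonneg w, h1.1, h1.2]

theorem abs_deviation_residual_le {x y s w : ℝ} (hx0 : 0 ≤ x) (hxy : x ≤ y) (hs0 : 0 ≤ s)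
    (hsy : s ≤ y) (hy1 : y ≤ 1) (hw : |w| ≤ y / 2) :
    |x * s / 24 + x * w * s / 12 + (10 * x ^ 3 * s - 7 * x * s ^ 3) / 960| ≤ y / 2 := by
  have hy0 : 0 ≤ y := hx0.trans hxy
  have hx1 : x ^ 2 ≤ 1 := pow_le_one₀ hx0 (hxy.trans hy1)
  have hs1 : s ^ 2 ≤ 1 := pow_le_one₀ hs0 (hsy.trans hy1)
  have hu0 : 0 ≤ x * s := mul_nonneg hx0 hs0
  have huy : x * s ≤ y := by
    calc x * s ≤ y * 1 := mul_le_mul hxy (hsy.trans hy1) hs0 hy0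
      _ = y := mul_one y
  have h1 : |1 / 24 + w / 12 + (10 * x ^ 2 - 7 * s ^ 2) / 960| ≤ 1 / 2 := by
    have := abs_le.1 hw
    rw [abs_le]
    constructor <;> linarith [sq_nonneg x, sq_nonneg s]
  have h2 : x * s / 24 + x * w * s / 12 + (10 * x ^ 3 * s - 7 * x * s ^ 3) / 960 =
      x * s * (1 / 24 + w / 12 + (10 * x ^ 2 - 7 * s ^ 2) / 960) := by ring
  rw [h2, abs_mul, abs_of_nonneg hu0]
  calc x * s * |1 / 24 + w / 12 + (10 * x ^ 2 - 7 * s ^ 2) / 960| ≤ y * (1 / 2) :=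
        mul_le_mul huy h1 (abs_nonneg _) hy0
    _ = y / 2 := by ring

/-- As `1/2 + ρ ≥ 0`, the terms in `J²` enter with a negative sign and may be dropped, which leaves
an upper bound independent of `J`. -/
theorem deviation_le {n y u μ J ρ e K : ℝ} (hn : 0 < n) (hy1 : y ≤ 1)
    (hu0 : 0 ≤ u) (hun : u * n ≤ y ^ 2) (hμ : |μ| ≤ n * y / 4) (hρ : |ρ| ≤ y / 2)
    (he : |e| ≤ y / 2) (hK : n * y ^ 4 ≤ K) :
    -u * ((J ^ 2 - μ ^ 2) / 2 + J ^ 2 * ρ) + e ≤ K / 32 + 1 := by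
  have hμ2 : μ ^ 2 ≤ (n * y / 4) ^ 2 := sq_le_sq' (abs_le.1 hμ).1 (abs_le.1 hμ).2
  have huμ : u * μ ^ 2 ≤ K / 16 := by
    calc u * μ ^ 2 ≤ u * (n * y / 4) ^ 2 := by gcongr
      _ = (u * n) * (n * y ^ 2) / 16 := by ring
      _ ≤ y ^ 2 * (n * y ^ 2) / 16 := by gcongr
      _ = n * y ^ 4 / 16 := by ring
      _ ≤ K / 16 := by linarith
  have h1 : 0 ≤ u * (J ^ 2 * (1 / 2 + ρ)) := by
    have := (abs_le.1 hρ).1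
    exact mul_nonneg hu0 (mul_nonneg (sq_nonneg J) (by linarith))
  have h2 := (abs_le.1 he).2
  have h3 : -u * ((J ^ 2 - μ ^ 2) / 2 + J ^ 2 * ρ) + e =
      u * μ ^ 2 / 2 - u * (J ^ 2 * (1 / 2 + ρ)) + e := by ring
  rw [h3]
  linarith

theorem abs_deviation_quadratic_le {n y u μ D K : ℝ} (hn : 0 < n) (hy0 : 0 ≤ y) (hy1 : y ≤ 1)
    (hu0 : 0 ≤ u) (hun : u * n ≤ y ^ 2) (hμ : |μ| ≤ n * y / 4) (hK : n * y ^ 4 ≤ K) :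
    |u * (((D + μ) ^ 2 - μ ^ 2) / 2)| ≤ y / n * D ^ 2 / 2 + (K * (y / n * D ^ 2) + y) / 8 := by
  have hyy : y ^ 2 ≤ y := by rw [pow_two]; exact mul_le_of_le_one_left hy0 hy1
  have hun' : u ≤ y / n := by rw [le_div_iff₀ hn]; exact hun.trans hyy
  have hyK : y ^ 5 ≤ K * (y / n) := by
    rw [← mul_div_assoc, le_div_iff₀ hn]
    calc y ^ 5 * n = n * y ^ 4 * y := by ring
      _ ≤ K * y := by gcongr
  have h1 : u * (((D + μ) ^ 2 - μ ^ 2) / 2) = u * D ^ 2 / 2 + u * (μ * D) := by ring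
  have h2 : |u * (μ * D)| ≤ y ^ 3 / 4 * |D| := by
    rw [abs_mul, abs_mul, abs_of_nonneg hu0]
    calc u * (|μ| * |D|) ≤ u * (n * y / 4 * |D|) := by gcongr
      _ = (u * n) * y / 4 * |D| := by ring
      _ ≤ y ^ 2 * y / 4 * |D| := by gcongr
      _ = y ^ 3 / 4 * |D| := by ring
  have h3 : y ^ 3 / 4 * |D| ≤ (y ^ 5 * D ^ 2 + y) / 8 := by
    have h4 : 2 * (y ^ 2 * |D|) ≤ (y ^ 2 * |D|) ^ 2 + 1 := by
      linarith [sq_nonneg (y ^ 2 * |D| - 1)]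
    have h5 : (y ^ 2 * |D|) ^ 2 = y ^ 4 * D ^ 2 := by rw [mul_pow, sq_abs]; ring
    rw [h5] at h4
    have := mul_le_mul_of_nonneg_left h4 (show 0 ≤ y / 8 by linarith)
    calc y ^ 3 / 4 * |D| = y / 8 * (2 * (y ^ 2 * |D|)) := by ring
      _ ≤ _ := this
      _ = _ := by ring
  have h6 : y ^ 5 * D ^ 2 ≤ K * (y / n * D ^ 2) := by
    rw [← mul_assoc]; gcongr
  have h7 : |u * D ^ 2 / 2| ≤ y / n * D ^ 2 / 2 := by
    rw [abs_of_nonneg (by positivity)]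
    gcongr
  rw [h1]
  refine (abs_add_le _ _).trans ?_
  linarith

theorem abs_deviation_cubic_le {n y u μ D ρ K : ℝ} (hn : 0 < n) (hy0 : 0 ≤ y) (hy1 : y ≤ 1)
    (hu0 : 0 ≤ u) (hun : u * n ≤ y ^ 2) (hμ : |μ| ≤ n * y / 4) (hρ : |ρ| ≤ y / 2)
    (hK : n * y ^ 4 ≤ K) :
    |u * ((D + μ) ^ 2 * ρ)| ≤ y / n * D ^ 2 + K * y / 16 := by
  have hyy : y ^ 2 ≤ y := by rw [pow_two]; exact mul_le_of_le_one_left hy0 hy1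
  have hun' : u ≤ y / n := by rw [le_div_iff₀ hn]; exact hun.trans hyy
  have hμ2 : μ ^ 2 ≤ (n * y / 4) ^ 2 := sq_le_sq' (abs_le.1 hμ).1 (abs_le.1 hμ).2
  have huμ : u * μ ^ 2 ≤ K / 16 := by
    calc u * μ ^ 2 ≤ u * (n * y / 4) ^ 2 := by gcongr
      _ = (u * n) * (n * y ^ 2) / 16 := by ring
      _ ≤ y ^ 2 * (n * y ^ 2) / 16 := by gcongr
      _ = n * y ^ 4 / 16 := by ring
      _ ≤ K / 16 := by linarith
  rw [abs_mul, abs_mul, abs_of_nonneg hu0, abs_of_nonneg (sq_nonneg (D + μ))]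
  have h1 : (D + μ) ^ 2 ≤ 2 * D ^ 2 + 2 * μ ^ 2 := by linarith [sq_nonneg (D - μ)]
  calc u * ((D + μ) ^ 2 * |ρ|) ≤ u * ((2 * D ^ 2 + 2 * μ ^ 2) * (y / 2)) := by gcongr
    _ = u * D ^ 2 * y + (u * μ ^ 2) * y := by ring
    _ ≤ y / n * D ^ 2 * 1 + K / 16 * y := by gcongr
    _ = _ := by ring

/-- The first bound keeps the exponential bounded; the second has mean `O(K y)` under a binomial law
centred at `μ`, whose variance is at most `n / 4`. -/
theorem exponentDeviation_bounds {n x y s μ J K : ℝ} (hn : 1 ≤ n) (hx0 : 0 ≤ x) (hxy : x ≤ y)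
    (hy1 : y ≤ 1) (hs0 : 0 ≤ s) (hs : s * n = y) (hμ : |μ| ≤ n * y / 4) (hJ : |J| ≤ n / 2)
    (hK1 : 1 ≤ K) (hK : n * y ^ 4 ≤ K) :
    exponentDeviation x s μ J ≤ K / 32 + 1 ∧
      |exponentDeviation x s μ J| ≤ 2 * K * y * (1 + (J - μ) ^ 2 / n) := by
  have hn0 : 0 < n := by linarith
  have hy0 : 0 ≤ y := hx0.trans hxy
  have hsy : s ≤ y := by rw [← hs]; exact le_mul_of_one_le_right hs0 hn
  have hw : |J * s| ≤ y / 2 := by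
    rw [abs_mul, abs_of_nonneg hs0]
    calc |J| * s ≤ n / 2 * s := by gcongr
      _ = y / 2 := by rw [← hs]; ring
  have hρ := abs_deviation_factor_le hx0 hxy hs0 hsy hy1 hw
  have he := abs_deviation_residual_le hx0 hxy hs0 hsy hy1 hw
  have hu0 : 0 ≤ x * s := mul_nonneg hx0 hs0
  have hun : x * s * n ≤ y ^ 2 := by
    rw [mul_assoc, hs, pow_two]; gcongr
  unfold exponentDeviation
  generalize J * s / 3 + (x ^ 2 - s ^ 2) / 8 + (J * s) ^ 2 / 4 = ρ at hρ ⊢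
  generalize x * s / 24 + x * (J * s) * s / 12 + (10 * x ^ 3 * s - 7 * x * s ^ 3) / 960 = e at he ⊢
  generalize x * s = u at hu0 hun ⊢
  refine ⟨deviation_le hn0 hy1 hu0 hun hμ hρ he hK, ?_⟩
  obtain ⟨D, rfl⟩ : ∃ D, J = D + μ := ⟨J - μ, by ring⟩
  have t1 := abs_deviation_quadratic_le (D := D) hn0 hy0 hy1 hu0 hun hμ hK
  have t2 := abs_deviation_cubic_le (D := D) hn0 hy0 hy1 hu0 hun hμ hρ hK
  have t3 : |-u * (((D + μ) ^ 2 - μ ^ 2) / 2 + (D + μ) ^ 2 * ρ) + e| ≤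
      |u * (((D + μ) ^ 2 - μ ^ 2) / 2)| + |u * ((D + μ) ^ 2 * ρ)| + |e| := by
    have : -u * (((D + μ) ^ 2 - μ ^ 2) / 2 + (D + μ) ^ 2 * ρ) + e =
        -(u * (((D + μ) ^ 2 - μ ^ 2) / 2)) + -(u * ((D + μ) ^ 2 * ρ)) + e := by ring
    rw [this]
    refine (abs_add_three _ _ _).trans_eq ?_
    rw [abs_neg, abs_neg]
  refine t3.trans ?_
  have hq : 0 ≤ y / n * D ^ 2 := by positivity
  have hKq : y / n * D ^ 2 ≤ K * (y / n * D ^ 2) := le_mul_of_one_le_left hq hK1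
  have hKy : y ≤ K * y := le_mul_of_one_le_left hy0 hK1
  have e2 : 2 * K * y * (1 + (D + μ - μ) ^ 2 / n) = 2 * (K * y) + 2 * (K * (y / n * D ^ 2)) := by
    ring
  rw [e2]
  linarith

theorem sum_bernstein (m : ℕ) (ν : ℝ) :
    ∑ j ∈ Finset.range (m + 1), (m.choose j : ℝ) * (ν ^ j * (1 - ν) ^ (m - j)) = 1 := by
  have := add_pow ν (1 - ν) m
  rw [add_sub_cancel, one_pow] at this
  refine Eq.trans ?_ this.symm
  exact Finset.sum_congr rfl fun j _ => by ring

theorem sum_bernstein_variance (m : ℕ) (ν : ℝ) :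
    ∑ j ∈ Finset.range (m + 1), (m.choose j : ℝ) * (ν ^ j * (1 - ν) ^ (m - j)) *
      (j - m * ν) ^ 2 = m * (ν * (1 - ν)) := by
  have h := congrArg (Polynomial.eval ν) (bernsteinPolynomial.variance (R := ℝ) m)
  simp only [bernsteinPolynomial, Polynomial.eval_finsetSum, Polynomial.eval_mul,
    Polynomial.eval_pow, Polynomial.eval_sub, Polynomial.eval_X,
    Polynomial.eval_natCast, Polynomial.eval_one, nsmul_eq_mul] at h
  rw [← mul_assoc, ← h]
  exact Finset.sum_congr rfl fun j _ => by ring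

theorem abs_exp_sub_one_le_mul {u B : ℝ} (hB : 0 ≤ B) (hu : u ≤ B) :
    |Real.exp u - 1| ≤ Real.exp B * |u| := by
  have hB1 : 1 ≤ Real.exp B := Real.one_le_exp hB
  rcases le_total 0 u with h | h
  · rw [abs_of_nonneg (by linarith [Real.one_le_exp h]), abs_of_nonneg h]
    have h1 : 1 - u ≤ Real.exp (-u) := by linarith [Real.add_one_le_exp (-u)]
    have h2 : Real.exp u * Real.exp (-u) = 1 := by rw [← Real.exp_add]; simp
    have h3 := mul_le_mul_of_nonneg_left h1 (Real.exp_pos u).le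
    have h4 : Real.exp u ≤ Real.exp B := Real.exp_le_exp.2 hu
    nlinarith
  · rw [abs_of_nonpos (by linarith [Real.exp_le_one_iff.2 h]), abs_of_nonpos h]
    have h1 := Real.add_one_le_exp u
    nlinarith

/-- The exponent of the `j`-th summand of `labelRatio` relative to the binomial weights with
success probability `1 / 2 - x / 4`. -/
noncomputable def tiltedExponent (a x : ℝ) (k m j : ℕ) : ℝ :=
  ∑ i ∈ Finset.range k, Real.log (1 + ((i - ((k : ℝ) - 1) / 2) - (j - m / 2)) / a) +
    (-(j * Real.log (1 - x / 2)) - (m - j) * Real.log (1 + x / 2))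

theorem labelRatio_summand_eq {a x : ℝ} {k m j : ℕ} (hj : j ≤ m) (hx0 : 0 ≤ x) (hx1 : x ≤ 1)
    (hpos : ∀ i ∈ Finset.range k, 0 < 1 + ((i - ((k : ℝ) - 1) / 2) - ((j : ℝ) - m / 2)) / a) :
    (1 / 2 : ℝ) ^ m * ((m.choose j : ℝ) *
      ∏ i ∈ Finset.range k, (1 + ((i - ((k : ℝ) - 1) / 2) - (j - m / 2)) / a)) =
    (m.choose j : ℝ) * ((1 / 2 - x / 4) ^ j * (1 - (1 / 2 - x / 4)) ^ (m - j)) *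
      Real.exp (tiltedExponent a x k m j) := by
  have h1 : Real.exp (tiltedExponent a x k m j) =
      (∏ i ∈ Finset.range k, (1 + ((i - ((k : ℝ) - 1) / 2) - (j - m / 2)) / a)) *
        (((1 - x / 2) ^ j)⁻¹ * ((1 + x / 2) ^ (m - j))⁻¹) := by
    have e1 : Real.exp (-(j * Real.log (1 - x / 2)) - (m - j) * Real.log (1 + x / 2)) =
        ((1 - x / 2) ^ j)⁻¹ * ((1 + x / 2) ^ (m - j))⁻¹ := by
      rw [← Nat.cast_sub hj, sub_eq_add_neg, Real.exp_add, Real.exp_neg, Real.exp_neg,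
        Real.exp_nat_mul, Real.exp_log (by linarith), Real.exp_nat_mul,
        Real.exp_log (by linarith)]
    rw [tiltedExponent, Real.exp_add, Real.exp_sum, e1]
    congr 1
    exact Finset.prod_congr rfl fun i hi => Real.exp_log (hpos i hi)
  have h2 : (1 / 2 - x / 4) ^ j * (1 - (1 / 2 - x / 4)) ^ (m - j) =
      (1 / 2) ^ m * ((1 - x / 2) ^ j * (1 + x / 2) ^ (m - j)) := by
    have e1 : 1 / 2 - x / 4 = 1 / 2 * (1 - x / 2) := by ring
    have e2 : 1 - (1 / 2 - x / 4) = 1 / 2 * (1 + x / 2) := by ring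
    have e3 : (1 / 2 : ℝ) ^ m = (1 / 2) ^ j * (1 / 2) ^ (m - j) := by
      rw [← pow_add]; congr 1; omega
    rw [e2, e1, mul_pow, mul_pow, e3]; ring
  have h3 : (1 - x / 2) ^ j ≠ 0 := pow_ne_zero _ (by linarith)
  have h4 : (1 + x / 2) ^ (m - j) ≠ 0 := pow_ne_zero _ (by linarith)
  rw [h1, h2]
  generalize (1 - x / 2) ^ j = A at h3 ⊢
  generalize (1 + x / 2) ^ (m - j) = B at h4 ⊢
  generalize ∏ i ∈ Finset.range k, (1 + ((i - ((k : ℝ) - 1) / 2) - ((j : ℝ) - m / 2)) / a) = Q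
  field_simp

theorem tiltedExponent_bounds {n k m j : ℕ} {a K : ℝ} (hn : 1 ≤ n) (hk : k ≤ n) (hm : m ≤ n)
    (hj : j ≤ m) (ha : 4 * (n : ℝ) ≤ a) (hK1 : 1 ≤ K) (hK : (n : ℝ) * (n / a) ^ 4 ≤ K)
    (hz : ∀ i ∈ Finset.range k, |((i - ((k : ℝ) - 1) / 2) - ((j : ℝ) - m / 2)) / a| ≤ n / a) :
    tiltedExponent a (k / a) k m j - ratioExponent a k m ≤ 5 * K ∧
      |tiltedExponent a (k / a) k m j - ratioExponent a k m| ≤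
        5 * K * (n / a) * (1 + (j - m * (1 / 2 - k / a / 4)) ^ 2 / n) := by
  have hnR : (1 : ℝ) ≤ n := by exact_mod_cast hn
  have hkR : (k : ℝ) ≤ n := by exact_mod_cast hk
  have hmR : (m : ℝ) ≤ n := by exact_mod_cast hm
  have hjR : (j : ℝ) ≤ m := by exact_mod_cast hj
  have hj0 : (0 : ℝ) ≤ j := Nat.cast_nonneg j
  have ha0 : 0 < a := by linarith
  have hy4 : (n : ℝ) / a ≤ 1 / 4 := by rw [div_le_iff₀ ha0]; linarith
  have hxy : (k : ℝ) / a ≤ n / a := by gcongr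
  have hx0 : (0 : ℝ) ≤ k / a := by positivity
  have hy0 : (0 : ℝ) ≤ n / a := by positivity
  have h1 := abs_sum_log_sub_le (by linarith) hz
  have h2 := abs_tilt_sub_le hj hx0 hxy (by linarith)
  have h3 := exponent_poly_identity (a := a) (k := k) (m := m) (J := (j : ℝ) - m / 2) ha0.ne'
  have h4 : -((k : ℝ) / a ^ 2) * ((((j : ℝ) - m / 2) ^ 2 - (m * (k / a) / 4) ^ 2) / 2 +
      ((j : ℝ) - m / 2) ^ 2 * (((j : ℝ) - m / 2) / a / 3 + ((k / a) ^ 2 - 1 / a ^ 2) / 8 +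
        (((j : ℝ) - m / 2) / a) ^ 2 / 4)) + (k / (24 * a ^ 2) +
        k * ((j : ℝ) - m / 2) / (12 * a ^ 3) + (10 * k ^ 3 - 7 * k) / (960 * a ^ 4)) =
      exponentDeviation (k / a) (1 / a) (-(m * (k / a) / 4)) ((j : ℝ) - m / 2) := by
    unfold exponentDeviation
    generalize (j : ℝ) - m / 2 = J
    ring
  rw [h4] at h3
  have h5 := exponentDeviation_bounds (n := n) (x := k / a) (y := n / a) (s := 1 / a)
    (μ := -(m * (k / a) / 4)) (J := (j : ℝ) - m / 2) (K := K) hnR hx0 hxy (by linarith)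
    (by positivity) (by ring)
    (by rw [abs_neg, abs_of_nonneg (by positivity)]; gcongr)
    (by rw [abs_le]; constructor <;> linarith) hK1 hK
  have hJμ : (j : ℝ) - m / 2 - -(m * (k / a) / 4) = j - m * (1 / 2 - k / a / 4) := by ring
  rw [hJμ] at h5
  have hdec : |tiltedExponent a (k / a) k m j - ratioExponent a k m -
      exponentDeviation (k / a) (1 / a) (-(m * (k / a) / 4)) ((j : ℝ) - m / 2)| ≤
        3 * (K * (n / a)) := by
    have hy5 : (n : ℝ) * (n / a) ^ 5 ≤ K * (n / a) := by
      calc (n : ℝ) * (n / a) ^ 5 = n * (n / a) ^ 4 * (n / a) := by ring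
        _ ≤ K * (n / a) := by gcongr
    have e1 : (k : ℝ) * (2 * (n / a) ^ 5) ≤ 2 * (K * (n / a)) := by
      calc (k : ℝ) * (2 * (n / a) ^ 5) ≤ n * (2 * (n / a) ^ 5) := by gcongr
        _ = 2 * (n * (n / a) ^ 5) := by ring
        _ ≤ _ := by gcongr
    have e2 : (m : ℝ) * (n / a) ^ 5 ≤ K * (n / a) := by
      calc (m : ℝ) * (n / a) ^ 5 ≤ n * (n / a) ^ 5 := by gcongr
        _ ≤ _ := hy5
    rw [← h3, tiltedExponent]
    have h6 := (abs_add_le _ _).trans (add_le_add (h1.trans e1) (h2.trans e2))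
    refine (le_of_eq (congrArg _ ?_)).trans (h6.trans (by linarith))
    ring
  generalize exponentDeviation (k / a) (1 / a) (-(m * (k / a) / 4)) ((j : ℝ) - m / 2) = E
    at h5 hdec
  generalize tiltedExponent a (k / a) k m j - ratioExponent a k m = T at hdec ⊢
  have hV0 : 0 ≤ ((j : ℝ) - m * (1 / 2 - k / a / 4)) ^ 2 / n := by positivity
  generalize ((j : ℝ) - m * (1 / 2 - k / a / 4)) ^ 2 / n = V at h5 hV0 ⊢
  generalize (n : ℝ) / a = y at h5 hdec hy4 hy0 ⊢
  have hKy0 : 0 ≤ K * y := by positivity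
  have hKy4 : K * y ≤ K * (1 / 4) := by gcongr
  constructor
  · linarith [h5.1, (abs_le.1 hdec).2]
  · have h6 : |T| ≤ |T - E| + |E| := by
      have := abs_add_le (T - E) E
      rwa [sub_add_cancel] at this
    have h8 : K * y * 1 ≤ K * y * (1 + V) := by gcongr; linarith
    have h9 : 5 * K * y * (1 + V) = 3 * (K * y * (1 + V)) + 2 * K * y * (1 + V) := by ring
    rw [h9]
    linarith [h5.2]

/-- Under the tilted binomial law the left side is the mean of `exp (T - L) - 1`, which `exp (5K) *
|T - L|` dominates; the binomial variance then bounds the mean. -/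
theorem abs_labelRatio_mul_exp_sub_one_le {n k m : ℕ} {a K : ℝ} (hn : 1 ≤ n) (hk : k ≤ n)
    (hm : m ≤ n) (ha : 4 * (n : ℝ) ≤ a) (hK1 : 1 ≤ K) (hK : (n : ℝ) ^ 5 ≤ K * a ^ 4) :
    |labelRatio a k m * Real.exp (-ratioExponent a k m) - 1| ≤
      Real.exp (5 * K) * (7 * K * (n / a)) := by
  have hnR : (1 : ℝ) ≤ n := by exact_mod_cast hn
  have hkR : (k : ℝ) ≤ n := by exact_mod_cast hk
  have hmR : (m : ℝ) ≤ n := by exact_mod_cast hm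
  have ha0 : 0 < a := by linarith
  have hy4 : (n : ℝ) / a ≤ 1 / 4 := by rw [div_le_iff₀ ha0]; linarith
  have hKy : (n : ℝ) * (n / a) ^ 4 ≤ K := by
    rw [div_pow, ← mul_div_assoc, div_le_iff₀ (by positivity)]
    calc (n : ℝ) * n ^ 4 = n ^ 5 := by ring
      _ ≤ _ := hK
  have hx0 : (0 : ℝ) ≤ k / a := by positivity
  have hxy : (k : ℝ) / a ≤ n / a := by gcongr
  have hzb : ∀ j ≤ m, ∀ i ∈ Finset.range k,
      |((i - ((k : ℝ) - 1) / 2) - ((j : ℝ) - m / 2)) / a| ≤ n / a := by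
    intro j hj i hi
    have hjR : (j : ℝ) ≤ m := by exact_mod_cast hj
    have hj0 : (0 : ℝ) ≤ j := Nat.cast_nonneg j
    have hi1 : (i : ℝ) + 1 ≤ k := by exact_mod_cast Finset.mem_range.1 hi
    have hi0 : (0 : ℝ) ≤ i := Nat.cast_nonneg i
    rw [abs_div, abs_of_pos ha0]
    gcongr
    rw [abs_le]
    constructor <;> linarith
  have hbounds := fun j (hj : j ∈ Finset.range (m + 1)) =>
    tiltedExponent_bounds hn hk hm (Nat.lt_succ_iff.1 (Finset.mem_range.1 hj)) ha hK1 hKy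
      (hzb j (Nat.lt_succ_iff.1 (Finset.mem_range.1 hj)))
  have hsum : labelRatio a k m = ∑ j ∈ Finset.range (m + 1), (m.choose j : ℝ) *
      ((1 / 2 - k / a / 4) ^ j * (1 - (1 / 2 - k / a / 4)) ^ (m - j)) *
        Real.exp (tiltedExponent a (k / a) k m j) := by
    rw [labelRatio, Finset.mul_sum]
    refine Finset.sum_congr rfl fun j hj => ?_
    have hj' : j ≤ m := Nat.lt_succ_iff.1 (Finset.mem_range.1 hj)
    refine labelRatio_summand_eq hj' hx0 (by linarith) fun i hi => ?_
    have := (abs_le.1 (hzb j hj' i hi)).1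
    linarith
  have e1 := sum_bernstein m (1 / 2 - k / a / 4)
  have e2 := sum_bernstein_variance m (1 / 2 - k / a / 4)
  have hb0 : ∀ j, 0 ≤ (m.choose j : ℝ) *
      ((1 / 2 - (k : ℝ) / a / 4) ^ j * (1 - (1 / 2 - k / a / 4)) ^ (m - j)) := fun j => by
    have h1 : 0 ≤ 1 / 2 - (k : ℝ) / a / 4 := by linarith
    have h2 : 0 ≤ 1 - (1 / 2 - (k : ℝ) / a / 4) := by linarith
    positivity
  have hvar : (m : ℝ) * ((1 / 2 - k / a / 4) * (1 - (1 / 2 - k / a / 4))) ≤ n * (1 / 4) := by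
    have h1 : (1 / 2 - (k : ℝ) / a / 4) * (1 - (1 / 2 - k / a / 4)) = 1 / 4 - (k / a / 4) ^ 2 := by
      ring
    have h2 : 0 ≤ 1 / 4 - ((k : ℝ) / a / 4) ^ 2 := by
      have : ((k : ℝ) / a / 4) ^ 2 ≤ (1 / 2) ^ 2 :=
        pow_le_pow_left₀ (by positivity) (by linarith) 2
      linarith
    rw [h1]
    exact mul_le_mul hmR (by linarith [sq_nonneg ((k : ℝ) / a / 4)]) h2 (by positivity)
  rw [hsum]
  generalize (1 / 2 - (k : ℝ) / a / 4) = ν at hbounds e1 e2 hb0 hvar ⊢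
  generalize ratioExponent a k m = L at hbounds ⊢
  generalize (n : ℝ) / a = y at hbounds hy4 hxy ⊢
  have hy0 : 0 ≤ y := hx0.trans hxy
  obtain ⟨b, hb⟩ : ∃ b : ℕ → ℝ, b = fun j => (m.choose j : ℝ) * (ν ^ j * (1 - ν) ^ (m - j)) :=
    ⟨_, rfl⟩
  obtain ⟨T, hT⟩ : ∃ T : ℕ → ℝ, T = fun j => tiltedExponent a (k / a) k m j := ⟨_, rfl⟩
  simp only [← congrFun hb, ← congrFun hT] at hbounds e1 e2 hb0 ⊢
  have hratio : (∑ j ∈ Finset.range (m + 1), b j * Real.exp (T j)) * Real.exp (-L) - 1 =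
      ∑ j ∈ Finset.range (m + 1), b j * (Real.exp (T j - L) - 1) := by
    simp_rw [mul_sub, mul_one]
    rw [Finset.sum_sub_distrib, e1, Finset.sum_mul]
    congr 1
    refine Finset.sum_congr rfl fun j _ => ?_
    rw [sub_eq_add_neg, Real.exp_add, mul_assoc]
  rw [hratio]
  calc |∑ j ∈ Finset.range (m + 1), b j * (Real.exp (T j - L) - 1)|
      ≤ ∑ j ∈ Finset.range (m + 1), |b j * (Real.exp (T j - L) - 1)| :=
        Finset.abs_sum_le_sum_abs _ _
    _ ≤ ∑ j ∈ Finset.range (m + 1), (Real.exp (5 * K) * (5 * K * y) * b j +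
          Real.exp (5 * K) * (5 * K * y / n) * (b j * (j - m * ν) ^ 2)) := by
        refine Finset.sum_le_sum fun j hj => ?_
        rw [abs_mul, abs_of_nonneg (hb0 j)]
        obtain ⟨h1, h2⟩ := hbounds j hj
        calc b j * |Real.exp (T j - L) - 1|
            ≤ b j * (Real.exp (5 * K) * (5 * K * y * (1 + (j - m * ν) ^ 2 / n))) := by
              refine mul_le_mul_of_nonneg_left ?_ (hb0 j)
              refine (abs_exp_sub_one_le_mul (by positivity) h1).trans ?_
              gcongr
          _ = _ := by ring
    _ = Real.exp (5 * K) * (5 * K * y) +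
          Real.exp (5 * K) * (5 * K * y / n) * (m * (ν * (1 - ν))) := by
        rw [Finset.sum_add_distrib, ← Finset.mul_sum, ← Finset.mul_sum, e1, e2, mul_one]
    _ ≤ Real.exp (5 * K) * (5 * K * y) + Real.exp (5 * K) * (5 * K * y / n) * (n * (1 / 4)) := by
        gcongr
    _ = Real.exp (5 * K) * (25 / 4 * K * y) := by field_simp; ring
    -- The constant 7 rounds up `5 * (1 + 1/4)`, with 1/4 from the variance.
    _ ≤ Real.exp (5 * K) * (7 * K * y) := by
        gcongr
        norm_num

end Asymptotics


/-! ### Class averages and removal of the quadratic tilt -/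

instance {n : ℕ} : DiscreteMeasurableSpace (Equiv.Perm (Fin n)) := ⟨fun _ => trivial⟩

/-- Summing `g (r * σ * r⁻¹)` over both `r` and `σ` gives each side, according to which sum is done
first; no centralizer has to be counted. -/
theorem sum_carrier_eq_sum_conj {G : Type*} [Group G] [Fintype G] (τ : G) (g : G → ℝ)
    (s : Finset G) (hs : (s : Set G) = (ConjClasses.mk τ).carrier) :
    (Fintype.card G : ℝ) * ∑ σ ∈ s, g σ = s.card * ∑ r : G, g (r * τ * r⁻¹) := by
  have hmem : ∀ σ, σ ∈ s ↔ IsConj σ τ := fun σ => by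
    rw [← Finset.mem_coe, hs, ConjClasses.mem_carrier_iff_mk_eq, ConjClasses.mk_eq_mk_iff_isConj]
  have h1 : ∀ r : G, ∑ σ ∈ s, g (r * σ * r⁻¹) = ∑ σ ∈ s, g σ := fun r => by
    refine Finset.sum_bij (fun σ _ => r * σ * r⁻¹) (fun σ hσ => ?_) (fun σ _ σ' _ h => ?_)
      (fun σ hσ => ⟨r⁻¹ * σ * r, ?_, by group⟩) (fun _ _ => rfl)
    · rw [hmem] at hσ ⊢
      exact IsConj.trans (isConj_iff.2 ⟨r⁻¹, by group⟩) hσ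
    · simpa using h
    · rw [hmem] at hσ ⊢
      exact IsConj.trans (isConj_iff.2 ⟨r, by group⟩) hσ
  have h2 : ∀ σ ∈ s, ∑ r : G, g (r * σ * r⁻¹) = ∑ r : G, g (r * τ * r⁻¹) := fun σ hσ => by
    obtain ⟨c, rfl⟩ := isConj_iff.1 ((hmem σ).1 hσ).symm
    refine Fintype.sum_equiv (Equiv.mulRight c) _ _ fun r => ?_
    simp [mul_assoc]
  calc (Fintype.card G : ℝ) * ∑ σ ∈ s, g σ = ∑ r : G, ∑ σ ∈ s, g (r * σ * r⁻¹) := by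
        simp [h1]
    _ = ∑ σ ∈ s, ∑ r : G, g (r * σ * r⁻¹) := Finset.sum_comm
    _ = _ := by rw [Finset.sum_congr rfl h2]; simp

theorem integral_uniformOn_carrier {G : Type*} [Group G] [Fintype G] [MeasurableSpace G]
    [MeasurableSingletonClass G] (τ : G) (g : G → ℝ) :
    ∫ σ, g σ ∂(uniformOn (ConjClasses.mk τ).carrier) =
      (∑ r : G, g (r * τ * r⁻¹)) / Fintype.card G := by
  classical
  set s : Finset G := (ConjClasses.mk τ).carrier.toFinite.toFinset with hs
  have hs' : (s : Set G) = (ConjClasses.mk τ).carrier := by simp [hs]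
  have hne : τ ∈ s := by
    rw [← Finset.mem_coe, hs']; exact ConjClasses.mem_carrier_mk
  have hc : (s.card : ℝ) ≠ 0 := by exact_mod_cast (Finset.card_pos.2 ⟨τ, hne⟩).ne'
  have : Nonempty G := ⟨τ⟩
  have hG : (Fintype.card G : ℝ) ≠ 0 := by exact_mod_cast Fintype.card_ne_zero
  have hfin : IsFiniteMeasure (uniformOn (ConjClasses.mk τ).carrier) := by
    rw [← hs']
    have := isProbabilityMeasure_uniformOn (s := (s : Set G)) s.finite_toSet ⟨τ, hne⟩
    infer_instance
  rw [integral_fintype Integrable.of_finite, eq_div_iff hG]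
  have h := sum_carrier_eq_sum_conj τ g s hs'
  have hmeas : ∀ σ : G, (uniformOn (ConjClasses.mk τ).carrier).real {σ} =
      if σ ∈ s then (s.card : ℝ)⁻¹ else 0 := fun σ => by
    rw [Measure.real, ← hs', ← Finset.coe_singleton, uniformOn_apply_finset]
    by_cases hσ : σ ∈ s
    · rw [Finset.inter_singleton_of_mem hσ]
      simp [hσ]
    · rw [Finset.inter_singleton_of_notMem hσ]
      simp [hσ]
  simp only [hmeas, smul_eq_mul, ite_mul, zero_mul, Finset.sum_ite_mem, Finset.univ_inter,
    ← Finset.mul_sum]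
  rw [mul_assoc, mul_comm _ (Fintype.card G : ℝ), h, inv_mul_cancel_left₀ hc]

theorem eventually_integral_exp_le_of_tilt {Ω : ℕ → Type*} [∀ n, Finite (Ω n)]
    [∀ n, MeasurableSpace (Ω n)] [∀ n, MeasurableSingletonClass (Ω n)]
    {μ : ∀ n, Measure (Ω n)} [∀ n, IsProbabilityMeasure (μ n)] {W q : ∀ n, Ω n → ℝ} {C : ℝ → ℝ}
    (hq : ∀ᶠ n in atTop, ∀ ω, |q n ω| ≤ 1)
    (h : ∀ θ < 0, ∃ s c : ℕ → ℝ, Tendsto s atTop (nhds θ) ∧ Tendsto c atTop (nhds (C θ)) ∧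
      Tendsto (fun n => ∫ ω, Real.exp (s n * W n ω + c n * q n ω) ∂(μ n)) atTop (nhds 1))
    {θ : ℝ} (hθ : θ < 0) :
    ∃ K, ∀ᶠ n in atTop, ∫ ω, Real.exp (θ * W n ω) ∂(μ n) ≤ K := by
  obtain ⟨s, c, hs, hc, hlim⟩ := h (θ - 1) (by linarith)
  refine ⟨1 + Real.exp (|C (θ - 1)| + 1) * 2, ?_⟩
  filter_upwards [hq, hs.eventually (gt_mem_nhds (show θ - 1 < θ by linarith)),
    hc.abs.eventually (gt_mem_nhds (lt_add_one _)),
    hlim.eventually (gt_mem_nhds one_lt_two)] with n hqn hsn hcn hln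
  have hcq : ∀ ω, -(c n * q n ω) ≤ |C (θ - 1)| + 1 := fun ω => by
    calc -(c n * q n ω) ≤ |c n * q n ω| := neg_le_abs _
      _ = |c n| * |q n ω| := abs_mul _ _
      _ ≤ |c n| * 1 := by gcongr; exact hqn ω
      _ ≤ _ := by linarith
  calc ∫ ω, Real.exp (θ * W n ω) ∂(μ n)
      ≤ ∫ ω, (1 + Real.exp (|C (θ - 1)| + 1) * Real.exp (s n * W n ω + c n * q n ω)) ∂(μ n) := by
        refine integral_mono Integrable.of_finite Integrable.of_finite fun ω => ?_
        refine (exp_mul_le_one_add_exp_mul hsn.le hθ.le).trans ?_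
        rw [← Real.exp_add]
        gcongr
        linarith [hcq ω]
    _ = 1 + Real.exp (|C (θ - 1)| + 1) * ∫ ω, Real.exp (s n * W n ω + c n * q n ω) ∂(μ n) := by
        rw [integral_add Integrable.of_finite Integrable.of_finite, integral_const_mul]; simp
    _ ≤ _ := by gcongr

/-- Removing from an exponential moment a bounded tilt that is asymptotically constant on the
scale of the variables. -/
theorem tendsto_integral_exp_of_tilt {Ω : ℕ → Type*} [∀ n, Finite (Ω n)]
    [∀ n, MeasurableSpace (Ω n)] [∀ n, MeasurableSingletonClass (Ω n)]
    {μ : ∀ n, Measure (Ω n)} [∀ n, IsProbabilityMeasure (μ n)] {W q : ∀ n, Ω n → ℝ} {C : ℝ → ℝ}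
    {ε r : ℕ → ℝ} {l : ℝ} (hε0 : ∀ n, 0 ≤ ε n) (hε : Tendsto ε atTop (nhds 0))
    (hr : Tendsto r atTop (nhds l))
    (hq : ∀ᶠ n in atTop, ∀ ω, |q n ω| ≤ 1) (hr1 : ∀ᶠ n in atTop, |r n| ≤ 1)
    (hqr : ∀ᶠ n in atTop, ∀ ω, |q n ω - r n| ≤ ε n * |W n ω|)
    (h : ∀ θ < 0, ∃ s c : ℕ → ℝ, Tendsto s atTop (nhds θ) ∧ Tendsto c atTop (nhds (C θ)) ∧
      Tendsto (fun n => ∫ ω, Real.exp (s n * W n ω + c n * q n ω) ∂(μ n)) atTop (nhds 1))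
    {θ : ℝ} (hθ : θ < 0) :
    ∃ s : ℕ → ℝ, Tendsto s atTop (nhds θ) ∧
      Tendsto (fun n => ∫ ω, Real.exp (s n * W n ω) ∂(μ n)) atTop
        (nhds (Real.exp (-(C θ * l)))) := by
  obtain ⟨s, c, hs, hc, hlim⟩ := h θ hθ
  obtain ⟨K, hK⟩ := eventually_integral_exp_le_of_tilt hq h (θ := 2 * θ - 1) (by linarith)
  refine ⟨s, hs, ?_⟩
  have hmain : Tendsto (fun n => Real.exp (-(c n * r n)) *
      ∫ ω, Real.exp (s n * W n ω + c n * q n ω) ∂(μ n)) atTop (nhds (Real.exp (-(C θ * l)))) := by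
    simpa using ((Real.continuous_exp.tendsto _).comp (hc.mul hr).neg).mul hlim
  refine tendsto_of_tendsto_of_dist hmain ?_
  have hD : Tendsto (fun n => Real.exp (2 * |c n|) * |c n| * ε n * (2 / (-θ) + K)) atTop
      (nhds 0) := by
    have h1 := (Real.continuous_exp.tendsto _).comp (hc.abs.const_mul 2)
    simpa using ((h1.mul hc.abs).mul hε).mul_const (2 / (-θ) + K)
  refine squeeze_zero' (Eventually.of_forall fun _ => dist_nonneg) ?_ hD
  filter_upwards [hq, hr1, hqr, hK, hs.eventually (Ioo_mem_nhds (show 2 * θ < θ by linarith)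
    (show θ < θ / 2 by linarith))] with n hqn hrn hqrn hKn hsn
  -- The tilt error is at most `|c n| * ε n * |W|`, and the factor `|W|` is absorbed by an
  -- exponential moment at the more negative argument `2θ - 1`.
  have hpt : ∀ ω, |Real.exp (-(c n * r n)) * Real.exp (s n * W n ω + c n * q n ω) -
      Real.exp (s n * W n ω)| ≤
      Real.exp (2 * |c n|) * |c n| * ε n * (2 / (-θ) + Real.exp ((2 * θ - 1) * W n ω)) := by
    intro ω
    have e1 : Real.exp (-(c n * r n)) * Real.exp (s n * W n ω + c n * q n ω) -
        Real.exp (s n * W n ω) =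
        Real.exp (s n * W n ω) * (Real.exp (c n * (q n ω - r n)) - 1) := by
      rw [mul_sub, ← Real.exp_add, ← Real.exp_add, mul_one]; ring_nf
    have e2 : c n * (q n ω - r n) ≤ 2 * |c n| := by
      have h2 : |q n ω - r n| ≤ 2 := (abs_sub _ _).trans (by linarith [hqn ω])
      calc c n * (q n ω - r n) ≤ |c n * (q n ω - r n)| := le_abs_self _
        _ = |c n| * |q n ω - r n| := abs_mul _ _
        _ ≤ |c n| * 2 := by gcongr
        _ = _ := mul_comm _ _
    have e3 := abs_exp_sub_one_le_mul (B := 2 * |c n|) (by positivity) e2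
    have e4 : |W n ω| * Real.exp (s n * W n ω) ≤
        2 / (-θ) + Real.exp ((2 * θ - 1) * W n ω) := by
      refine (abs_mul_exp_mul_le (s := 2 * θ - 1) (by linarith [hsn.1]) (by linarith [hsn.2])).trans
        (add_le_add ?_ ?_)
      · rw [div_le_div_iff₀ (by linarith [hsn.2]) (by linarith)]; linarith [hsn.2]
      · refine mul_le_of_le_one_left (Real.exp_pos _).le ?_
        rw [div_le_one (by linarith [hsn.1])]; linarith [hsn.1]
    rw [e1, abs_mul, Real.abs_exp]
    have hε1 := hε0 n
    calc Real.exp (s n * W n ω) * |Real.exp (c n * (q n ω - r n)) - 1|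
        ≤ Real.exp (s n * W n ω) * (Real.exp (2 * |c n|) * (|c n| * (ε n * |W n ω|))) := by
          gcongr
          refine e3.trans ?_
          rw [abs_mul]
          gcongr
          exact hqrn ω
      _ = Real.exp (2 * |c n|) * |c n| * ε n * (|W n ω| * Real.exp (s n * W n ω)) := by ring
      _ ≤ _ := by gcongr
  have hε1 := hε0 n
  rw [Real.dist_eq, ← integral_const_mul, ← integral_sub Integrable.of_finite Integrable.of_finite]
  calc |∫ ω, (Real.exp (-(c n * r n)) * Real.exp (s n * W n ω + c n * q n ω) -
        Real.exp (s n * W n ω)) ∂(μ n)|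
      ≤ ∫ ω, |Real.exp (-(c n * r n)) * Real.exp (s n * W n ω + c n * q n ω) -
        Real.exp (s n * W n ω)| ∂(μ n) := abs_integral_le_integral_abs
    _ ≤ ∫ ω, Real.exp (2 * |c n|) * |c n| * ε n *
        (2 / (-θ) + Real.exp ((2 * θ - 1) * W n ω)) ∂(μ n) :=
        integral_mono Integrable.of_finite Integrable.of_finite hpt
    _ = Real.exp (2 * |c n|) * |c n| * ε n *
        (2 / (-θ) + ∫ ω, Real.exp ((2 * θ - 1) * W n ω) ∂(μ n)) := by
        rw [integral_const_mul, integral_add Integrable.of_finite Integrable.of_finite]; simp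
    _ ≤ _ := by gcongr

/-- The number of peaks, centred and normalised for a proportion `A` of fixed points. -/
noncomputable def normalizedPeaks (A : ℝ) {n : ℕ} (σ : Equiv.Perm (Fin n)) : ℝ :=
  ((peaks σ : ℝ) - (1 - A ^ 3) / 3 * n) / Real.sqrt n

/-- The coefficient of `n ^ 5 / a ^ 4` in the difference of the limiting exponents of the label
ratios of a permutation with `(1 - u) * n / 2` peaks and of the identity on `A * n` points. -/
noncomputable def tiltCoeff (A u : ℝ) : ℝ := -1 / 320 + u / 64 - u ^ 2 / 32 + 3 * A ^ 5 / 160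

theorem abs_tiltCoeff_le_one {A u : ℝ} (hA : A ∈ Set.Icc (0 : ℝ) 1) (hu : u ∈ Set.Icc (0 : ℝ) 1) :
    |tiltCoeff A u| ≤ 1 := by
  have h1 : 0 ≤ A ^ 5 := pow_nonneg hA.1 5
  have h2 : A ^ 5 ≤ 1 := pow_le_one₀ hA.1 hA.2
  have h3 : u ^ 2 ≤ 1 := pow_le_one₀ hu.1 hu.2
  unfold tiltCoeff
  rw [abs_le]
  constructor <;> nlinarith [hu.1, hu.2, sq_nonneg u]

theorem abs_tiltCoeff_sub_le {A u v : ℝ} (hu : u ∈ Set.Icc (0 : ℝ) 1)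
    (hv : v ∈ Set.Icc (0 : ℝ) 1) : |tiltCoeff A u - tiltCoeff A v| ≤ |u - v| / 2 := by
  have : tiltCoeff A u - tiltCoeff A v = (u - v) * (1 / 64 - (u + v) / 32) := by
    unfold tiltCoeff; ring
  rw [this, abs_mul, div_eq_mul_inv]
  refine mul_le_mul_of_nonneg_left ?_ (abs_nonneg _)
  rw [abs_le]
  constructor <;> linarith [hu.1, hu.2, hv.1, hv.2]

theorem two_mul_peaks_le_sub_one {n : ℕ} (hn : 1 ≤ n) (σ : Equiv.Perm (Fin n)) :
    2 * peaks σ ≤ n - 1 := by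
  obtain ⟨i, rfl⟩ := Nat.exists_eq_add_of_le' hn
  simpa using two_mul_peaks_lt σ

theorem one_sub_two_mul_peaks_div_mem {n : ℕ} (hn : 1 ≤ n) (σ : Equiv.Perm (Fin n)) :
    1 - 2 * (peaks σ : ℝ) / n ∈ Set.Icc (0 : ℝ) 1 := by
  have h : (2 * peaks σ : ℝ) ≤ n := by
    exact_mod_cast (two_mul_peaks_le_sub_one hn σ).trans (Nat.sub_le _ _)
  have hn0 : (0 : ℝ) < n := by exact_mod_cast hn
  constructor
  · rw [sub_nonneg, div_le_one hn0]; exact h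
  · have : 0 ≤ 2 * (peaks σ : ℝ) / n := by positivity
    linarith

/-- This absorbs the off-by-one between `n - 1 - 2p` and `n - 2p`, and between `k - 1` and `k`. -/
theorem abs_ratioExponent_sub_le {n k m m' a : ℝ} (ha : 0 < a) (hk0 : 0 ≤ k) (hk : k ≤ n)
    (hm0 : 0 ≤ m) (hm : m ≤ n) (hm0' : 0 ≤ m') (hm' : m' ≤ n) (h : |m - m'| ≤ 1) :
    |ratioExponent a k m - ratioExponent a k m'| ≤ (n / a) ^ 2 + (n / a) ^ 4 := by
  have hn : 0 ≤ n := hk0.trans hk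
  have e : ratioExponent a k m - ratioExponent a k m' =
      (m - m') * (k ^ 2 / (8 * a ^ 2) + k ^ 3 * (k / 64 - (m + m') / 32) / a ^ 4) := by
    unfold ratioExponent; field_simp; ring
  have h2 : |k / 64 - (m + m') / 32| ≤ n := by
    rw [abs_le]; constructor <;> linarith
  rw [e, abs_mul]
  calc |m - m'| * |k ^ 2 / (8 * a ^ 2) + k ^ 3 * (k / 64 - (m + m') / 32) / a ^ 4|
      ≤ 1 * (|k ^ 2 / (8 * a ^ 2)| + |k ^ 3 * (k / 64 - (m + m') / 32) / a ^ 4|) := by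
        gcongr; exact abs_add_le _ _
    _ = k ^ 2 / (8 * a ^ 2) + k ^ 3 * |k / 64 - (m + m') / 32| / a ^ 4 := by
        rw [one_mul, abs_of_nonneg (by positivity), abs_div, abs_mul,
          abs_of_nonneg (pow_nonneg hk0 3), abs_of_nonneg (pow_nonneg ha.le 4)]
    _ ≤ n ^ 2 / (1 * a ^ 2) + n ^ 3 * n / a ^ 4 := by gcongr; norm_num
    _ = _ := by rw [div_pow, div_pow, one_mul]; ring

/-- The source of the centring: the terms in `a⁻²` are linear in `p` and vanish exactly at `p = (1 -
(k/n)^3) n / 3`. The terms in `a⁻⁴` form the tilt. -/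
theorem ratioExponent_sub_eq {n a : ℝ} (hn : 0 < n) (ha : a ≠ 0) (k p : ℝ) :
    ratioExponent a n (n - 2 * p) - ratioExponent a k k =
      -(n ^ 2 * Real.sqrt n / (4 * a ^ 2)) *
        ((p - (1 - (k / n) ^ 3) / 3 * n) / Real.sqrt n) +
      n ^ 5 / a ^ 4 * tiltCoeff (k / n) (1 - 2 * p / n) := by
  have hs : Real.sqrt n ≠ 0 := (Real.sqrt_pos.2 hn).ne'
  have hn' := hn.ne'
  unfold ratioExponent tiltCoeff
  field_simp
  ring

/-- Three errors multiply: the double count, the exponential approximation of both label ratios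
(relative error `δ`), and the off-by-one in the exponents. -/
theorem integral_exp_bounds {n a : ℕ} {K : ℝ} (hn : 1 ≤ n) (ha : 4 * n ≤ a) (hK1 : 1 ≤ K)
    (hK : (n : ℝ) ^ 5 ≤ K * a ^ 4) (τ : Equiv.Perm (Fin n)) {x δ : ℝ} (hx : x = n / a)
    (hδ : δ = Real.exp (5 * K) * (7 * K * x)) (hδ1 : δ < 1) {I : ℝ}
    (hI : I = ∫ σ, Real.exp (-((n : ℝ) ^ 2 * Real.sqrt n / (4 * a ^ 2)) *
        normalizedPeaks (numFixedPoints τ / n) σ + n ^ 5 / a ^ 4 *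
          tiltCoeff (numFixedPoints τ / n) (1 - 2 * peaks σ / n))
      ∂(uniformOn (ConjClasses.mk τ).carrier)) :
    (1 - (x + x ^ 2 / 4)) * ((1 - δ) / (1 + δ)) * Real.exp (-(2 * (x ^ 2 + x ^ 4))) ≤ I ∧
      I ≤ Real.exp (x / 2 + x ^ 2 / 4) * ((1 + δ) / (1 - δ)) * Real.exp (2 * (x ^ 2 + x ^ 4)) := by
  set k := numFixedPoints τ with hk
  set μ := uniformOn (ConjClasses.mk τ).carrier with hμ
  have hμp : IsProbabilityMeasure μ :=
    isProbabilityMeasure_uniformOn (Set.toFinite _) ⟨τ, ConjClasses.mem_carrier_mk⟩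
  have hn0 : (0 : ℝ) < n := by exact_mod_cast hn
  have ha0 : 0 < a := by omega
  have haR : (0 : ℝ) < a := by exact_mod_cast ha0
  have hkn : k ≤ n := (Finset.card_le_univ _).trans (by simp)
  have hx0 : 0 ≤ x := by rw [hx]; positivity
  have hδ0 : 0 ≤ δ := by rw [hδ]; positivity
  have hx4 : x ≤ 1 / 4 := by
    rw [hx, div_le_div_iff₀ haR (by norm_num)]
    have : (4 * n : ℝ) ≤ a := by exact_mod_cast ha
    linarith
  set R := labelRatio a k (k - 1) with hR
  set F := Real.exp (ratioExponent a k ((k - 1 : ℕ) : ℝ)) with hF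
  set L : Equiv.Perm (Fin n) → ℝ := fun σ => labelRatio a n (n - 1 - 2 * peaks σ) with hL
  set E : Equiv.Perm (Fin n) → ℝ := fun σ =>
    Real.exp (ratioExponent a n ((n - 1 - 2 * peaks σ : ℕ) : ℝ)) with hE
  have hclose : ∀ k' m : ℕ, k' ≤ n → m ≤ n →
      (1 - δ) * Real.exp (ratioExponent a k' m) ≤ labelRatio a k' m ∧
      labelRatio a k' m ≤ (1 + δ) * Real.exp (ratioExponent a k' m) := by
    intro k' m h1 h2
    have h3 := abs_labelRatio_mul_exp_sub_one_le hn h1 h2 (by exact_mod_cast ha) hK1 hK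
    rw [← hx, ← hδ, abs_le, Real.exp_neg, ← div_eq_mul_inv] at h3
    constructor
    · rw [← le_div_iff₀ (Real.exp_pos _)]; linarith
    · rw [← div_le_iff₀ (Real.exp_pos _)]; linarith
  have hRF := hclose k (k - 1) hkn ((Nat.sub_le _ _).trans hkn)
  have hLE : ∀ σ, (1 - δ) * E σ ≤ L σ ∧ L σ ≤ (1 + δ) * E σ := fun σ =>
    hclose n _ le_rfl (by omega)
  have hav := labelRatio_average_bounds (n := n) (a := a) (by omega) ha0 τ
  have hint := integral_uniformOn_carrier τ L
  rw [Fintype.card_perm, Fintype.card_fin, ← hμ] at hint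
  rw [← hint] at hav
  have hIL1 : (1 - δ) * ∫ σ, E σ ∂μ ≤ ∫ σ, L σ ∂μ := by
    rw [← integral_const_mul]
    exact integral_mono Integrable.of_finite Integrable.of_finite fun σ => (hLE σ).1
  have hIL2 : ∫ σ, L σ ∂μ ≤ (1 + δ) * ∫ σ, E σ ∂μ := by
    rw [← integral_const_mul]
    exact integral_mono Integrable.of_finite Integrable.of_finite fun σ => (hLE σ).2
  set η := 2 * (x ^ 2 + x ^ 4) with hη
  have hexp : ∀ σ : Equiv.Perm (Fin n), |ratioExponent a n ((n - 1 - 2 * peaks σ : ℕ) : ℝ) -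
      ratioExponent a k ((k - 1 : ℕ) : ℝ) - (-((n : ℝ) ^ 2 * Real.sqrt n / (4 * a ^ 2)) *
        normalizedPeaks (k / n) σ + n ^ 5 / a ^ 4 * tiltCoeff (k / n) (1 - 2 * peaks σ / n))| ≤
      η := by
    intro σ
    have hp := two_mul_peaks_le_sub_one hn σ
    have hpR : (2 * peaks σ : ℝ) ≤ n - 1 := by
      have : 2 * peaks σ + 1 ≤ n := by omega
      have : (2 * peaks σ + 1 : ℝ) ≤ n := by exact_mod_cast this
      linarith
    have hc1 : ((n - 1 - 2 * peaks σ : ℕ) : ℝ) = n - 1 - 2 * peaks σ := by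
      rw [Nat.cast_sub hp, Nat.cast_sub hn]; push_cast; ring
    -- Only an inequality, because the truncated subtraction gives 0 when there are no fixed points.
    have hc2 : (k : ℝ) - 1 ≤ ((k - 1 : ℕ) : ℝ) := by
      have : k ≤ (k - 1) + 1 := by omega
      have : (k : ℝ) ≤ ((k - 1 : ℕ) : ℝ) + 1 := by exact_mod_cast this
      linarith
    have hc3 : ((k - 1 : ℕ) : ℝ) ≤ k := by exact_mod_cast Nat.sub_le _ _
    have hknR : (k : ℝ) ≤ n := by exact_mod_cast hkn
    have h1 := abs_ratioExponent_sub_le (n := n) (k := n) (m := n - 1 - 2 * peaks σ)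
      (m' := n - 2 * peaks σ) haR hn0.le le_rfl (by linarith)
      (by linarith [(peaks σ).cast_nonneg (α := ℝ)]) (by linarith)
      (by linarith [(peaks σ).cast_nonneg (α := ℝ)]) (by rw [abs_le]; constructor <;> linarith)
    have h2 := abs_ratioExponent_sub_le (n := n) (k := k) (m := ((k - 1 : ℕ) : ℝ))
      (m' := k) haR k.cast_nonneg hknR (Nat.cast_nonneg _) (hc3.trans hknR) (Nat.cast_nonneg _)
      hknR (by rw [abs_le]; constructor <;> linarith)
    rw [← hx] at h1 h2
    rw [normalizedPeaks, ← ratioExponent_sub_eq hn0 haR.ne' (k : ℝ) (peaks σ), hc1, hη]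
    rw [abs_le] at h1 h2 ⊢
    constructor <;> linarith [h1.1, h1.2, h2.1, h2.2]
  have hI1 : I ≤ Real.exp η * ((∫ σ, E σ ∂μ) / F) := by
    rw [hI, ← integral_div, ← integral_const_mul]
    refine integral_mono Integrable.of_finite Integrable.of_finite fun σ => ?_
    simp only [hE, hF]
    rw [← Real.exp_sub, ← Real.exp_add, Real.exp_le_exp]
    linarith [(abs_le.1 (hexp σ)).1]
  have hI2 : Real.exp (-η) * ((∫ σ, E σ ∂μ) / F) ≤ I := by
    rw [hI, ← integral_div, ← integral_const_mul]
    refine integral_mono Integrable.of_finite Integrable.of_finite fun σ => ?_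
    simp only [hE, hF]
    rw [← Real.exp_sub, ← Real.exp_add, Real.exp_le_exp]
    linarith [(abs_le.1 (hexp σ)).2]
  have hF0 : 0 < F := Real.exp_pos _
  have hlow : 1 - (n : ℝ) * (1 / a + n / (2 * a) ^ 2) = 1 - (x + x ^ 2 / 4) := by
    rw [hx]; field_simp; ring
  have hupp : (1 + (1 / (2 * (a : ℝ)) + n / (2 * a) ^ 2)) ^ n ≤ Real.exp (x / 2 + x ^ 2 / 4) := by
    calc (1 + (1 / (2 * (a : ℝ)) + n / (2 * a) ^ 2)) ^ n
        ≤ (Real.exp (1 / (2 * (a : ℝ)) + n / (2 * a) ^ 2)) ^ n := by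
          gcongr; linarith [Real.add_one_le_exp (1 / (2 * (a : ℝ)) + n / (2 * a) ^ 2)]
      _ = _ := by
          rw [← Real.exp_nat_mul, hx]; congr 1; field_simp; ring
  rw [hlow] at hav
  have hR0 : 0 ≤ R := (mul_nonneg (by linarith) hF0.le).trans hRF.1
  have hl0 : 0 ≤ 1 - (x + x ^ 2 / 4) := by nlinarith
  constructor
  · rw [mul_comm]
    refine le_trans ?_ hI2
    gcongr
    rw [le_div_iff₀ hF0, mul_assoc, div_mul_eq_mul_div, mul_div_assoc', div_le_iff₀ (by linarith)]
    calc _ ≤ (1 - (x + x ^ 2 / 4)) * R := by gcongr; exact hRF.1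
      _ ≤ _ := by linarith [hav.1]
  · rw [mul_comm]
    refine hI1.trans ?_
    gcongr
    rw [div_le_iff₀ hF0, mul_assoc, div_mul_eq_mul_div, mul_div_assoc', le_div_iff₀ (by linarith)]
    calc _ ≤ _ := by rw [mul_comm]; exact hIL1
      _ ≤ _ := hav.2
      _ ≤ Real.exp (x / 2 + x ^ 2 / 4) * R := by gcongr
      _ ≤ _ := by gcongr; exact hRF.2


/-! ### The critical scale and the limit theorem -/

/-- The witness is `⌈b * n^(5/4)⌉`: at this order the coefficients of the linear and quadratic parts
of the exponent both have positive finite limits, while `n / a` vanishes. -/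
theorem exists_scale {b : ℝ} (hb : 0 < b) : ∃ a : ℕ → ℕ,
    Tendsto (fun n : ℕ => (n : ℝ) ^ 2 * Real.sqrt n / (4 * (a n : ℝ) ^ 2)) atTop
      (nhds (1 / (4 * b ^ 2))) ∧
    Tendsto (fun n : ℕ => (n : ℝ) ^ 5 / (a n : ℝ) ^ 4) atTop (nhds (1 / b ^ 4)) ∧
    Tendsto (fun n : ℕ => (n : ℝ) / a n) atTop (nhds 0) ∧ ∀ᶠ n in atTop, 0 < a n := by
  set v : ℕ → ℝ := fun n => (n : ℝ) ^ (1 / 4 : ℝ) with hv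
  have hvt : Tendsto v atTop atTop :=
    (tendsto_rpow_atTop (by norm_num)).comp tendsto_natCast_atTop_atTop
  have hv4 : ∀ n : ℕ, (n : ℝ) = v n ^ 4 := fun n => by
    rw [hv, ← Real.rpow_natCast, ← Real.rpow_mul (by positivity)]; norm_num
  have hv0 : ∀ n, 0 ≤ v n := fun n => by positivity
  have hvs : ∀ n : ℕ, Real.sqrt n = v n ^ 2 := fun n => by
    rw [hv4, show v n ^ 4 = (v n ^ 2) ^ 2 by ring, Real.sqrt_sq (by positivity)]
  have hv5 : Tendsto (fun n => v n ^ 5) atTop atTop := (tendsto_pow_atTop (by norm_num)).comp hvt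
  have ht : Tendsto (fun n => (⌈b * v n ^ 5⌉₊ : ℝ) / v n ^ 5) atTop (nhds b) :=
    (tendsto_nat_ceil_mul_div_atTop hb.le).comp hv5
  have hpos : ∀ᶠ n in atTop, 0 < v n := hvt.eventually_gt_atTop 0
  refine ⟨fun n => ⌈b * v n ^ 5⌉₊, ?_, ?_, ?_, ?_⟩
  · refine (((ht.pow 2).const_mul 4).inv₀ (by positivity)).congr' ?_ |>.trans (by simp)
    filter_upwards [hpos] with n hn
    rw [hvs, hv4 n]
    field_simp
  · refine ((ht.pow 4).inv₀ (by positivity)).congr' ?_ |>.trans (by simp)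
    filter_upwards [hpos] with n hn
    rw [hv4 n]
    field_simp
  · have := (ht.inv₀ hb.ne').mul hvt.inv_tendsto_atTop
    rw [mul_zero] at this
    refine this.congr' ?_
    filter_upwards [hpos] with n hn
    rw [hv4 n]
    simp only [Pi.inv_apply]
    field_simp
  · filter_upwards [hpos] with n hn
    exact Nat.ceil_pos.2 (by positivity)

theorem numFixedPoints_div_mem {n : ℕ} (τ : Equiv.Perm (Fin n)) :
    (numFixedPoints τ : ℝ) / n ∈ Set.Icc (0 : ℝ) 1 := by
  have hkn : numFixedPoints τ ≤ n := (Finset.card_le_univ _).trans (by simp)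
  exact ⟨by positivity, div_le_one_of_le₀ (by exact_mod_cast hkn) n.cast_nonneg⟩

/-- The scale is chosen with `1 / (4 b²) = -θ`, which is possible exactly for negative `θ`; the
coefficient of the tilt then tends to `1 / b⁴ = 16 θ²`. -/
theorem tendsto_integral_exp_tilted_peaks (τ : ∀ n, Equiv.Perm (Fin n)) {θ : ℝ} (hθ : θ < 0) :
    ∃ s c : ℕ → ℝ, Tendsto s atTop (nhds θ) ∧ Tendsto c atTop (nhds (16 * θ ^ 2)) ∧
      Tendsto (fun n => ∫ σ, Real.exp (s n * normalizedPeaks (numFixedPoints (τ n) / n) σ +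
          c n * tiltCoeff (numFixedPoints (τ n) / n) (1 - 2 * peaks σ / n))
        ∂(uniformOn (ConjClasses.mk (τ n)).carrier)) atTop (nhds 1) := by
  have hθ4 : 0 < 1 / (4 * (-θ)) := by
    have : 0 < -θ := by linarith
    positivity
  set b := Real.sqrt (1 / (4 * (-θ))) with hb
  have hb0 : 0 < b := Real.sqrt_pos.2 hθ4
  have hb2 : b ^ 2 = 1 / (4 * (-θ)) := Real.sq_sqrt hθ4.le
  obtain ⟨a, h1, h2, h3, h4⟩ := exists_scale hb0
  have e1 : -(1 / (4 * b ^ 2)) = θ := by rw [hb2]; field_simp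
  have e2 : 1 / b ^ 4 = 16 * θ ^ 2 := by
    rw [show b ^ 4 = (b ^ 2) ^ 2 by ring, hb2]; field_simp; ring
  refine ⟨_, _, e1 ▸ h1.neg, e2 ▸ h2, ?_⟩
  set K := 16 * θ ^ 2 + 1 with hK
  have hKe : ∀ᶠ n : ℕ in atTop, (n : ℝ) ^ 5 / (a n : ℝ) ^ 4 < K :=
    h2.eventually (gt_mem_nhds (by rw [e2]; exact lt_add_one _))
  have hδ : Tendsto (fun n : ℕ => Real.exp (5 * K) * (7 * K * ((n : ℝ) / a n))) atTop
      (nhds 0) := by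
    simpa using (h3.const_mul (7 * K)).const_mul (Real.exp (5 * K))
  have hlow : Tendsto (fun n : ℕ =>
      (1 - ((n : ℝ) / a n + ((n : ℝ) / a n) ^ 2 / 4)) *
        ((1 - Real.exp (5 * K) * (7 * K * ((n : ℝ) / a n))) /
          (1 + Real.exp (5 * K) * (7 * K * ((n : ℝ) / a n)))) *
        Real.exp (-(2 * (((n : ℝ) / a n) ^ 2 + ((n : ℝ) / a n) ^ 4)))) atTop (nhds 1) := by
    have t1 := (h3.add ((h3.pow 2).div_const 4)).const_sub 1
    have t2 := (hδ.const_sub 1).div (hδ.const_add 1) (by norm_num)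
    have t3 := (Real.continuous_exp.tendsto _).comp (((h3.pow 2).add (h3.pow 4)).const_mul 2).neg
    simpa using (t1.mul t2).mul t3
  have hupp : Tendsto (fun n : ℕ =>
      Real.exp ((n : ℝ) / a n / 2 + ((n : ℝ) / a n) ^ 2 / 4) *
        ((1 + Real.exp (5 * K) * (7 * K * ((n : ℝ) / a n))) /
          (1 - Real.exp (5 * K) * (7 * K * ((n : ℝ) / a n)))) *
        Real.exp (2 * (((n : ℝ) / a n) ^ 2 + ((n : ℝ) / a n) ^ 4))) atTop (nhds 1) := by
    have t1 := (Real.continuous_exp.tendsto _).comp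
      ((h3.div_const 2).add ((h3.pow 2).div_const 4))
    have t2 := (hδ.const_add 1).div (hδ.const_sub 1) (by norm_num)
    have t3 := (Real.continuous_exp.tendsto _).comp (((h3.pow 2).add (h3.pow 4)).const_mul 2)
    simpa using (t1.mul t2).mul t3
  have hK1 : 1 ≤ K := by rw [hK]; nlinarith [sq_nonneg θ]
  have hgood : ∀ᶠ n in atTop, 1 ≤ n ∧ 4 * n ≤ a n ∧ (n : ℝ) ^ 5 ≤ K * (a n : ℝ) ^ 4 ∧
      Real.exp (5 * K) * (7 * K * ((n : ℝ) / a n)) < 1 := by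
    filter_upwards [eventually_ge_atTop 1, h4, hKe, hδ.eventually (gt_mem_nhds one_pos),
      h3.eventually (gt_mem_nhds (show (0 : ℝ) < 1 / 4 by norm_num))] with n hn han hKn hδn hxn
    have haR : (0 : ℝ) < a n := by exact_mod_cast han
    refine ⟨hn, ?_, ?_, hδn⟩
    · rw [div_lt_div_iff₀ haR (by norm_num)] at hxn
      have : (4 * n : ℝ) ≤ a n := by linarith
      exact_mod_cast this
    · rw [div_lt_iff₀ (by positivity)] at hKn
      exact hKn.le
  exact tendsto_of_tendsto_of_tendsto_of_le_of_le' hlow hupp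
    (hgood.mono fun n h => (integral_exp_bounds h.1 h.2.1 hK1 h.2.2.1 (τ n) rfl rfl h.2.2.2 rfl).1)
    (hgood.mono fun n h => (integral_exp_bounds h.1 h.2.1 hK1 h.2.2.1 (τ n) rfl rfl h.2.2.2 rfl).2)

/-- At the centring value the argument `1 - 2p/n` of the tilt equals `(1 + 2A³)/3`, and in general
it deviates from this by `2 |W| / √n`. The variance is thus `-32` times the tilt coefficient at `u =
(1 + 2α³)/3`. -/
theorem tendsto_integral_exp_normalizedPeaks (τ : ∀ n, Equiv.Perm (Fin n)) {α : ℝ}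
    (hα : Tendsto (fun n => (numFixedPoints (τ n) : ℝ) / n) atTop (nhds α)) {θ : ℝ} (hθ : θ < 0) :
    ∃ s : ℕ → ℝ, Tendsto s atTop (nhds θ) ∧
      Tendsto (fun n => ∫ σ, Real.exp (s n * normalizedPeaks (numFixedPoints (τ n) / n) σ)
        ∂(uniformOn (ConjClasses.mk (τ n)).carrier)) atTop
        (nhds (Real.exp (peakVariance α * θ ^ 2 / 2))) := by
  have hprob : ∀ n, IsProbabilityMeasure (uniformOn (ConjClasses.mk (τ n)).carrier) := fun n =>
    isProbabilityMeasure_uniformOn (Set.toFinite _) ⟨τ n, ConjClasses.mem_carrier_mk⟩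
  have hmem : ∀ n, (1 + 2 * ((numFixedPoints (τ n) : ℝ) / n) ^ 3) / 3 ∈ Set.Icc (0 : ℝ) 1 := by
    intro n
    obtain ⟨h0, h1⟩ := numFixedPoints_div_mem (τ n)
    have h2 := pow_nonneg h0 3
    have h3 : ((numFixedPoints (τ n) : ℝ) / n) ^ 3 ≤ 1 := pow_le_one₀ h0 h1
    constructor <;> linarith
  have hvar : peakVariance α * θ ^ 2 / 2 =
      -(16 * θ ^ 2 * tiltCoeff α ((1 + 2 * α ^ 3) / 3)) := by
    unfold peakVariance tiltCoeff; ring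
  rw [hvar]
  refine tendsto_integral_exp_of_tilt (C := fun θ => 16 * θ ^ 2)
    (W := fun n => normalizedPeaks (numFixedPoints (τ n) / n))
    (q := fun n σ => tiltCoeff (numFixedPoints (τ n) / n) (1 - 2 * peaks σ / n))
    (ε := fun n => 1 / Real.sqrt n)
    (r := fun n => tiltCoeff (numFixedPoints (τ n) / n)
      ((1 + 2 * ((numFixedPoints (τ n) : ℝ) / n) ^ 3) / 3))
    (fun n => by positivity) ?_ ?_ ?_ ?_ ?_ (fun θ hθ => tendsto_integral_exp_tilted_peaks τ hθ) hθ
  · have : Tendsto (fun n : ℕ => Real.sqrt n) atTop atTop :=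
      Real.tendsto_sqrt_atTop.comp tendsto_natCast_atTop_atTop
    simp only [one_div]
    exact this.inv_tendsto_atTop
  · have : Continuous fun A : ℝ => tiltCoeff A ((1 + 2 * A ^ 3) / 3) := by
      unfold tiltCoeff; fun_prop
    exact (this.tendsto α).comp hα
  · filter_upwards [eventually_ge_atTop 1] with n hn σ
    exact abs_tiltCoeff_le_one (numFixedPoints_div_mem _) (one_sub_two_mul_peaks_div_mem hn σ)
  · exact Eventually.of_forall fun n => abs_tiltCoeff_le_one (numFixedPoints_div_mem _) (hmem n)
  · filter_upwards [eventually_ge_atTop 1] with n hn σ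
    have hn0 : (0 : ℝ) < n := by exact_mod_cast hn
    have hs : 0 < Real.sqrt n := Real.sqrt_pos.2 hn0
    refine (abs_tiltCoeff_sub_le (one_sub_two_mul_peaks_div_mem hn σ) (hmem n)).trans_eq ?_
    have e : 1 - 2 * (peaks σ : ℝ) / n - (1 + 2 * ((numFixedPoints (τ n) : ℝ) / n) ^ 3) / 3 =
        -(2 / Real.sqrt n) * normalizedPeaks (numFixedPoints (τ n) / n) σ := by
      rw [normalizedPeaks, neg_mul, div_mul_div_comm, Real.mul_self_sqrt hn0.le]
      field_simp
      ring
    rw [e, abs_mul, abs_neg, abs_of_pos (by positivity)]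
    ring

theorem theorem1
    (C : ∀ n : ℕ, ConjClasses (Equiv.Perm (Fin n)))
    (α : ℝ) (hα : α ∈ Set.Icc (0 : ℝ) 1)
    (hC : Tendsto (fun n => fixedPointDensity (C n)) atTop (nhds α))
    {Ω : ℕ → Type*} [∀ n, MeasurableSpace (Ω n)]
    (P : ∀ n, Measure (Ω n)) [∀ n, IsProbabilityMeasure (P n)]
    (π : ∀ n, Ω n → Equiv.Perm (Fin n))
    (hπ : ∀ n, HasLaw (π n) (uniformOn (C n).carrier) (P n)) :
    TendstoInDistribution
      (fun (n : ℕ) (ω : Ω n) =>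
        ((peaks (π n ω) : ℝ) - (1 - fixedPointDensity (C n) ^ 3) / 3 * n) / Real.sqrt n)
      atTop (id : ℝ → ℝ) P
      (gaussianReal 0 (peakVarianceNN α hα)) := by
  choose τ hτ using fun n => ConjClasses.exists_rep (C n)
  obtain rfl : (fun n => ConjClasses.mk (τ n)) = C := funext hτ
  have hmeas : ∀ n, AEMeasurable (fun ω => normalizedPeaks (numFixedPoints (τ n) / n) (π n ω))
      (P n) := fun n =>
    (measurable_of_finite (normalizedPeaks _)).comp_aemeasurable (hπ n).aemeasurable
  have hmap : ∀ n, (P n).map (fun ω => normalizedPeaks (numFixedPoints (τ n) / n) (π n ω)) =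
      (uniformOn (ConjClasses.mk (τ n)).carrier).map
        (normalizedPeaks (numFixedPoints (τ n) / n)) := fun n => by
    rw [← (hπ n).map_eq, AEMeasurable.map_map_of_aemeasurable (measurable_of_finite _).aemeasurable
      (hπ n).aemeasurable]
    rfl
  have hprob : ∀ n, IsProbabilityMeasure (uniformOn (ConjClasses.mk (τ n)).carrier) := fun n =>
    isProbabilityMeasure_uniformOn (Set.toFinite _) ⟨τ n, ConjClasses.mem_carrier_mk⟩
  refine ⟨hmeas, aemeasurable_id, ?_⟩
  have hlim : Tendsto (β := ProbabilityMeasure ℝ) (fun n => ⟨(P n).map (fun ω =>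
      normalizedPeaks (numFixedPoints (τ n) / n) (π n ω)),
      Measure.isProbabilityMeasure_map (hmeas n)⟩) atTop
      (nhds ⟨gaussianReal 0 (peakVarianceNN α hα), inferInstance⟩) := by
    refine tendsto_gaussianReal_of_tendsto_integral_exp (fun n θ => ?_) fun θ hθ => ?_
    · change Integrable _ ((P n).map _)
      rw [hmap, integrable_map_measure (by fun_prop) (measurable_of_finite _).aemeasurable]
      exact Integrable.of_finite
    · obtain ⟨s, hs, h⟩ := tendsto_integral_exp_normalizedPeaks τ hC hθ
      refine ⟨s, hs, h.congr fun n => ?_⟩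
      change _ = ∫ x, Real.exp (s n * x) ∂((P n).map _)
      rw [hmap, integral_map (measurable_of_finite _).aemeasurable (by fun_prop)]
  have hid : (⟨gaussianReal 0 (peakVarianceNN α hα), inferInstance⟩ : ProbabilityMeasure ℝ) =
      ⟨(gaussianReal 0 (peakVarianceNN α hα)).map id,
        Measure.isProbabilityMeasure_map aemeasurable_id⟩ :=
    Subtype.ext Measure.map_id.symm
  rw [hid] at hlim
  exact hlim
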